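/- **Setting.** Let $n\ge 2$, $N=n+1$, let $k=(k_1,\dots,k_n)$ be positive integers, $m_i=\sum_{j=i}^n k_j$ for $1\le i\le n$, $m_N=0$, $m=m_1$, and let $\lambda=(\lambda_1,\lambda_N)\subset\mathbb R$ be a bounded open interval. Put $x(\ell)=\mathrm{diag}\left(-\frac{\ell-1}4,-\frac{\ell-3}4,\dots,\frac{\ell-1}4\right)$, and let $y(\ell)$ be the $\ell\times\ell$ matrix with ones directly below the diagonal and zeros elsewhere. Set $x_1=-x(m)$, $y_1=y(m)^T$, $x_N=\mathrm{diag}(x(k_n),\dots,x(k_1))$, $y_N=\mathrm{diag}(y(k_n),\dots,y(k_1))$. Block matrices near $\lambda_N$ have diagonal blocks of sizes $k_n,\dots,k_1$, so the $i$-th block has size $k_{N-i}$ and occupies the indices $m_{N+1-i}+1,\dots,m_{N-i}$. A *$k$-Nahm complex* is a tuple $((\alpha,\beta),v)$ of smooth maps $\alpha,\beta:\lambda\to\mathfrak{gl}_m(\mathbb C)$ with $\dot\beta+2[\alpha,\beta]=0$ and $v=(v_1,\dots,v_N)\in(\mathbb C^m)^*\times(\mathbb C^m)^n$ such that 1. $\alpha,\beta$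 are meromorphic near $\lambda_1$ with at most first order poles at $\lambda_1$ and residues conjugate under $\mathrm{GL}_m(\mathbb C)$ to $x_1$ and $y_1$, respectively; 2. there is $g\in \mathrm{GL}_m(\mathbb C)$ such that, for $z<0$ of small modulus, $g\alpha(\lambda_N+z)g^{-1}-\frac{x_N}z$ and $g\beta(\lambda_N+z)g^{-1}-\frac{y_N}z$ are block matrices whose $(i,j)$-block is $z^{|k_{N-i}-k_{N-j}|/2}\,O(1)$; 3. $v_1^T$ lies in the $\frac{m-1}4$-eigenspace of $\mathrm{res}_{\lambda_1}(\alpha)^T$ and is cyclic for $\mathrm{res}_{\lambda_1}(\beta)^T$; 4. for $1\le i\le n$, $v_{i+1}$ lies in the $-\frac{k_i-1}4$-eigenspace of $\mathrm{res}_{\lambda_N}(\alpha)$ and $\mathrm{res}_{\lambda_N}(\beta)^{k_i}v_{i+1}=0$; moreover the matrix with columns $v_N,\dots,\mathrm{res}_{\lambda_N}(\beta)^{k_n-1}v_N,\dots,v_2,\dots,\mathrm{res}_{\lambda_N}(\beta)^{k_1-1}v_2$ is invertible. Here $\mathrm{res}_{\lambda_N}$ is the coefficient of $(t-\lambda_N)^{-1}$.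 Let $\mathcal G$ be the group of smooth maps $g:\lambda\to \mathrm{GL}_m(\mathbb C)$ that extend continuously and invertibly to $[\lambda_1,\lambda_N]$. It acts by $g.\alpha=g\alpha g^{-1}-\frac12\dot gg^{-1}$, $g.\beta=g\beta g^{-1}$ and $g.v=(v_1g(\lambda_1)^{-1},g(\lambda_N)v_2,\dots,g(\lambda_N)v_N)$. Two $k$-Nahm complexes are *equivalent* if some $g\in\mathcal G$ takes one to the other. **Proposition (normal form).** Let $((\alpha,\beta),v)$ be a $k$-Nahm complex. (a) $(\alpha,\beta)$ is locally equivalent to $(0,\beta_0)$ with $\beta_0$ constant: for every compact interval $[a,b]\subset\lambda$ there are $g\in\mathcal G$ and a constant matrix $\beta_0$ with $g.\alpha=0$ and $g.\beta=\beta_0$ on $[a,b]$. (b) $((\alpha,\beta),v)$ is equivalent to a $k$-Nahm complex $((\alpha_{\mathrm{st}},\beta_{\mathrm{st}}),v_{\mathrm{st}})$ with the following properties. * There is $q\in\mathbb C^m$ such that for small $z>0$ $$(g_{\mathrm{st}}.\alpha_{\mathrm{st}})(\lambda_1+z)=-\frac{x_1}z,\qquad \beta_{\mathrm{st}}(\lambda_1+z)=\begin{pmatrix}0&&&-z^{m-1}q_1\\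 z^{-1}&\ddots&&\vdots\\&\ddots&0&-zq_{m-1}\\&&z^{-1}&-q_m\end{pmatrix}^T,$$ where $g_{\mathrm{st}}(\lambda_1+z)$ is the $m\times m$ matrix whose $(a,b)$-entry is $z^{m+1-a-b}q_{a+b}$ if $a+b\le m$, $1$ if $a+b=m+1$, and $0$ if $a+b>m+1$. * For $z<0$ of small modulus, $\alpha_{\mathrm{st}}(\lambda_N+z)=\frac{x_N}z$. * There is $C\in\mathrm{Mat}_{m\times n}(\mathbb C)$ such that for $z<0$ of small modulus (with principal powers of $z$) $\beta_{\mathrm{st}}(\lambda_N+z)$ has $(i,i)$-block with $z^{-1}$ directly below the diagonal, last column $\left(z^{k_{N-i}-1}C_{(m_{N+1-i}+1)i},\dots,C_{m_{N-i}i}\right)^T$ and zeros elsewhere; and, for $i\ne j$, $(i,j)$-block with last column $$\left(z^{\frac{k_{N-j}+k_{N-i}}2-1}C_{(m_{N+1-i}+1)j},\ \dots,\ z^{\frac{k_{N-j}-k_{N-i}}2}C_{m_{N-i}j}\right)^T$$ (the exponent decreasing by $1$ from each row to the next) and zeros elsewhere. Moreover, for $i\neq j$, this $(i,j)$-block is $z^{|k_{N-i}-k_{N-j}|/2}\,O(1)$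 as $z\nearrow0$. * $v_{\mathrm{st}}=(e_1^T,e_{m_2+1},e_{m_3+1},\dots,e_{m_N+1})$, that is $(v_{\mathrm{st}})_{i+1}=e_{m_{i+1}+1}$ for $1\le i\le n$. -/

import Mathlib

open Set Filter Topology Asymptotics Matrix
open scoped ContDiff

noncomputable section

namespace NahmNF

/-! ### Matrices and indexing

The data is `k = (k_1, …, k_n)`, given as `k : Fin n → ℕ` (so `k i` is the paper's `k_{i+1}`).
Block matrices have diagonal blocks of sizes `k_n, …, k_1`, from top left to bottom right. -/

/-- The size of the `b`-th diagonal block: the blocks have sizes `k_n, …, k_1`, in this order. -/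
def blockSize {n : ℕ} (k : Fin n → ℕ) (b : Fin n) : ℕ := k b.rev

/-- `m = k_n + ⋯ + k_1`. -/
def dim {n : ℕ} (k : Fin n → ℕ) : ℕ := ∑ b : Fin n, blockSize k b

theorem dim_eq_sum {n : ℕ} (k : Fin n → ℕ) : dim k = ∑ i : Fin n, k i :=
  Equiv.sum_comp Fin.revPerm k

/-- Complex `m × m` matrices. -/
abbrev Mat (m : ℕ) : Type := Matrix (Fin m) (Fin m) ℂ

/-- Identification of pairs (block, position in the block) with `{0, …, m - 1}`,
in lexicographic order. -/
def idx {n : ℕ} (k : Fin n → ℕ) : (Σ b : Fin n, Fin (blockSize k b)) ≃ Fin (dim k) :=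
  finSigmaFinEquiv

/-- The block to which an index belongs. -/
def blk {n : ℕ} (k : Fin n → ℕ) (a : Fin (dim k)) : Fin n := ((idx k).symm a).1

/-- The position (starting from `0`) of an index in its block. -/
def pos {n : ℕ} (k : Fin n → ℕ) (a : Fin (dim k)) : ℕ := (((idx k).symm a).2 : ℕ)

/-- `x(ℓ) = diag(-(ℓ-1)/4, -(ℓ-3)/4, …, (ℓ-1)/4)`. -/
def xMat (ℓ : ℕ) : Mat ℓ :=
  Matrix.diagonal fun s => -((ℓ : ℂ) - 1 - 2 * ((s : ℕ) : ℂ)) / 4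

/-- `y(ℓ)`: ones directly below the diagonal, zeros elsewhere. -/
def yMat (ℓ : ℕ) : Mat ℓ :=
  Matrix.of fun a b => if (a : ℕ) = (b : ℕ) + 1 then 1 else 0

/-- `x_1 = -x(m)`. -/
def xLeft (m : ℕ) : Mat m := -xMat m

/-- `y_1 = y(m)ᵀ`. -/
def yLeft (m : ℕ) : Mat m := (yMat m)ᵀ

/-- `x_N = diag(x(k_n), …, x(k_1))`. -/
def xRight {n : ℕ} (k : Fin n → ℕ) : Mat (dim k) :=
  Matrix.reindex (idx k) (idx k) (Matrix.blockDiagonal' fun b => xMat (blockSize k b))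

/-- `y_N = diag(y(k_n), …, y(k_1))`. -/
def yRight {n : ℕ} (k : Fin n → ℕ) : Mat (dim k) :=
  Matrix.reindex (idx k) (idx k) (Matrix.blockDiagonal' fun b => yMat (blockSize k b))

/-! ### Matrix-valued functions of a real variable -/

/-- Entrywise smoothness on the open interval `(l₁, lN)`. -/
def SmoothOn {m : ℕ} (l₁ lN : ℝ) (f : ℝ → Mat m) : Prop :=
  ∀ a b, ContDiffOn ℝ ∞ (fun t => f t a b) (Ioo l₁ lN)

/-- The entrywise derivative. -/
def matDeriv {m : ℕ} (f : ℝ → Mat m) (t : ℝ) : Mat m :=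
  Matrix.of fun a b => deriv (fun s => f s a b) t

/-- `f` is, to the right of `p`, the restriction of a meromorphic function with at most a
first order pole at `p`, whose residue is `A`. -/
def MeroSimplePoleRight {m : ℕ} (p : ℝ) (f : ℝ → Mat m) (A : Mat m) : Prop :=
  ∀ a b, ∃ F : ℂ → ℂ, AnalyticAt ℂ F (p : ℂ) ∧
    ∀ᶠ t : ℝ in 𝓝[>] p, f t a b = A a b / ((t : ℂ) - (p : ℂ)) + F (t : ℂ)

/-- `A` is the coefficient of `(t - p)⁻¹` of `f` as `t` increases to `p`:
`f t = A / (t - p) + O(1)`. -/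
def HasResidueLeft {m : ℕ} (p : ℝ) (f : ℝ → Mat m) (A : Mat m) : Prop :=
  ∀ a b, (fun t : ℝ => f t a b - A a b / ((t : ℂ) - (p : ℂ))) =O[𝓝[<] p] fun _ => (1 : ℝ)

/-- `A` is conjugate to `X` under `GL_m(ℂ)`. -/
def ConjTo {m : ℕ} (A X : Mat m) : Prop :=
  ∃ g : Mat m, IsUnit g.det ∧ g * A * g⁻¹ = X

/-- `f (p + z)` has, for `z < 0` small, the form `X / z` plus a block matrix whose block with
row size `c` and column size `d` is `z^{|c - d| / 2} O(1)`. -/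
def HalfPowerForm {n : ℕ} (k : Fin n → ℕ) (p : ℝ) (f : ℝ → Mat (dim k)) (X : Mat (dim k)) :
    Prop :=
  ∀ a b, (fun t : ℝ => f t a b - X a b / ((t : ℂ) - (p : ℂ))) =O[𝓝[<] p]
    fun t => |t - p| ^
      (|(blockSize k (blk k a) : ℝ) - (blockSize k (blk k b) : ℝ)| / 2)

/-! ### Nahm complexes -/

/-- `k`-Nahm complexes `((α, β), v)` on the interval `(l₁, lN)`. The tuple
`v = (v_1, …, v_N)`, `N = n + 1`, is given by the row vector `v₁` and the `n` vectors `w i`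
(`w i` is `v_{i+1}` for `i = 1, …, n`, that is, `w` lists `v_2, …, v_N`). -/
structure IsNahmComplex {n : ℕ} (k : Fin n → ℕ) (l₁ lN : ℝ) (α β : ℝ → Mat (dim k))
    (v₁ : Fin (dim k) → ℂ) (w : Fin n → Fin (dim k) → ℂ) : Prop where
  smooth_alpha : SmoothOn l₁ lN α
  smooth_beta : SmoothOn l₁ lN β
  complex_eq : ∀ t ∈ Ioo l₁ lN,
    matDeriv β t + (2 : ℂ) • (α t * β t - β t * α t) = 0
  /-- Conditions (i) and (iii) at the left end; `A`, `B` are the residues there. -/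
  left_end : ∃ A B : Mat (dim k),
    MeroSimplePoleRight l₁ α A ∧ MeroSimplePoleRight l₁ β B ∧
    ConjTo A (xLeft (dim k)) ∧ ConjTo B (yLeft (dim k)) ∧
    Aᵀ *ᵥ v₁ = (((dim k : ℂ) - 1) / 4) • v₁ ∧
    Submodule.span ℂ (Set.range fun r : ℕ => (Bᵀ ^ r) *ᵥ v₁) = ⊤
  /-- Condition (ii) at the right end. -/
  right_end : ∃ g : Mat (dim k), IsUnit g.det ∧
    HalfPowerForm k lN (fun t => g * α t * g⁻¹) (xRight k) ∧
    HalfPowerForm k lN (fun t => g * β t * g⁻¹) (yRight k)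
  /-- Condition (iv) at the right end; `A`, `B` are the residues there. The columns of the
  matrix are `v_N, …, B^{k_n-1} v_N, …, v_2, …, B^{k_1-1} v_2`. -/
  right_vectors : ∃ A B : Mat (dim k),
    HasResidueLeft lN α A ∧ HasResidueLeft lN β B ∧
    (∀ i, A *ᵥ w i = (-((k i : ℂ) - 1) / 4) • w i) ∧
    (Matrix.of fun a b => ((B ^ pos k b) *ᵥ w (blk k b).rev) a : Mat (dim k)).det ≠ 0 ∧
    ∀ i, (B ^ k i) *ᵥ w i = 0

/-! ### Gauge transformations -/

/-- Smooth `GL_m(ℂ)`-valued maps on `(l₁, lN)` that extend continuously and invertibly to the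
boundary; the values at `l₁` and `lN` are those of the extension. -/
structure IsGauge {m : ℕ} (l₁ lN : ℝ) (g : ℝ → Mat m) : Prop where
  smooth : SmoothOn l₁ lN g
  continuous : ∀ a b, ContinuousOn (fun t => g t a b) (Icc l₁ lN)
  invertible : ∀ t ∈ Icc l₁ lN, IsUnit (g t).det

/-- `g.α = g α g⁻¹ - (1/2) ġ g⁻¹`. -/
def gaugeAlpha {m : ℕ} (g α : ℝ → Mat m) (t : ℝ) : Mat m :=
  g t * α t * (g t)⁻¹ - (1 / 2 : ℂ) • (matDeriv g t * (g t)⁻¹)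

/-- `g.β = g β g⁻¹`. -/
def gaugeBeta {m : ℕ} (g β : ℝ → Mat m) (t : ℝ) : Mat m :=
  g t * β t * (g t)⁻¹

/-- Equivalence of `((α, β), v)` and `((α', β'), v')`: they differ by a gauge transformation,
which acts on `v_1` through its value at `l₁` and on `v_2, …, v_N` through its value
at `lN`. -/
def GaugeEquiv {n m : ℕ} (l₁ lN : ℝ)
    (α β : ℝ → Mat m) (v₁ : Fin m → ℂ) (w : Fin n → Fin m → ℂ)
    (α' β' : ℝ → Mat m) (v₁' : Fin m → ℂ) (w' : Fin n → Fin m → ℂ) : Prop :=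
  ∃ g : ℝ → Mat m, IsGauge l₁ lN g ∧
    (∀ t ∈ Ioo l₁ lN, α' t = gaugeAlpha g α t ∧ β' t = gaugeBeta g β t) ∧
    v₁' = v₁ ᵥ* (g l₁)⁻¹ ∧ ∀ i, w' i = g lN *ᵥ w i

/-! ### The standard form -/

/-- The matrix `g_st(l₁ + z)`: in row `a`, column `b` (counted from `1`) it has
`z^{m+1-a-b} q_{a+b}` if `a + b ≤ m`, `1` if `a + b = m + 1`, and `0` otherwise. -/
def gSt {m : ℕ} (q : Fin m → ℂ) (z : ℝ) : Mat m :=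
  Matrix.of fun a b =>
    if h : (a : ℕ) + b + 1 < m then (z : ℂ) ^ (m - 1 - ((a : ℕ) + b)) * q ⟨(a : ℕ) + b + 1, h⟩
    else if (a : ℕ) + b + 1 = m then 1 else 0

/-- The companion-type matrix with `z⁻¹` directly below the diagonal and last column
`-z^{m-1} q_1, …, -z q_{m-1}, -q_m`. -/
def companionSt {m : ℕ} (q : Fin m → ℂ) (z : ℝ) : Mat m :=
  Matrix.of fun a b =>
    if (b : ℕ) + 1 = m then -((z : ℂ) ^ (m - 1 - (a : ℕ)) * q a)
    else if (a : ℕ) = (b : ℕ) + 1 then (z : ℂ)⁻¹ else 0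

/-- The matrix `β_st(lN + z)`, `z < 0`. In a block with row size `c` and column size `d` the
last column has the entries `z^{(c+d)/2-1} C, …, z^{(d-c)/2} C` (with the corresponding entries
of `C`); in a diagonal block these are `z^{c-1} C, …, C`, and there are entries `z⁻¹` directly
below the diagonal. All other entries vanish. The powers of `z` are principal. -/
def betaRightSt {n : ℕ} (k : Fin n → ℕ) (C : Matrix (Fin (dim k)) (Fin n) ℂ) (z : ℝ) :
    Mat (dim k) :=
  Matrix.of fun a b =>
    if pos k b + 1 = blockSize k (blk k b) then
      (z : ℂ) ^ (((blockSize k (blk k b) : ℂ) + (blockSize k (blk k a) : ℂ)) / 2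
        - ((pos k a : ℂ) + 1)) * C a (blk k b)
    else if blk k a = blk k b ∧ pos k a = pos k b + 1 then (z : ℂ)⁻¹ else 0

/-- The pair `(α, β)` has the standard form near both ends of the interval. -/
structure IsStandardForm {n : ℕ} (k : Fin n → ℕ) (l₁ lN : ℝ) (α β : ℝ → Mat (dim k)) :
    Prop where
  left_end : ∃ q : Fin (dim k) → ℂ, ∀ᶠ t : ℝ in 𝓝[>] l₁,
    gaugeAlpha (fun s => gSt q (s - l₁)) α t = -(((t : ℂ) - (l₁ : ℂ))⁻¹ • xLeft (dim k)) ∧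
    β t = (companionSt q (t - l₁))ᵀ
  right_alpha : ∀ᶠ t : ℝ in 𝓝[<] lN, α t = ((t : ℂ) - (lN : ℂ))⁻¹ • xRight k
  right_beta : ∃ C : Matrix (Fin (dim k)) (Fin n) ℂ,
    ∀ᶠ t : ℝ in 𝓝[<] lN, β t = betaRightSt k C (t - lN)
  /-- The off-diagonal blocks of `β` vanish to the prescribed half-integer order. -/
  right_vanish : ∀ a b, blk k a ≠ blk k b →
    (fun t : ℝ => β t a b) =O[𝓝[<] lN] fun t => |t - lN| ^
      (|(blockSize k (blk k a) : ℝ) - (blockSize k (blk k b) : ℝ)| / 2)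

/-- The row vector `(v_st)_1 = e_1ᵀ`. -/
def stdRow {n : ℕ} (k : Fin n → ℕ) : Fin (dim k) → ℂ :=
  fun a => if (a : ℕ) = 0 then 1 else 0

/-- The vectors `(v_st)_{i+1} = e_{k_{i+1} + ⋯ + k_n + 1}`, `i = 1, …, n`: the first basis
vector of the block of size `k_i` (here the index `i` is counted from `0`). -/
def stdVec {n : ℕ} (k : Fin n → ℕ) (i : Fin n) : Fin (dim k) → ℂ :=
  fun a => if (a : ℕ) = ∑ j ∈ Finset.Ioi i, k j then 1 else 0

end NahmNF

end

/-! Away from the ends, a solution of ġ = 2gα makes g.α = 0; the equation of a complex is gauge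
covariant, so g.β is then constant. Cutting g off outside a neighbourhood of [a, b] gives (a).

For (b), consider an end placed at t = 0, where α = x/t + A and β = y/t + B with x, y block diagonal
and with entries of A, B of order t^w, w being half the difference of the block sizes. A frame P
with P → 1 and Ṗ = -2αP + (2/t)Px yields the gauge transformation P⁻¹ taking α to x/t. A
differential equation is solved only for the columns at the first vectors of the blocks
(`exists_column_solution`): there x has its lowest eigenvalue in the block, and after the factors
t^w are split off all exponents of the singular term are nonnegative, so that the fixed point
argument of `exists_singular_linear_ode` applies. The other columns come for free (`exists_frame`):
by the equation of a complex, tβ maps solutions with eigenvalue x_j to solutions with eigenvalue x_j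
+ 1/2, and tβ → y. In this frame β shifts the columns inside each block. In the last column of a
block, the remaining equation β̇ = -2[x/t, β] makes every entry a constant times a definite power of
t. This is `exists_local_normal_form`; the weighted estimates survive products because the weights
satisfy the triangle inequality.

It remains to find constant frames that put the vectors in standard position. At the left end the
rows (Bᵀ)^r v₁ form such a frame, because the residues satisfy 2[A, B] = B; the duality (α, β) ↦
(-αᵀ, βᵀ) then leads to the model with one block. At the right end the columns B^r v form a frame.
It differs from the one in which the half-integer estimates are assumed by a matrix commuting with
x_N and y_N, and such a matrix has no entries between blocks of different sizes
(`apply_eq_zero_of_commute`), so the estimates persist. The two local transformations are joined by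
`exists_gauge_glue`, GL_m(ℂ) being connected. -/

noncomputable section

namespace NahmNF

/-! ### Linear equations with a regular singular point -/

/-- The solution operator of `u' = -(κ / z) u + f`, `u(0) = 0`. -/
def singInt (κ : ℝ) (f : ℝ → ℂ) (z : ℝ) : ℂ :=
  ∫ s in (0 : ℝ)..z, ((((s / z) ^ κ : ℝ)) : ℂ) * f s

theorem intervalIntegrable_of_bounded {T M z : ℝ} {f : ℝ → ℂ}
    (hf : ContinuousOn f (Ioo 0 T)) (hM : ∀ s ∈ Ioo 0 T, ‖f s‖ ≤ M) (hz : z ∈ Ioo 0 T) :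
    IntervalIntegrable f MeasureTheory.volume 0 z := by
  rw [intervalIntegrable_iff_integrableOn_Ioo_of_le hz.1.le]
  have hsub : Ioo 0 z ⊆ Ioo 0 T := Ioo_subset_Ioo_right hz.2.le
  refine MeasureTheory.IntegrableOn.of_bound (by simp)
    ((hf.mono hsub).aestronglyMeasurable measurableSet_Ioo) M ?_
  filter_upwards [MeasureTheory.ae_restrict_mem measurableSet_Ioo] with s hs using hM s (hsub hs)

theorem continuousOn_rpow_mul {T κ : ℝ} (hκ : 0 ≤ κ) {f : ℝ → ℂ}
    (hf : ContinuousOn f (Ioo 0 T)) :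
    ContinuousOn (fun s : ℝ => (((s ^ κ : ℝ)) : ℂ) * f s) (Ioo 0 T) := by
  refine ContinuousOn.mul ?_ hf
  exact (Complex.continuous_ofReal.comp (Real.continuous_rpow_const hκ)).continuousOn

theorem norm_rpow_mul_le {T κ M : ℝ} (hκ : 0 ≤ κ) {f : ℝ → ℂ}
    (hM : ∀ s ∈ Ioo 0 T, ‖f s‖ ≤ M) :
    ∀ s ∈ Ioo 0 T, ‖(((s ^ κ : ℝ)) : ℂ) * f s‖ ≤ T ^ κ * M := by
  intro s hs
  rw [norm_mul, Complex.norm_real, Real.norm_of_nonneg (Real.rpow_nonneg hs.1.le _)]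
  exact mul_le_mul (Real.rpow_le_rpow hs.1.le hs.2.le hκ) (hM s hs) (norm_nonneg _)
    (Real.rpow_nonneg (hs.1.trans hs.2).le _)

/-- With z^(-κ) taken out, the integrand no longer depends on z and the fundamental theorem of
calculus applies. -/
theorem singInt_eq {κ z : ℝ} (hz : 0 < z) (f : ℝ → ℂ) :
    singInt κ f z = (((z ^ (-κ) : ℝ)) : ℂ) * ∫ s in (0 : ℝ)..z, (((s ^ κ : ℝ)) : ℂ) * f s := by
  rw [singInt, ← intervalIntegral.integral_const_mul]
  refine intervalIntegral.integral_congr fun s hs => ?_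
  rw [uIcc_of_le hz.le] at hs
  rw [Real.div_rpow hs.1 hz.le, Real.rpow_neg hz.le]
  push_cast
  ring

theorem hasDerivAt_singInt {T κ M z : ℝ} (hκ : 0 ≤ κ) {f : ℝ → ℂ}
    (hf : ContinuousOn f (Ioo 0 T)) (hM : ∀ s ∈ Ioo 0 T, ‖f s‖ ≤ M) (hz : z ∈ Ioo 0 T) :
    HasDerivAt (singInt κ f) (-((κ / z : ℝ) : ℂ) * singInt κ f z + f z) z := by
  have hc := continuousOn_rpow_mul hκ hf
  have h1 : HasDerivAt (fun y => ∫ s in (0 : ℝ)..y, (((s ^ κ : ℝ)) : ℂ) * f s)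
      ((((z ^ κ : ℝ)) : ℂ) * f z) z :=
    intervalIntegral.integral_hasDerivAt_right
      (intervalIntegrable_of_bounded hc (norm_rpow_mul_le hκ hM) hz)
      (hc.stronglyMeasurableAtFilter isOpen_Ioo z hz) (hc.continuousAt (isOpen_Ioo.mem_nhds hz))
  have h2 : HasDerivAt (fun y : ℝ => (((y ^ (-κ) : ℝ)) : ℂ))
      (((-κ * z ^ (-κ - 1) : ℝ)) : ℂ) z :=
    (Real.hasDerivAt_rpow_const (Or.inl hz.1.ne')).ofReal_comp
  have h3 := (h2.mul h1).congr_of_eventuallyEq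
    (f₁ := singInt κ f) (by
      filter_upwards [isOpen_Ioo.mem_nhds hz] with y hy using singInt_eq hy.1 f)
  refine h3.congr_deriv ?_
  rw [singInt_eq hz.1, Real.rpow_sub_one hz.1.ne', ← mul_assoc (((z ^ (-κ) : ℝ)) : ℂ),
    ← Complex.ofReal_mul, ← Real.rpow_add hz.1]
  simp
  ring

/-- Since κ ≥ 0, the kernel (s/z)^κ is at most 1. The factor 1/L gained from integrating the
exponential is the source of the contraction below. -/
theorem norm_singInt_le {T κ M L z : ℝ} (hκ : 0 ≤ κ) (hL : 0 < L) {f : ℝ → ℂ}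
    (hM : ∀ s ∈ Ioo 0 T, ‖f s‖ ≤ M * Real.exp (L * s)) (hz : z ∈ Ioo 0 T) :
    ‖singInt κ f z‖ ≤ M / L * Real.exp (L * z) := by
  have hM0 : 0 ≤ M := by
    have := (norm_nonneg _).trans (hM z hz)
    exact nonneg_of_mul_nonneg_left this (Real.exp_pos _)
  have hi : ∫ s in (0 : ℝ)..z, M * Real.exp (L * s) = M / L * (Real.exp (L * z) - 1) := by
    rw [intervalIntegral.integral_const_mul, intervalIntegral.integral_comp_mul_left _ hL.ne']
    simp
    ring
  calc ‖singInt κ f z‖ ≤ ∫ s in (0 : ℝ)..z, M * Real.exp (L * s) := by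
        refine intervalIntegral.norm_integral_le_of_norm_le hz.1.le ?_
          (Continuous.intervalIntegrable (by fun_prop) _ _)
        have hne : ∀ᵐ s : ℝ, s ≠ z := by simp [MeasureTheory.ae_iff]
        filter_upwards [hne] with s hs hs'
        have hs0 : s ∈ Ioo 0 T := ⟨hs'.1, hs'.2.trans_lt hz.2⟩
        rw [norm_mul, Complex.norm_real,
          Real.norm_of_nonneg (Real.rpow_nonneg (div_nonneg hs'.1.le hz.1.le) _)]
        calc (s / z) ^ κ * ‖f s‖ ≤ 1 * ‖f s‖ := by
              gcongr
              exact Real.rpow_le_one (div_nonneg hs'.1.le hz.1.le)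
                ((div_le_one hz.1).2 hs'.2) hκ
          _ ≤ _ := by rw [one_mul]; exact hM s hs0
    _ ≤ M / L * Real.exp (L * z) := by
        rw [hi]
        gcongr
        linarith

/-- This linear bound is the rate at which solutions attain their boundary value. -/
theorem norm_singInt_le' {T κ M z : ℝ} (hκ : 0 ≤ κ) {f : ℝ → ℂ}
    (hM : ∀ s ∈ Ioo 0 T, ‖f s‖ ≤ M) (hz : z ∈ Ioo 0 T) :
    ‖singInt κ f z‖ ≤ M * z := by
  have := intervalIntegral.norm_integral_le_of_norm_le_const (a := 0) (b := z) (C := M)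
    (f := fun s => ((((s / z) ^ κ : ℝ)) : ℂ) * f s) (fun s hs => ?_)
  · simpa [singInt, abs_of_pos hz.1] using this
  rw [uIoc_of_le hz.1.le] at hs
  rw [norm_mul, Complex.norm_real,
    Real.norm_of_nonneg (Real.rpow_nonneg (div_nonneg hs.1.le hz.1.le) _)]
  calc (s / z) ^ κ * ‖f s‖ ≤ 1 * ‖f s‖ := by
        gcongr
        exact Real.rpow_le_one (div_nonneg hs.1.le hz.1.le) ((div_le_one hz.1).2 hs.2) hκ
    _ ≤ _ := by rw [one_mul]; exact hM s ⟨hs.1, hs.2.trans_lt hz.2⟩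

theorem singInt_sub {T κ M M' z : ℝ} (hκ : 0 ≤ κ) {f g : ℝ → ℂ}
    (hf : ContinuousOn f (Ioo 0 T)) (hM : ∀ s ∈ Ioo 0 T, ‖f s‖ ≤ M)
    (hg : ContinuousOn g (Ioo 0 T)) (hM' : ∀ s ∈ Ioo 0 T, ‖g s‖ ≤ M') (hz : z ∈ Ioo 0 T) :
    singInt κ f z - singInt κ g z = singInt κ (fun s => f s - g s) z := by
  rw [singInt_eq hz.1, singInt_eq hz.1, singInt_eq hz.1, ← mul_sub,
    ← intervalIntegral.integral_sub
      (intervalIntegrable_of_bounded (continuousOn_rpow_mul hκ hf) (norm_rpow_mul_le hκ hM) hz)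
      (intervalIntegrable_of_bounded (continuousOn_rpow_mul hκ hg) (norm_rpow_mul_le hκ hM') hz)]
  simp only [mul_sub]

open BoundedContinuousFunction in
/-- Existence of a solution with prescribed boundary value at the singular point. -/
theorem exists_singular_linear_ode {ι : Type*} [Fintype ι] {T K : ℝ} (hT : 0 < T)
    {κ : ι → ℝ} (hκ : ∀ a, 0 ≤ κ a) {G : ι → ι → ℝ → ℂ}
    (hG : ∀ a b, ContinuousOn (G a b) (Ioo 0 T))
    (hK : ∀ a b, ∀ t ∈ Ioo 0 T, ‖G a b t‖ ≤ K) {u₀ : ι → ℂ} (hu : ∀ a, (κ a : ℂ) * u₀ a = 0) :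
    ∃ u : ι → ℝ → ℂ,
      (∀ a, ∀ t ∈ Ioo 0 T,
        HasDerivAt (u a) (-((κ a / t : ℝ) : ℂ) * u a t + ∑ b, G a b t * u b t) t) ∧
      ∃ C, ∀ a, ∀ t ∈ Ioo 0 T, ‖u a t - u₀ a‖ ≤ C * t := by
  classical
  set n : ℝ := (Fintype.card ι : ℝ)
  have hn : 0 ≤ n := by positivity
  -- The iteration has Lipschitz constant n|K|/L, which this choice keeps below 1/2.
  set L : ℝ := 2 * (n * |K|) + 1 with hLdef
  have hL : 0 < L := by positivity
  have hK' : ∀ a b, ∀ t ∈ Ioo 0 T, ‖G a b t‖ ≤ |K| := fun a b t ht =>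
    (hK a b t ht).trans (le_abs_self K)
  -- An element of `E` stands for exp(-Lt) u, so the sup norm on `E` is an exponentially weighted
  -- norm of the unknown u.
  let E := (Ioo (0 : ℝ) T) →ᵇ (ι → ℂ)
  let ext : E → ι → ℝ → ℂ := fun v a t => if h : t ∈ Ioo 0 T then v ⟨t, h⟩ a else 0
  let R : E → ι → ℝ → ℂ := fun v a t => ∑ b, G a b t * ((Real.exp (L * t) : ℂ) * ext v b t)
  have hext : ∀ v a, ContinuousOn (ext v a) (Ioo 0 T) := by
    intro v a
    rw [continuousOn_iff_continuous_domRestrict]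
    have : (Ioo 0 T).domRestrict (ext v a) = fun t => v t a := by
      funext t
      exact dif_pos t.2
    rw [this]
    exact (continuous_apply a).comp v.continuous
  have hextb : ∀ (v w : E) a, ∀ t ∈ Ioo 0 T, ‖ext v a t - ext w a t‖ ≤ dist v w := by
    intro v w a t ht
    simp only [ext, ht, dif_pos]
    rw [← dist_eq_norm]
    exact (dist_le_pi_dist _ _ a).trans (dist_coe_le_dist _)
  have hRc : ∀ v a, ContinuousOn (R v a) (Ioo 0 T) := by
    intro v a
    refine continuousOn_finsetSum _ fun b _ => (hG a b).mul (ContinuousOn.mul ?_ (hext v b))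
    exact (Complex.continuous_ofReal.comp (by fun_prop)).continuousOn
  have hRd : ∀ (v w : E) a, ∀ t ∈ Ioo 0 T,
      ‖R v a t - R w a t‖ ≤ n * |K| * dist v w * Real.exp (L * t) := by
    intro v w a t ht
    simp only [R, ← Finset.sum_sub_distrib, ← mul_sub]
    refine (norm_sum_le _ _).trans ?_
    have : ∀ b ∈ Finset.univ, ‖G a b t * ((Real.exp (L * t) : ℂ) * (ext v b t - ext w b t))‖ ≤
        |K| * (Real.exp (L * t) * dist v w) := by
      intro b _
      rw [norm_mul, norm_mul, Complex.norm_real, Real.norm_of_nonneg (Real.exp_pos _).le]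
      exact mul_le_mul (hK' a b t ht) (mul_le_mul_of_nonneg_left (hextb v w b t ht)
        (Real.exp_pos _).le) (by positivity) (abs_nonneg _)
    refine (Finset.sum_le_sum this).trans (le_of_eq ?_)
    simp [n]
    ring
  have hR0 : ∀ a, R 0 a = 0 := by
    intro a
    funext t
    refine Finset.sum_eq_zero fun b _ => ?_
    have : ext 0 b t = 0 := by
      simp only [ext]
      split_ifs <;> rfl
    rw [this, mul_zero, mul_zero]
  have hRb : ∀ (v : E) a, ∀ t ∈ Ioo 0 T, ‖R v a t‖ ≤ n * |K| * ‖v‖ * Real.exp (L * t) := by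
    intro v a t ht
    simpa [hR0] using hRd v 0 a t ht
  have hRb' : ∀ (v : E) a, ∀ t ∈ Ioo 0 T, ‖R v a t‖ ≤ n * |K| * ‖v‖ * Real.exp (L * T) := by
    intro v a t ht
    refine (hRb v a t ht).trans ?_
    gcongr
    exact ht.2.le
  let f : E → ℝ → ι → ℂ := fun v t a =>
    (Real.exp (-(L * t)) : ℂ) * (u₀ a + singInt (κ a) (R v a) t)
  have hexp : ∀ t : ℝ, 0 < t → ‖(Real.exp (-(L * t)) : ℂ)‖ ≤ 1 := by
    intro t ht
    rw [Complex.norm_real, Real.norm_of_nonneg (Real.exp_pos _).le, Real.exp_le_one_iff]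
    nlinarith
  have hfc : ∀ v, Continuous fun t : Ioo (0 : ℝ) T => f v t := by
    intro v
    refine continuous_pi fun a => Continuous.mul ?_ (Continuous.add continuous_const ?_)
    · exact Complex.continuous_ofReal.comp (by fun_prop)
    · rw [continuous_iff_continuousAt]
      intro t
      exact (hasDerivAt_singInt (hκ a) (hRc v a) (hRb' v a) t.2).continuousAt.comp
        continuousAt_subtype_val
  have hfb : ∀ v, ∀ t : Ioo (0 : ℝ) T,
      ‖f v t‖ ≤ ‖u₀‖ + n * |K| * ‖v‖ * Real.exp (L * T) * T := by
    intro v t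
    rw [pi_norm_le_iff_of_nonneg (by positivity)]
    intro a
    rw [norm_mul]
    refine (mul_le_of_le_one_left (norm_nonneg _) (hexp t t.2.1)).trans ?_
    refine (norm_add_le _ _).trans (add_le_add (norm_le_pi_norm _ _) ?_)
    refine (norm_singInt_le' (hκ a) (hRb' v a) t.2).trans ?_
    gcongr
    exact t.2.2.le
  let Φ : E → E := fun v => ofNormedAddCommGroup (fun t : Ioo (0 : ℝ) T => f v t) (hfc v) _ (hfb v)
  have hΦ : ContractingWith (1 / 2) Φ := by
    refine ⟨by norm_num, LipschitzWith.of_dist_le_mul fun v w => ?_⟩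
    rw [BoundedContinuousFunction.dist_le (by positivity)]
    intro t
    rw [dist_pi_le_iff (by positivity)]
    intro a
    have h1 : Φ v t a - Φ w t a = (Real.exp (-(L * t)) : ℂ) *
        singInt (κ a) (fun s => R v a s - R w a s) t := by
      rw [← singInt_sub (hκ a) (hRc v a) (hRb' v a) (hRc w a) (hRb' w a) t.2]
      change f v t a - f w t a = _
      simp only [f]
      ring
    rw [dist_eq_norm, h1, norm_mul, Complex.norm_real, Real.norm_of_nonneg (Real.exp_pos _).le]
    have h2 := norm_singInt_le (hκ a) hL (hRd v w a) t.2
    calc _ ≤ Real.exp (-(L * t)) * (n * |K| * dist v w / L * Real.exp (L * t)) := by gcongr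
      _ = n * |K| / L * dist v w := by
        rw [Real.exp_neg]
        field_simp
      _ ≤ 1 / 2 * dist v w := by
        refine mul_le_mul_of_nonneg_right ?_ dist_nonneg
        rw [div_le_iff₀ hL, hLdef]
        linarith
      _ = _ := by simp
  obtain ⟨v, hv⟩ : ∃ v, Φ v = v := ⟨_, hΦ.fixedPoint_isFixedPt⟩
  let u : ι → ℝ → ℂ := fun a t => u₀ a + singInt (κ a) (R v a) t
  have huv : ∀ a, ∀ t ∈ Ioo 0 T, (Real.exp (L * t) : ℂ) * ext v a t = u a t := by
    intro a t ht
    have h1 : ext v a t = f v t a := by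
      simp only [ext, ht, dif_pos]
      conv_lhs => rw [← hv]
      rfl
    rw [h1]
    simp only [f, u]
    rw [← mul_assoc, ← Complex.ofReal_mul, ← Real.exp_add]
    simp
  refine ⟨u, fun a t ht => ?_, n * |K| * ‖v‖ * Real.exp (L * T), fun a t ht => ?_⟩
  · have h1 := (hasDerivAt_singInt (hκ a) (hRc v a) (hRb' v a) ht).const_add (u₀ a)
    refine h1.congr_deriv ?_
    congr 1
    · simp only [u]
      -- The constant u₀ contributes nothing to the singular term, as κ u₀ = 0.
      have := hu a
      push_cast
      linear_combination (1 / (t : ℂ)) * this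
    · exact Finset.sum_congr rfl fun b _ => by rw [huv b t ht]
  · simp only [u, add_sub_cancel_left]
    exact norm_singInt_le' (hκ a) (hRb' v a) ht

/-- Solutions of linear equations with smooth coefficients are smooth. -/
theorem contDiffOn_of_linear_ode {ι : Type*} [Fintype ι] {s : Set ℝ} (hs : IsOpen s)
    {u : ι → ℝ → ℂ} {M : ι → ι → ℝ → ℂ} (hM : ∀ a b, ContDiffOn ℝ ∞ (M a b) s)
    (hu : ∀ a, ∀ t ∈ s, HasDerivAt (u a) (∑ b, M a b t * u b t) t) (a : ι) :
    ContDiffOn ℝ ∞ (u a) s := by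
  have key : ∀ n : ℕ, ∀ a, ContDiffOn ℝ n (u a) s := by
    intro n
    induction n with
    | zero =>
      intro a
      rw [Nat.cast_zero, contDiffOn_zero]
      exact fun t ht => (hu a t ht).continuousAt.continuousWithinAt
    | succ n ih =>
      intro a
      rw [Nat.cast_succ, contDiffOn_succ_iff_deriv_of_isOpen hs]
      refine ⟨fun t ht => (hu a t ht).differentiableAt.differentiableWithinAt, by simp, ?_⟩
      refine ContDiffOn.congr (f := fun t => ∑ b, M a b t * u b t) ?_
        fun t ht => (hu a t ht).deriv
      exact ContDiffOn.sum fun b _ => ((hM a b).of_le (by exact_mod_cast le_top)).mul (ih b)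
  rw [contDiffOn_infty]
  exact fun n => key n a

/-! ### Calculus of matrix-valued functions -/

section Calculus

variable {m : ℕ} {f g : ℝ → Mat m} {f' g' : Mat m} {t l u : ℝ}

/-- The entrywise derivative of `f` at `t` is `f'`. -/
def HasMatDeriv (f : ℝ → Mat m) (f' : Mat m) (t : ℝ) : Prop :=
  ∀ a b, HasDerivAt (fun s => f s a b) (f' a b) t

theorem HasMatDeriv.matDeriv_eq (h : HasMatDeriv f f' t) : matDeriv f t = f' := by
  ext a b
  exact (h a b).deriv

theorem hasMatDeriv_const (A : Mat m) (t : ℝ) : HasMatDeriv (fun _ => A) 0 t :=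
  fun _ _ => hasDerivAt_const _ _

theorem HasMatDeriv.mul (hf : HasMatDeriv f f' t) (hg : HasMatDeriv g g' t) :
    HasMatDeriv (fun s => f s * g s) (f' * g t + f t * g') t := by
  intro a b
  simp only [Matrix.mul_apply, Matrix.add_apply, ← Finset.sum_add_distrib]
  exact HasDerivAt.fun_sum fun c _ => (hf a c).mul (hg c b)

theorem HasMatDeriv.transpose (hf : HasMatDeriv f f' t) : HasMatDeriv (fun s => (f s)ᵀ) f'ᵀ t :=
  fun a b => hf b a

theorem HasMatDeriv.congr_of_eventuallyEq (hf : HasMatDeriv f f' t) (h : g =ᶠ[𝓝 t] f) :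
    HasMatDeriv g f' t :=
  fun a b => (hf a b).congr_of_eventuallyEq (h.mono fun s hs => by simp only [hs])

theorem SmoothOn.hasMatDeriv (hf : SmoothOn l u f) (ht : t ∈ Ioo l u) :
    HasMatDeriv f (matDeriv f t) t := fun a b =>
  (((hf a b).contDiffAt (isOpen_Ioo.mem_nhds ht)).differentiableAt (by simp)).hasDerivAt

theorem SmoothOn.const (A : Mat m) : SmoothOn l u fun _ => A := fun _ _ => contDiffOn_const

theorem SmoothOn.mul (hf : SmoothOn l u f) (hg : SmoothOn l u g) :
    SmoothOn l u fun t => f t * g t := by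
  intro a b
  simp only [Matrix.mul_apply]
  exact ContDiffOn.sum fun c _ => (hf a c).mul (hg c b)

theorem SmoothOn.neg (hf : SmoothOn l u f) : SmoothOn l u fun t => -f t :=
  fun a b => (hf a b).neg

theorem SmoothOn.sub (hf : SmoothOn l u f) (hg : SmoothOn l u g) :
    SmoothOn l u fun t => f t - g t :=
  fun a b => (hf a b).sub (hg a b)

theorem SmoothOn.smul (hf : SmoothOn l u f) (c : ℂ) : SmoothOn l u fun t => c • f t :=
  fun a b => contDiffOn_const.mul (hf a b)

theorem SmoothOn.transpose (hf : SmoothOn l u f) : SmoothOn l u fun t => (f t)ᵀ :=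
  fun a b => hf b a

theorem SmoothOn.mono {l' u' : ℝ} (hf : SmoothOn l u f) (hl : l ≤ l') (hu : u' ≤ u) :
    SmoothOn l' u' f := fun a b => (hf a b).mono (Ioo_subset_Ioo hl hu)

theorem SmoothOn.comp {θ : ℝ → ℝ} {l' u' : ℝ} (hf : SmoothOn l u f)
    (hθ : ContDiffOn ℝ ∞ θ (Ioo l' u')) (hm : MapsTo θ (Ioo l' u') (Ioo l u)) :
    SmoothOn l' u' fun t => f (θ t) :=
  fun a b => (hf a b).comp hθ hm

theorem SmoothOn.matDeriv (hf : SmoothOn l u f) : SmoothOn l u (matDeriv f) := fun a b =>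
  ((contDiffOn_infty_iff_deriv_of_isOpen isOpen_Ioo).1 (hf a b)).2

theorem contDiff_det :
    ContDiff ℝ ∞ fun A : Fin m → Fin m → ℂ => (Matrix.of A).det := by
  simp only [Matrix.det_apply, Matrix.of_apply]
  refine ContDiff.sum fun σ _ => ContDiff.const_smul _ ?_
  exact contDiff_prod fun i _ => (contDiff_apply_apply ℝ ℂ (σ i) i)

theorem contDiff_adjugate (a b : Fin m) :
    ContDiff ℝ ∞ fun A : Fin m → Fin m → ℂ => (Matrix.of A).adjugate a b := by
  simp only [Matrix.adjugate_apply]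
  refine contDiff_det.comp (g := fun A : Fin m → Fin m → ℂ => (Matrix.of A).det)
    (f := fun (A : Fin m → Fin m → ℂ) i j => (Matrix.of A).updateRow b (Pi.single a 1) i j) ?_
  rw [contDiff_pi]
  intro i
  rw [contDiff_pi]
  intro j
  by_cases h : i = b
  · subst h
    simpa using contDiff_const
  · simpa [Matrix.updateRow_apply, h] using contDiff_apply_apply ℝ ℂ i j

theorem inv_apply_eq (A : Mat m) (a b : Fin m) : A⁻¹ a b = (A.det)⁻¹ * A.adjugate a b := by
  rw [Matrix.inv_def, Matrix.smul_apply, Ring.inverse_eq_inv', smul_eq_mul]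

theorem SmoothOn.inv (hf : SmoothOn l u f) (h : ∀ t ∈ Ioo l u, IsUnit (f t).det) :
    SmoothOn l u fun t => (f t)⁻¹ := by
  intro a b
  have hp : ContDiffOn ℝ ∞ (fun t i j => f t i j) (Ioo l u) := by
    rw [contDiffOn_pi]
    intro i
    rw [contDiffOn_pi]
    exact fun j => hf i j
  simp only [inv_apply_eq]
  exact ((contDiff_det.comp_contDiffOn hp).inv fun t ht => (h t ht).ne_zero).mul
    ((contDiff_adjugate a b).comp_contDiffOn hp)

theorem continuousOn_inv_entry {s : Set ℝ} (hf : ∀ a b, ContinuousOn (fun t => f t a b) s)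
    (h : ∀ t ∈ s, IsUnit (f t).det) (a b : Fin m) :
    ContinuousOn (fun t => (f t)⁻¹ a b) s := by
  have hp : ContinuousOn (fun t i j => f t i j) s :=
    continuousOn_pi.2 fun i => continuousOn_pi.2 fun j => hf i j
  simp only [inv_apply_eq]
  exact ((contDiff_det.continuous.comp_continuousOn hp).inv₀ fun t ht => (h t ht).ne_zero).mul
    ((contDiff_adjugate a b).continuous.comp_continuousOn hp)

theorem continuousOn_mul_entry {s : Set ℝ} (hf : ∀ a b, ContinuousOn (fun t => f t a b) s)
    (hg : ∀ a b, ContinuousOn (fun t => g t a b) s) (a b : Fin m) :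
    ContinuousOn (fun t => (f t * g t) a b) s := by
  simp only [Matrix.mul_apply]
  exact continuousOn_finsetSum _ fun c _ => (hf a c).mul (hg c b)

/-- Cramer's formula gives differentiability of the inverse; its derivative then follows by
differentiating f f⁻¹ = 1, which holds near t. -/
theorem HasMatDeriv.inv (hf : HasMatDeriv f f' t) (h : IsUnit (f t).det) :
    HasMatDeriv (fun s => (f s)⁻¹) (-((f t)⁻¹ * f' * (f t)⁻¹)) t := by
  have hp : DifferentiableAt ℝ (fun t i j => f t i j) t := by
    rw [differentiableAt_pi]
    intro i
    rw [differentiableAt_pi]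
    exact fun j => (hf i j).differentiableAt
  have hdet : DifferentiableAt ℝ (fun t => (f t).det) t :=
    ((contDiff_det.differentiable (by simp)).differentiableAt).comp t hp
  have hd : ∀ a b, DifferentiableAt ℝ (fun t => (f t)⁻¹ a b) t := by
    intro a b
    simp only [inv_apply_eq]
    exact (hdet.inv h.ne_zero).mul
      (((contDiff_adjugate a b).differentiable (by simp)).differentiableAt.comp t hp)
  have h1 : HasMatDeriv (fun s => (f s)⁻¹) (NahmNF.matDeriv (fun s => (f s)⁻¹) t) t :=
    fun a b => (hd a b).hasDerivAt
  set D := NahmNF.matDeriv (fun s => (f s)⁻¹) t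
  have hne : ∀ᶠ s in 𝓝 t, (f s).det ≠ 0 := hdet.continuousAt.eventually_ne h.ne_zero
  have h2 := (hf.mul h1).congr_of_eventuallyEq (g := fun _ => (1 : Mat m))
    (hne.mono fun s hs => (Matrix.mul_nonsing_inv _ (isUnit_iff_ne_zero.2 hs)).symm)
  have h3 : f' * (f t)⁻¹ + f t * D = 0 := by
    rw [← h2.matDeriv_eq, (hasMatDeriv_const 1 t).matDeriv_eq]
  have h4 : D = -((f t)⁻¹ * f' * (f t)⁻¹) := by
    have := congrArg ((f t)⁻¹ * ·) h3
    simp only [mul_add, mul_zero, ← mul_assoc, Matrix.nonsing_inv_mul _ h, one_mul] at this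
    exact eq_neg_of_add_eq_zero_right this
  rwa [h4] at h1

theorem eq_of_hasDerivAt_zero {φ : ℝ → ℂ} (h : ∀ t ∈ Ioo l u, HasDerivAt φ 0 t) {s t : ℝ}
    (hs : s ∈ Ioo l u) (ht : t ∈ Ioo l u) : φ s = φ t :=
  isOpen_Ioo.is_const_of_deriv_eq_zero isPreconnected_Ioo
    (fun x hx => (h x hx).differentiableAt.differentiableWithinAt)
    (fun x hx => (h x hx).deriv) hs ht

theorem eq_of_hasMatDeriv_zero (h : ∀ t ∈ Ioo l u, HasMatDeriv f 0 t) {s t : ℝ}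
    (hs : s ∈ Ioo l u) (ht : t ∈ Ioo l u) : f s = f t := by
  ext a b
  exact eq_of_hasDerivAt_zero (fun x hx => h x hx a b) hs ht

end Calculus

/-! ### Gauge transformations -/

section Gauge

variable {m : ℕ} {α β g : ℝ → Mat m} {g' : Mat m} {t l u : ℝ}

theorem HasMatDeriv.gaugeAlpha_eq (hg : HasMatDeriv g g' t) :
    gaugeAlpha g α t = g t * α t * (g t)⁻¹ - (1 / 2 : ℂ) • (g' * (g t)⁻¹) := by
  rw [gaugeAlpha, hg.matDeriv_eq]

/-- The equation of a complex is preserved by gauge transformations. -/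
theorem HasMatDeriv.gaugeBeta (hg : HasMatDeriv g g' t) (hdet : IsUnit (g t).det)
    (hβ : HasMatDeriv β (-((2 : ℂ) • (α t * β t - β t * α t))) t) :
    HasMatDeriv (gaugeBeta g β) (-((2 : ℂ) • (gaugeAlpha g α t * gaugeBeta g β t -
      gaugeBeta g β t * gaugeAlpha g α t))) t := by
  have h := (hg.mul hβ).mul (hg.inv hdet)
  have hinv : (g t)⁻¹ * g t = 1 := Matrix.nonsing_inv_mul _ hdet
  have hinv' : ∀ A : Mat m, (g t)⁻¹ * (g t * A) = A := fun A => by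
    rw [← mul_assoc, hinv, one_mul]
  rw [hg.gaugeAlpha_eq]
  -- The factor 1/2 in the action on α cancels the 2 in the equation, so the terms with ġ g⁻¹ match
  -- those from differentiating g and g⁻¹.
  have e : -((2 : ℂ) • ((g t * α t * (g t)⁻¹ - (1 / 2 : ℂ) • (g' * (g t)⁻¹)) *
      NahmNF.gaugeBeta g β t -
      NahmNF.gaugeBeta g β t * (g t * α t * (g t)⁻¹ - (1 / 2 : ℂ) • (g' * (g t)⁻¹)))) =
      (g' * β t + g t * -((2 : ℂ) • (α t * β t - β t * α t))) * (g t)⁻¹ +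
        g t * β t * -((g t)⁻¹ * g' * (g t)⁻¹) := by
    simp only [NahmNF.gaugeBeta, sub_mul, mul_sub, add_mul, mul_neg, neg_mul, smul_sub,
      smul_mul_assoc, mul_smul_comm, mul_assoc, hinv']
    module
  rw [e]
  exact h

theorem hasMatDeriv_of_complex (hβ : SmoothOn l u β) (ht : t ∈ Ioo l u)
    (h : matDeriv β t + (2 : ℂ) • (α t * β t - β t * α t) = 0) :
    HasMatDeriv β (-((2 : ℂ) • (α t * β t - β t * α t))) t := by
  rw [← eq_neg_of_add_eq_zero_left h]
  exact hβ.hasMatDeriv ht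

theorem IsGauge.mul {h : ℝ → Mat m} (hg : IsGauge l u g) (hh : IsGauge l u h) :
    IsGauge l u fun t => g t * h t where
  smooth := hg.smooth.mul hh.smooth
  continuous := continuousOn_mul_entry hg.continuous hh.continuous
  invertible t ht := by
    rw [Matrix.det_mul]
    exact (hg.invertible t ht).mul (hh.invertible t ht)

theorem IsGauge.const {A : Mat m} (hA : IsUnit A.det) : IsGauge l u fun _ => A where
  smooth := SmoothOn.const A
  continuous _ _ := continuousOn_const
  invertible _ _ := hA

theorem IsGauge.comp {θ : ℝ → ℝ} {l' u' : ℝ} (hg : IsGauge l u g) (hθ : ContDiff ℝ ∞ θ)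
    (hm : MapsTo θ (Ioo l' u') (Ioo l u)) (hm' : MapsTo θ (Icc l' u') (Icc l u)) :
    IsGauge l' u' fun t => g (θ t) where
  smooth := hg.smooth.comp hθ.contDiffOn hm
  continuous a b := (hg.continuous a b).comp hθ.continuous.continuousOn hm'
  invertible _ ht := hg.invertible _ (hm' ht)

theorem IsGauge.mono {l' u' : ℝ} (hg : IsGauge l u g) (hl : l ≤ l') (hu : u' ≤ u) :
    IsGauge l' u' g where
  smooth := hg.smooth.mono hl hu
  continuous a b := (hg.continuous a b).mono (Icc_subset_Icc hl hu)
  invertible t ht := hg.invertible t (Icc_subset_Icc hl hu ht)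

theorem IsGauge.inv (hg : IsGauge l u g) : IsGauge l u fun t => (g t)⁻¹ where
  smooth := hg.smooth.inv fun t ht => hg.invertible t (Ioo_subset_Icc_self ht)
  continuous := continuousOn_inv_entry hg.continuous hg.invertible
  invertible t ht := by
    rw [Matrix.det_nonsing_inv]
    exact (isUnit_ringInverse).2 (hg.invertible t ht)

theorem IsGauge.transpose (hg : IsGauge l u g) : IsGauge l u fun t => (g t)ᵀ where
  smooth := hg.smooth.transpose
  continuous a b := hg.continuous b a
  invertible t ht := by
    rw [Matrix.det_transpose]
    exact hg.invertible t ht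

theorem IsGauge.reflect (hg : IsGauge l u g) : IsGauge (-u) (-l) fun t => g (-t) :=
  hg.comp contDiff_neg (fun t ht => ⟨by linarith [ht.2], by linarith [ht.1]⟩)
    (fun t ht => ⟨by linarith [ht.2], by linarith [ht.1]⟩)

/-- A smooth step function, `0` on the left of `p` and `1` on the right of `q`. -/
def stepFun (p q t : ℝ) : ℝ := Real.smoothTransition ((t - p) / (q - p))

theorem contDiff_stepFun (p q : ℝ) : ContDiff ℝ ∞ (stepFun p q) :=
  Real.smoothTransition.contDiff.comp (by fun_prop)

theorem stepFun_of_le {p q t : ℝ} (hpq : p < q) (ht : t ≤ p) : stepFun p q t = 0 :=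
  Real.smoothTransition.zero_of_nonpos
    (div_nonpos_of_nonpos_of_nonneg (by linarith) (by linarith))

theorem stepFun_of_ge {p q t : ℝ} (hpq : p < q) (ht : q ≤ t) : stepFun p q t = 1 :=
  Real.smoothTransition.one_of_one_le ((one_le_div (by linarith)).2 (by linarith))

theorem stepFun_mem (p q t : ℝ) : stepFun p q t ∈ Icc (0 : ℝ) 1 :=
  ⟨Real.smoothTransition.nonneg _, Real.smoothTransition.le_one _⟩

/-- A gauge transformation can be continued beyond the right end, at the price of a change
near that end, and made constant there. -/
theorem IsGauge.extend_right {p q v : ℝ} (hg : IsGauge l u g) (hlp : l < p) (hpq : p < q)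
    (hqu : q < u) :
    ∃ h : ℝ → Mat m, IsGauge l v h ∧ (∀ t ≤ p, h t = g t) ∧ ∀ t, q ≤ t → h t = g q := by
  -- A change of time that is the identity up to p and stops at q. Since g ∘ θ takes only values of
  -- g, invertibility is automatic.
  set θ : ℝ → ℝ := fun t => t + stepFun p q t * (q - t) with hθ
  have hlo : ∀ t, q ≤ t → θ t = q := fun t ht => by simp [hθ, stepFun_of_ge hpq ht]
  have hmem : ∀ t ≤ q, t ≤ θ t ∧ θ t ≤ q := fun t ht => by
    have := stepFun_mem p q t
    simp only [hθ]
    constructor <;> nlinarith [this.1, this.2]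
  refine ⟨fun t => g (θ t), hg.comp ?_ ?_ ?_, fun _ ht => ?_, fun t ht => congrArg g (hlo t ht)⟩
  · exact contDiff_id.add ((contDiff_stepFun p q).mul (contDiff_const.sub contDiff_id))
  · intro t ht
    rcases le_total q t with h | h
    · rw [hlo t h]
      exact ⟨hlp.trans hpq, hqu⟩
    · exact ⟨ht.1.trans_le (hmem t h).1, (hmem t h).2.trans_lt hqu⟩
  · intro t ht
    rcases le_total q t with h | h
    · rw [hlo t h]
      exact ⟨(hlp.trans hpq).le, hqu.le⟩
    · exact ⟨ht.1.trans (hmem t h).1, (hmem t h).2.trans hqu.le⟩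
  · simp [hθ, stepFun_of_le hpq ht]

theorem IsGauge.extend_left {p q v : ℝ} (hg : IsGauge l u g) (hlp : l < p) (hpq : p < q)
    (hqu : q < u) :
    ∃ h : ℝ → Mat m, IsGauge v u h ∧ (∀ t, q ≤ t → h t = g t) ∧ ∀ t ≤ p, h t = g p := by
  obtain ⟨h, h1, h2, h3⟩ := hg.reflect.extend_right (v := -v) (neg_lt_neg hqu) (neg_lt_neg hpq)
    (neg_lt_neg hlp)
  refine ⟨fun t => h (-t), by simpa using h1.reflect, fun t ht => ?_, fun t ht => ?_⟩
  · exact (h2 (-t) (neg_le_neg ht)).trans (by rw [neg_neg])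
  · exact (h3 (-t) (neg_le_neg ht)).trans (by rw [neg_neg])

/-- `GL_m(ℂ)` is connected, by explicit smooth paths. -/
theorem exists_path_ne_zero {A : Mat m} (hA : IsUnit A.det) :
    ∃ η : ℝ, ∀ x ∈ Icc (0 : ℝ) 1,
      IsUnit (1 + ((x : ℂ) + η * (x * (1 - x)) * Complex.I) • (A - 1)).det := by
  let p : Polynomial ℂ := (1 + (Polynomial.X : Polynomial ℂ) • (A - 1).map Polynomial.C).det
  have hp : ∀ s : ℂ, p.eval s = (1 + s • (A - 1)).det := by
    intro s
    rw [← Polynomial.coe_evalRingHom, RingHom.map_det]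
    congr 1
    ext i j
    rcases eq_or_ne i j with rfl | hij
    · simp
    · simp [hij]
      ring
  have hp0 : p ≠ 0 := by
    intro h0
    have := hp 0
    simp [h0] at this
  -- The curve s(x) = x + iηx(1 - x) has real part x, so for 0 < x < 1 it passes through a root r
  -- for at most one η. Finitely many roots exclude finitely many η.
  obtain ⟨η, hη⟩ := Infinite.exists_notMem_finset
    (p.roots.toFinset.image fun r => r.im / (r.re * (1 - r.re)))
  refine ⟨η, fun x hx => isUnit_iff_ne_zero.2 fun h0 => ?_⟩
  rw [← hp] at h0
  rcases eq_or_ne x 0 with rfl | hx0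
  · rw [hp] at h0
    simp at h0
  rcases eq_or_ne x 1 with rfl | hx1
  · rw [hp] at h0
    simp [hA.ne_zero] at h0
  refine hη ?_
  simp only [Finset.mem_image, Multiset.mem_toFinset]
  refine ⟨_, (Polynomial.mem_roots hp0).2 h0, ?_⟩
  have : x * (1 - x) ≠ 0 := mul_ne_zero hx0 (sub_ne_zero.2 hx1.symm)
  simp
  field_simp

/-- Gauge transformations near the two ends are restrictions of a global one. -/
theorem exists_gauge_glue {l₁ c d lN : ℝ} {gL gR : ℝ → Mat m} (h₁ : l₁ < c) (hcd : c ≤ d)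
    (h₂ : d < lN) (hL : IsGauge l₁ c gL) (hR : IsGauge d lN gR) :
    ∃ g, IsGauge l₁ lN g ∧ (∃ p, l₁ < p ∧ ∀ t ≤ p, g t = gL t) ∧
      ∃ q, q < lN ∧ ∀ t, q ≤ t → g t = gR t := by
  obtain ⟨p, hp1, hp2⟩ := exists_between h₁
  obtain ⟨p', hp3, hp4⟩ := exists_between hp2
  obtain ⟨q', hq1, hq2⟩ := exists_between h₂
  obtain ⟨q, hq3, hq4⟩ := exists_between hq2
  obtain ⟨f, f1, f2, f3⟩ := hL.extend_right (v := lN) hp1 hp3 hp4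
  obtain ⟨h, h1, h2, h3⟩ := hR.extend_left (v := l₁) hq1 hq3 hq4
  have hG₀ := hL.invertible p' ⟨(hp1.trans hp3).le, hp4.le⟩
  have hG₁ := hR.invertible q' ⟨hq1.le, hq2.le⟩
  set G₀ := gL p'
  set G₁ := gR q'
  have hA : IsUnit (G₀⁻¹ * G₁).det := by
    rw [Matrix.det_mul, Matrix.det_nonsing_inv]
    exact ((isUnit_ringInverse).2 hG₀).mul hG₁
  obtain ⟨η, hη⟩ := exists_path_ne_zero hA
  have hpq : p' < q' := hp4.trans (hcd.trans_lt hq1)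
  let s : ℝ → ℂ := fun t => (stepFun p' q' t : ℂ) +
    η * ((stepFun p' q' t : ℂ) * (1 - (stepFun p' q' t : ℂ))) * Complex.I
  have hs : ContDiff ℝ ∞ s := by
    have h0 : ContDiff ℝ ∞ fun t => (stepFun p' q' t : ℂ) :=
      Complex.ofRealCLM.contDiff.comp (contDiff_stepFun p' q')
    exact h0.add ((contDiff_const.mul (h0.mul (contDiff_const.sub h0))).mul contDiff_const)
  have hH : IsGauge l₁ lN fun t => 1 + s t • (G₀⁻¹ * G₁ - 1) := by
    have hsm : ∀ a b, ContDiff ℝ ∞ fun t => (1 + s t • (G₀⁻¹ * G₁ - 1) : Mat m) a b :=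
      fun a b => contDiff_const.add (hs.mul contDiff_const)
    exact ⟨fun a b => (hsm a b).contDiffOn, fun a b => (hsm a b).continuous.continuousOn,
      fun t _ => hη _ (stepFun_mem _ _ _)⟩
  -- Left of p the last factor is G₁ and the path is at 1; right of q the first factor is G₀ and the
  -- path is at G₀⁻¹G₁. In both regions the constants cancel.
  refine ⟨_, ((f1.mul hH).mul (IsGauge.const (A := G₁⁻¹) ?_)).mul h1, ⟨p, hp1, fun t ht => ?_⟩,
    q, hq4, fun t ht => ?_⟩
  · rw [Matrix.det_nonsing_inv]
    exact (isUnit_ringInverse).2 hG₁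
  · have hs0 : s t = 0 := by simp [s, stepFun_of_le hpq (ht.trans hp3.le)]
    rw [f2 t ht, h3 t (ht.trans (hp3.trans hpq).le), hs0, zero_smul, add_zero, mul_one, mul_assoc,
      Matrix.nonsing_inv_mul _ hG₁, mul_one]
  · have hs1 : s t = 1 := by simp [s, stepFun_of_ge hpq (hq3.le.trans ht)]
    rw [h2 t ht, f3 t ((hpq.trans hq3).le.trans ht), hs1, one_smul, add_sub_cancel,
      ← mul_assoc, Matrix.mul_nonsing_inv _ hG₀, one_mul, Matrix.mul_nonsing_inv _ hG₁, one_mul]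

end Gauge

/-! ### Trivialization on compact intervals -/

section Local

variable {m : ℕ} {α β : ℝ → Mat m} {l u : ℝ}

/-- Solutions of `g' = A g` with `g = 1` at the left end of the interval. -/
theorem exists_fundamental_matrix {A : ℝ → Mat m} {p q : ℝ} (hA : SmoothOn l u A) (hlp : l < p)
    (hpq : p < q) (hqu : q < u) :
    ∃ g : ℝ → Mat m, (∀ t ∈ Ioo p q, HasMatDeriv g (A t * g t) t) ∧ SmoothOn p q g ∧
      ∀ a b, Tendsto (fun t => g t a b) (𝓝[>] p) (𝓝 ((1 : Mat m) a b)) := by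
  have hT : 0 < q - p := sub_pos.2 hpq
  have hAc : ∀ a b, ContinuousOn (fun t => A t a b) (Icc p q) := fun a b =>
    (hA a b).continuousOn.mono (Icc_subset_Ioo hlp hqu)
  have hbd : ∀ a b, ∃ K, ∀ t ∈ Icc p q, ‖A t a b‖ ≤ K := fun a b =>
    isCompact_Icc.exists_bound_of_continuousOn (hAc a b)
  choose K hK using hbd
  have hmap : ∀ t ∈ Ioo 0 (q - p), p + t ∈ Icc p q := fun t ht =>
    ⟨by linarith [ht.1], by linarith [ht.2]⟩
  have hex : ∀ c : Fin m, ∃ y : Fin m → ℝ → ℂ,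
      (∀ a, ∀ t ∈ Ioo 0 (q - p), HasDerivAt (y a)
        (-(((0 : ℝ) / t : ℝ) : ℂ) * y a t + ∑ b, A (p + t) a b * y b t) t) ∧
      ∃ C, ∀ a, ∀ t ∈ Ioo 0 (q - p), ‖y a t - (1 : Mat m) a c‖ ≤ C * t := by
    intro c
    -- The regular case κ = 0, one column at a time, with time measured from p.
    refine exists_singular_linear_ode (K := ∑ a, ∑ b, |K a b|) hT (κ := fun _ => 0)
      (fun _ => le_rfl) (G := fun a b t => A (p + t) a b) (fun a b => ?_) (fun a b t ht => ?_)
      (u₀ := fun a => (1 : Mat m) a c) (by simp)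
    · exact (hAc a b).comp (by fun_prop) hmap
    · refine (hK a b _ (hmap t ht)).trans ((le_abs_self _).trans ?_)
      refine (Finset.single_le_sum (f := fun b => |K a b|) (fun _ _ => abs_nonneg _)
        (Finset.mem_univ b)).trans ?_
      exact Finset.single_le_sum (f := fun a => ∑ b, |K a b|)
        (fun _ _ => Finset.sum_nonneg fun _ _ => abs_nonneg _) (Finset.mem_univ a)
  choose y hy C hC using hex
  have hmem : ∀ t ∈ Ioo p q, t - p ∈ Ioo 0 (q - p) := fun t ht =>
    ⟨by linarith [ht.1], by linarith [ht.2]⟩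
  have hder : ∀ t ∈ Ioo p q,
      HasMatDeriv (fun t => Matrix.of fun a c => y c a (t - p))
        (A t * (Matrix.of fun a c => y c a (t - p) : Mat m)) t := by
    intro t ht a c
    have := (hy c a (t - p) (hmem t ht)).comp_sub_const t p
    simpa [Matrix.mul_apply] using this
  refine ⟨fun t => Matrix.of fun a c => y c a (t - p), hder, fun a c => ?_, fun a c => ?_⟩
  · refine contDiffOn_of_linear_ode (u := fun a t => y c a (t - p)) isOpen_Ioo
      (M := fun a b t => A t a b) (fun a b => (hA a b).mono (Ioo_subset_Ioo hlp.le hqu.le))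
      (fun a t ht => ?_) a
    have := hder t ht a c
    simpa [Matrix.mul_apply] using this
  · rw [tendsto_iff_norm_sub_tendsto_zero]
    have h0 : Tendsto (fun t => C c * (t - p)) (𝓝[>] p) (𝓝 0) := by
      refine (Continuous.tendsto' (by fun_prop) p _ (by simp)).mono_left nhdsWithin_le_nhds
    refine squeeze_zero' (Eventually.of_forall fun _ => norm_nonneg _) ?_ h0
    filter_upwards [Ioo_mem_nhdsGT hpq] with t ht using hC c a _ (hmem t ht)

/-- The equation ġ = 2gα is solved through its transpose. If h solves ḣ = -2αh with the same limit 1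
at p, then gh has derivative zero, hence gh = 1 and g is invertible. -/
theorem exists_trivializing_gauge (hα : SmoothOn l u α) {p q : ℝ} (hlp : l < p) (hpq : p < q)
    (hqu : q < u) :
    ∃ g : ℝ → Mat m, SmoothOn p q g ∧ (∀ t ∈ Ioo p q, IsUnit (g t).det) ∧
      ∀ t ∈ Ioo p q, HasMatDeriv g ((2 : ℂ) • (g t * α t)) t := by
  obtain ⟨f, hf, hfs, hf1⟩ :=
    exists_fundamental_matrix (A := fun t => (2 : ℂ) • (α t)ᵀ) (hα.transpose.smul 2) hlp hpq hqu
  obtain ⟨h, hh, -, hh1⟩ :=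
    exists_fundamental_matrix (A := fun t => (-2 : ℂ) • α t) (hα.smul (-2)) hlp hpq hqu
  have hg : ∀ t ∈ Ioo p q, HasMatDeriv (fun t => (f t)ᵀ) ((2 : ℂ) • ((f t)ᵀ * α t)) t := by
    intro t ht
    have := (hf t ht).transpose
    simpa [Matrix.transpose_mul] using this
  have hconst : ∀ t ∈ Ioo p q, HasMatDeriv (fun t => (f t)ᵀ * h t) 0 t := by
    intro t ht
    have := (hg t ht).mul (hh t ht)
    simpa [mul_assoc] using this
  have hone : ∀ t ∈ Ioo p q, (f t)ᵀ * h t = 1 := by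
    intro t ht
    ext a b
    have h1 : Tendsto (fun t => ((f t)ᵀ * h t) a b) (𝓝[>] p) (𝓝 ((1 : Mat m) a b)) := by
      have : (1 : Mat m) a b = ∑ c, (1 : Mat m) c a * (1 : Mat m) c b := by
        rw [← Matrix.transpose_one, ← mul_one (1 : Mat m)ᵀ, Matrix.mul_apply]
        simp
      rw [this]
      simp only [Matrix.mul_apply, Matrix.transpose_apply]
      exact tendsto_finsetSum _ fun c _ => (hf1 c a).mul (hh1 c b)
    refine tendsto_nhds_unique (tendsto_const_nhds.congr' ?_) h1
    filter_upwards [Ioo_mem_nhdsGT hpq] with s hs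
    rw [eq_of_hasMatDeriv_zero hconst ht hs]
  refine ⟨fun t => (f t)ᵀ, hfs.transpose, fun t ht => ?_, hg⟩
  refine IsUnit.of_mul_eq_one (h t).det ?_
  rw [← Matrix.det_mul, hone t ht, Matrix.det_one]

/-- Near a compact interval, a solution of the complex equation is equivalent to a
constant one. -/
theorem exists_gauge_const (hα : SmoothOn l u α) (hβ : SmoothOn l u β)
    (heq : ∀ t ∈ Ioo l u, matDeriv β t + (2 : ℂ) • (α t * β t - β t * α t) = 0) {a b : ℝ}
    (hla : l < a) (hab : a < b) (hbu : b < u) :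
    ∃ g : ℝ → Mat m, IsGauge l u g ∧ ∃ β₀ : Mat m, ∀ t ∈ Icc a b,
      gaugeAlpha g α t = 0 ∧ gaugeBeta g β t = β₀ := by
  -- Nested intervals: the equation is solved on (p₄, q₄), the solution is a gauge transformation on
  -- [p₃, q₃], it is cut off between p₂ and p₁ and between q₁ and q₂, and it is unchanged on [p₁,
  -- q₁], whose interior contains [a, b].
  obtain ⟨p₄, hp4, h⟩ := exists_between hla
  obtain ⟨p₃, hp3, h⟩ := exists_between h
  obtain ⟨p₂, hp2, h⟩ := exists_between h
  obtain ⟨p₁, hp1, hp0⟩ := exists_between h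
  obtain ⟨q₁, hq0, h⟩ := exists_between hbu
  obtain ⟨q₂, hq1, h⟩ := exists_between h
  obtain ⟨q₃, hq2, h⟩ := exists_between h
  obtain ⟨q₄, hq3, hq4⟩ := exists_between h
  obtain ⟨g, g1, g2, g3⟩ := exists_trivializing_gauge hα hp4 (by linarith : p₄ < q₄) hq4
  have hg : IsGauge p₃ q₃ g :=
    ⟨g1.mono hp3.le hq3.le, fun a b => (g1 a b).continuousOn.mono (Icc_subset_Ioo hp3 hq3),
      fun t ht => g2 t (Icc_subset_Ioo hp3 hq3 ht)⟩
  obtain ⟨f, f1, f2, -⟩ := hg.extend_right (v := u) (by linarith : p₃ < q₁) hq1 hq2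
  obtain ⟨h, h1, h2, -⟩ := f1.extend_left (v := l) hp2 hp1 (by linarith : p₁ < u)
  have hfg : ∀ t ∈ Icc p₁ q₁, h t = g t := fun t ht => by rw [h2 t ht.1, f2 t ht.2]
  have hd : ∀ t ∈ Ioo p₁ q₁, HasMatDeriv h ((2 : ℂ) • (h t * α t)) t := by
    intro t ht
    rw [hfg t (Ioo_subset_Icc_self ht)]
    refine (g3 t ⟨by linarith [ht.1], by linarith [ht.2]⟩).congr_of_eventuallyEq ?_
    filter_upwards [isOpen_Ioo.mem_nhds ht] with s hs using hfg s (Ioo_subset_Icc_self hs)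
  have hu : ∀ t ∈ Ioo p₁ q₁, IsUnit (h t).det := fun t ht =>
    h1.invertible t ⟨by linarith [ht.1], by linarith [ht.2]⟩
  have hα0 : ∀ t ∈ Ioo p₁ q₁, gaugeAlpha h α t = 0 := by
    intro t ht
    rw [(hd t ht).gaugeAlpha_eq, smul_mul_assoc, smul_smul]
    norm_num
  have hβ0 : ∀ t ∈ Ioo p₁ q₁, HasMatDeriv (gaugeBeta h β) 0 t := by
    intro t ht
    have ht' : t ∈ Ioo l u := ⟨by linarith [ht.1], by linarith [ht.2]⟩
    have := (hd t ht).gaugeBeta (hu t ht) (hasMatDeriv_of_complex hβ ht' (heq t ht'))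
    simpa [hα0 t ht] using this
  refine ⟨h, h1, gaugeBeta h β a, fun t ht => ?_⟩
  have ht' := Icc_subset_Ioo hp0 hq0 ht
  exact ⟨hα0 t ht', eq_of_hasMatDeriv_zero hβ0 ht' ⟨hp0, hab.trans hq0⟩⟩

end Local

/-! ### Block matrices with weights -/

section Weights

variable {m : ℕ} {κ : Type*} {sz : κ → ℕ} (e : Fin m ≃ Σ b : κ, Fin (sz b))

/-- The order of vanishing prescribed for a matrix entry. -/
def weight (a b : Fin m) : ℝ := |(sz (e a).1 : ℝ) - (sz (e b).1 : ℝ)| / 2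

theorem weight_nonneg (a b : Fin m) : 0 ≤ weight e a b := by
  unfold weight
  positivity

/-- This inequality is what makes the weighted estimates multiplicative. -/
theorem weight_triangle (a b c : Fin m) : weight e a c ≤ weight e a b + weight e b c := by
  unfold weight
  have := abs_sub_le (sz (e a).1 : ℝ) (sz (e b).1 : ℝ) (sz (e c).1 : ℝ)
  linarith

theorem weight_eq_zero {a b : Fin m} (h : sz (e a).1 = sz (e b).1) : weight e a b = 0 := by
  simp [weight, h]

/-- The diagonal entries of `diag(x(sz b))_b`. -/
def xVal (a : Fin m) : ℝ := -((sz (e a).1 : ℝ) - 1) / 4 + ((e a).2 : ℕ) / 2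

/-- The block diagonal matrix `diag(x(sz b))_b`. -/
def xBlock : Mat m := Matrix.diagonal fun a => (xVal e a : ℂ)

/-- The block diagonal matrix `diag(y(sz b))_b`. -/
def yBlock [DecidableEq κ] : Mat m :=
  Matrix.of fun a b => if (e a).1 = (e b).1 ∧ ((e a).2 : ℕ) = (e b).2 + 1 then 1 else 0

/-- `f` is `O(t^(r + weight))` entrywise as `t` decreases to `0`. -/
def WeightO (r : ℝ) (f : ℝ → Mat m) : Prop :=
  ∀ a b, (fun t => f t a b) =O[𝓝[>] 0] fun t : ℝ => t ^ (r + weight e a b)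

theorem isBigO_rpow_of_le {p q : ℝ} (h : q ≤ p) :
    (fun t : ℝ => t ^ p) =O[𝓝[>] 0] fun t : ℝ => t ^ q := by
  refine IsBigO.of_bound 1 ?_
  filter_upwards [Ioo_mem_nhdsGT (zero_lt_one' ℝ)] with t ht
  rw [Real.norm_of_nonneg (Real.rpow_nonneg ht.1.le _),
    Real.norm_of_nonneg (Real.rpow_nonneg ht.1.le _), one_mul]
  exact Real.rpow_le_rpow_of_exponent_ge ht.1 ht.2.le h

variable {e}
variable {r s : ℝ} {f g : ℝ → Mat m}

theorem WeightO.add (hf : WeightO e r f) (hg : WeightO e r g) :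
    WeightO e r fun t => f t + g t := fun a b => (hf a b).add (hg a b)

theorem WeightO.sub (hf : WeightO e r f) (hg : WeightO e r g) :
    WeightO e r fun t => f t - g t := fun a b => (hf a b).sub (hg a b)

theorem WeightO.mono (hf : WeightO e r f) (h : s ≤ r) : WeightO e s f := fun a b =>
  (hf a b).trans (isBigO_rpow_of_le (by linarith))

theorem WeightO.congr (hf : WeightO e r f) (h : ∀ᶠ t in 𝓝[>] 0, g t = f t) : WeightO e r g :=
  fun a b => (hf a b).congr' (h.mono fun t ht => by simp only [ht]) EventuallyEq.rfl

theorem WeightO.mul (hf : WeightO e r f) (hg : WeightO e s g) :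
    WeightO e (r + s) fun t => f t * g t := by
  intro a b
  simp only [Matrix.mul_apply]
  refine IsBigO.fun_sum fun c _ => ?_
  refine ((hf a c).mul (hg c b)).trans ?_
  have : (fun t : ℝ => t ^ (r + weight e a c) * t ^ (s + weight e c b)) =ᶠ[𝓝[>] 0]
      fun t => t ^ (r + weight e a c + (s + weight e c b)) := by
    filter_upwards [self_mem_nhdsWithin] with t ht using (Real.rpow_add ht _ _).symm
  refine this.trans_isBigO (isBigO_rpow_of_le ?_)
  linarith [weight_triangle e a c b]

theorem WeightO.rpow_smul (hf : WeightO e r f) (p : ℝ) :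
    WeightO e (p + r) fun t => ((t ^ p : ℝ) : ℂ) • f t := by
  intro a b
  have h1 : (fun t : ℝ => ((t ^ p : ℝ) : ℂ)) =O[𝓝[>] 0] fun t : ℝ => t ^ p :=
    IsBigO.of_bound 1 (Eventually.of_forall fun t => by simp)
  refine (h1.mul (hf a b)).congr' EventuallyEq.rfl ?_
  filter_upwards [self_mem_nhdsWithin] with t ht
  rw [← Real.rpow_add ht, add_assoc]

theorem weightO_const {A : Mat m} (h : ∀ a b, sz (e a).1 ≠ sz (e b).1 → A a b = 0) :
    WeightO e 0 fun _ => A := by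
  intro a b
  by_cases hab : sz (e a).1 = sz (e b).1
  · simp only [weight_eq_zero e hab, add_zero, Real.rpow_zero]
    exact isBigO_const_const _ one_ne_zero _
  · simp only [h a b hab]
    exact isBigO_zero _ _

theorem weightO_yBlock [DecidableEq κ] : WeightO e 0 fun _ => yBlock e :=
  weightO_const fun a b h => if_neg fun h' => h (by rw [h'.1])

theorem weightO_one : WeightO e 0 fun _ => (1 : Mat m) :=
  weightO_const fun _ _ h => Matrix.one_apply_ne fun h' => h (by rw [h'])

/-- Products of small perturbations of constant matrices. -/
theorem WeightO.mul_sub_mul {A B : Mat m} (hA : WeightO e 0 fun _ => A)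
    (hB : WeightO e 0 fun _ => B) (hf : WeightO e 1 fun t => f t - A)
    (hg : WeightO e 1 fun t => g t - B) : WeightO e 1 fun t => f t * g t - A * B := by
  have h1 := ((hf.mul hg).mono (s := 1) (by norm_num)).add
    (((hf.mul hB).mono (s := 1) (by norm_num)).add ((hA.mul hg).mono (s := 1) (by norm_num)))
  refine h1.congr (Eventually.of_forall fun t => ?_)
  noncomm_ring

theorem WeightO.exists_bound (hf : WeightO e r f) :
    ∃ K, 0 < K ∧ ∀ᶠ t : ℝ in 𝓝[>] 0, ∀ a b, ‖f t a b‖ ≤ K * t ^ (r + weight e a b) := by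
  have h : ∀ a b, ∃ c > 0, IsBigOWith c (𝓝[>] 0) (fun t => f t a b)
    fun t : ℝ => t ^ (r + weight e a b) := fun a b => (hf a b).exists_pos
  choose c hc hO using h
  refine ⟨1 + ∑ a, ∑ b, c a b, ?_, ?_⟩
  · have : 0 ≤ ∑ a, ∑ b, c a b :=
      Finset.sum_nonneg fun a _ => Finset.sum_nonneg fun b _ => (hc a b).le
    linarith
  · simp only [eventually_all]
    intro a b
    filter_upwards [(hO a b).bound, self_mem_nhdsWithin] with t ht ht0
    rw [Real.norm_of_nonneg (Real.rpow_nonneg (le_of_lt ht0) _)] at ht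
    refine ht.trans (mul_le_mul_of_nonneg_right ?_ (Real.rpow_nonneg (le_of_lt ht0) _))
    have h1 : c a b ≤ ∑ b, c a b :=
      Finset.single_le_sum (f := fun b => c a b) (fun b _ => (hc a b).le) (Finset.mem_univ b)
    have h2 : ∑ b, c a b ≤ ∑ a, ∑ b, c a b :=
      Finset.single_le_sum (f := fun a => ∑ b, c a b)
        (fun a _ => Finset.sum_nonneg fun b _ => (hc a b).le) (Finset.mem_univ a)
    linarith

theorem WeightO.tendsto (hf : WeightO e r f) (hr : 0 < r) (a b : Fin m) :
    Tendsto (fun t => f t a b) (𝓝[>] 0) (𝓝 0) := by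
  refine (hf a b).trans_tendsto ?_
  have hp : 0 < r + weight e a b := by linarith [weight_nonneg e a b]
  exact ((Real.continuous_rpow_const hp.le).tendsto' 0 0 (Real.zero_rpow hp.ne')).mono_left
    nhdsWithin_le_nhds

/-- If `P = 1 + O(t)` and `P c` is bounded, in the weighted sense, then so is `c`. -/
theorem WeightO.of_mul {P c : ℝ → Mat m} (hP : WeightO e 1 fun t => P t - 1)
    (hc : WeightO e 0 fun t => P t * c t) : WeightO e 0 c := by
  obtain ⟨K, hK0, hK⟩ := hP.exists_bound
  obtain ⟨L, hL0, hL⟩ := hc.exists_bound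
  intro a₀ b
  have hsmall : ∀ᶠ t : ℝ in 𝓝[>] 0, t < 1 ∧ m * K * t < 1 / 2 := by
    refine Eventually.and (mem_nhdsWithin_of_mem_nhds (Iio_mem_nhds one_pos)) ?_
    have : Tendsto (fun t : ℝ => m * K * t) (𝓝[>] 0) (𝓝 0) :=
      (Continuous.tendsto' (by fun_prop) 0 0 (by simp)).mono_left nhdsWithin_le_nhds
    exact this.eventually (gt_mem_nhds (by norm_num))
  refine IsBigO.of_bound (2 * (m * L)) ?_
  filter_upwards [hK, hL, hsmall, self_mem_nhdsWithin] with t hKt hLt hst ht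
  have ht : 0 < t := ht
  -- The column b is fixed and its entries are rescaled by their weights. Then c = Pc - (P - 1)c
  -- becomes an unweighted linear inequality for v, with no need to estimate P⁻¹.
  set v : Fin m → ℝ := fun a => t ^ (-weight e a b) * ‖c t a b‖ with hv
  have hv0 : ∀ a, 0 ≤ v a := fun a => by positivity
  have hcv : ∀ a, ‖c t a b‖ = t ^ (weight e a b) * v a := fun a => by
    rw [hv, ← mul_assoc, ← Real.rpow_add ht]
    simp
  have hle : ∀ a, v a ≤ L + ∑ l, K * t * v l := by
    intro a
    have h1 : c t a b = (P t * c t) a b - ∑ l, (P t - 1) a l * c t l b := by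
      have : c t = P t * c t - (P t - 1) * c t := by noncomm_ring
      conv_lhs => rw [this]
      rw [Matrix.sub_apply, Matrix.mul_apply (M := P t - 1)]
    have h2 : ‖c t a b‖ ≤ L * t ^ (weight e a b) + ∑ l, K * t ^ (1 + weight e a l) * ‖c t l b‖ := by
      conv_lhs => rw [h1]
      refine (norm_sub_le _ _).trans (add_le_add (by simpa using hLt a b) ?_)
      refine (norm_sum_le _ _).trans (Finset.sum_le_sum fun l _ => ?_)
      rw [norm_mul]
      exact mul_le_mul_of_nonneg_right (hKt a l) (norm_nonneg _)
    have h3 : v a ≤ t ^ (-weight e a b) *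
        (L * t ^ (weight e a b) + ∑ l, K * t ^ (1 + weight e a l) * ‖c t l b‖) :=
      mul_le_mul_of_nonneg_left h2 (by positivity)
    refine h3.trans ?_
    rw [mul_add]
    refine add_le_add (le_of_eq ?_) ?_
    · rw [mul_left_comm, ← Real.rpow_add ht]
      simp
    · rw [Finset.mul_sum]
      refine Finset.sum_le_sum fun l _ => ?_
      rw [hcv l]
      calc t ^ (-weight e a b) * (K * t ^ (1 + weight e a l) * (t ^ weight e l b * v l))
          = K * t ^ (-weight e a b + (1 + weight e a l) + weight e l b) * v l := by
            rw [Real.rpow_add ht (-weight e a b + (1 + weight e a l)),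
              Real.rpow_add ht (-weight e a b)]
            ring
        _ ≤ K * t ^ (1 : ℝ) * v l := by
            refine mul_le_mul_of_nonneg_right (mul_le_mul_of_nonneg_left ?_ hK0.le) (hv0 l)
            refine Real.rpow_le_rpow_of_exponent_ge ht hst.1.le ?_
            linarith [weight_triangle e a l b]
        _ = K * t * v l := by rw [Real.rpow_one]
  have hsum : ∑ a, v a ≤ m * L + m * K * t * ∑ l, v l := by
    refine (Finset.sum_le_sum fun a _ => hle a).trans (le_of_eq ?_)
    simp [← Finset.mul_sum]
    ring
  have hS0 : 0 ≤ ∑ l, v l := Finset.sum_nonneg fun a _ => hv0 a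
  -- As mKt < 1/2, the sum on the right is absorbed on the left.
  have hS : ∑ a, v a ≤ 2 * (m * L) := by nlinarith [hst.2]
  have hva : v a₀ ≤ 2 * (m * L) :=
    (Finset.single_le_sum (fun a _ => hv0 a) (Finset.mem_univ a₀)).trans hS
  rw [hcv, zero_add, Real.norm_of_nonneg (Real.rpow_nonneg ht.le _), mul_comm]
  exact mul_le_mul_of_nonneg_right hva (Real.rpow_nonneg ht.le _)

end Weights

/-! ### Solutions attached to the first vectors of the blocks -/

section Singular

variable {m : ℕ} {κ : Type*} {sz : κ → ℕ} {e : Fin m ≃ Σ b : κ, Fin (sz b)}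
  {α : ℝ → Mat m} {ε : ℝ}

/-- The solution of `s' = -2 α s + (2 x_j / t) s` with `s = e_j + O(t)`, where `e_j` is the first
basis vector of a block. -/
theorem exists_column_solution (hε : 0 < ε) (hα : SmoothOn 0 ε α)
    (hα' : WeightO e 0 fun t => α t - ((t⁻¹ : ℝ) : ℂ) • xBlock e) {j : Fin m}
    (hj : ((e j).2 : ℕ) = 0) :
    ∃ η, 0 < η ∧ η ≤ ε ∧ ∃ s : Fin m → ℝ → ℂ,
      (∀ a, ∀ t ∈ Ioo 0 η, HasDerivAt (s a)
        (∑ b, (-2 * α t a b) * s b t + 2 * ((xVal e j * t⁻¹ : ℝ) : ℂ) * s a t) t) ∧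
      ∀ a, (fun t => s a t - (1 : Mat m) a j) =O[𝓝[>] 0] fun t : ℝ => t ^ (1 + weight e a j) := by
  obtain ⟨K, hK0, hK⟩ := hα'.exists_bound
  obtain ⟨η₁, hη₁, hη₁'⟩ := mem_nhdsGT_iff_exists_Ioo_subset.1 hK
  have hη₁ : 0 < η₁ := hη₁
  set η := min (min η₁ ε) 1 with hη
  have hη0 : 0 < η := by positivity
  have hηε : η ≤ ε := (min_le_left _ _).trans (min_le_right _ _)
  have hη1 : η ≤ 1 := min_le_right _ _
  have hbd : ∀ t ∈ Ioo 0 η, ∀ a b, ‖(α t - ((t⁻¹ : ℝ) : ℂ) • xBlock e) a b‖ ≤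
      K * t ^ (weight e a b) := by
    intro t ht a b
    simpa using hη₁' ⟨ht.1, ht.2.trans_le ((min_le_left _ _).trans (min_le_left _ _))⟩ a b
  -- Substituting s_a = t^(w a) u_a turns the equation into one for u with singular exponents κ' and
  -- coefficients -2 t^(w b - w a) A_ab.
  set w : Fin m → ℝ := fun a => weight e a j with hw
  set κ' : Fin m → ℝ := fun a => 2 * (xVal e a - xVal e j) + w a with hκ'
  -- Because j is first in its block, 2(x_a - x_j) = (sz_j - sz_a)/2 + pos_a; adding the weight
  -- |sz_a - sz_j|/2 makes this nonnegative.
  have hκ : ∀ a, 0 ≤ κ' a := by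
    intro a
    have h1 := le_abs_self ((sz (e a).1 : ℝ) - (sz (e j).1 : ℝ))
    have h2 : (0 : ℝ) ≤ ((e a).2 : ℕ) := Nat.cast_nonneg _
    simp only [hκ', hw, xVal, weight, hj, Nat.cast_zero]
    linarith
  have hwj : w j = 0 := weight_eq_zero e rfl
  have hκj : κ' j = 0 := by simp [hκ', hwj]
  set A : ℝ → Mat m := fun t => α t - ((t⁻¹ : ℝ) : ℂ) • xBlock e with hA
  have hrpow : ∀ p : ℝ, ContDiffOn ℝ ∞ (fun t : ℝ => ((t ^ p : ℝ) : ℂ)) (Ioo 0 ε) := fun p =>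
    Complex.ofRealCLM.contDiff.comp_contDiffOn fun t ht =>
      (Real.contDiffAt_rpow_const_of_ne ht.1.ne').contDiffWithinAt
  have hAc : ∀ a b, ContinuousOn (fun t => A t a b) (Ioo 0 η) := by
    intro a b
    refine ((hα a b).continuousOn.sub (ContinuousOn.mul ?_ continuousOn_const)).mono
      (Ioo_subset_Ioo_right hηε)
    simpa [Real.rpow_neg_one] using (hrpow (-1)).continuousOn
  obtain ⟨u, hu, C, hC⟩ := exists_singular_linear_ode (K := 2 * K) hη0 hκ
    (G := fun a b t => -2 * (((t ^ (w b - w a) : ℝ) : ℂ) * A t a b))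
    (fun a b => continuousOn_const.mul
      (((hrpow _).continuousOn.mono (Ioo_subset_Ioo_right hηε)).mul (hAc a b)))
    (fun a b t ht => by
      rw [norm_mul, norm_mul, Complex.norm_real, Real.norm_of_nonneg (Real.rpow_nonneg ht.1.le _)]
      have h1 : t ^ (w b - w a) * ‖A t a b‖ ≤ t ^ (w b - w a) * (K * t ^ weight e a b) :=
        mul_le_mul_of_nonneg_left (hbd t ht a b) (Real.rpow_nonneg ht.1.le _)
      have h2 : t ^ (w b - w a) * (K * t ^ weight e a b) = K * t ^ (w b - w a + weight e a b) := by
        rw [Real.rpow_add ht.1 (w b - w a)]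
        ring
      -- The triangle inequality makes the exponent nonnegative: the rescaled coefficients stay
      -- bounded.
      have h3 : t ^ (w b - w a + weight e a b) ≤ 1 :=
        Real.rpow_le_one ht.1.le (ht.2.le.trans hη1) (by
          have := weight_triangle e a b j
          simp only [hw]
          linarith)
      have h4 : ‖(-2 : ℂ)‖ = 2 := by simp
      rw [h4]
      nlinarith)
    (u₀ := fun a => (1 : Mat m) a j) (fun a => by
      rcases eq_or_ne a j with rfl | h
      · simp [hκj]
      · simp [Matrix.one_apply_ne h])
  refine ⟨η, hη0, hηε, fun a t => ((t ^ (w a) : ℝ) : ℂ) * u a t, fun a t ht => ?_, fun a => ?_⟩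
  · have h1 : HasDerivAt (fun t : ℝ => ((t ^ (w a) : ℝ) : ℂ)) ((w a * t ^ (w a - 1) : ℝ) : ℂ) t :=
      (Real.hasDerivAt_rpow_const (Or.inl ht.1.ne')).ofReal_comp
    refine (h1.mul (hu a t ht)).congr_deriv ?_
    have ht0 : (t : ℂ) ≠ 0 := by exact_mod_cast ht.1.ne'
    have hsum : ((t ^ (w a) : ℝ) : ℂ) * ∑ b, -2 * (((t ^ (w b - w a) : ℝ) : ℂ) * A t a b) * u b t =
        ∑ b, (-2 * α t a b) * (((t ^ (w b) : ℝ) : ℂ) * u b t) +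
          2 * (((xVal e a * t⁻¹ : ℝ) : ℂ)) * (((t ^ (w a) : ℝ) : ℂ) * u a t) := by
      rw [Finset.mul_sum]
      have hterm : ∀ b, ((t ^ (w a) : ℝ) : ℂ) * (-2 * (((t ^ (w b - w a) : ℝ) : ℂ) * A t a b) * u b t)
          = (-2 * α t a b) * (((t ^ (w b) : ℝ) : ℂ) * u b t) +
            if a = b then 2 * (((xVal e a * t⁻¹ : ℝ) : ℂ)) * (((t ^ (w a) : ℝ) : ℂ) * u a t)
              else 0 := by
        intro b
        have h2 : ((t ^ (w b) : ℝ) : ℂ) = ((t ^ (w a) : ℝ) : ℂ) * ((t ^ (w b - w a) : ℝ) : ℂ) := by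
          rw [← Complex.ofReal_mul, ← Real.rpow_add ht.1]
          congr 2
          ring
        by_cases hab : a = b
        · subst hab
          simp only [hA, Matrix.sub_apply, Matrix.smul_apply, xBlock, Matrix.diagonal_apply_eq,
            sub_self, Real.rpow_zero, if_true, smul_eq_mul]
          push_cast
          ring
        · rw [h2, if_neg hab]
          simp only [hA, Matrix.sub_apply, Matrix.smul_apply, xBlock,
            Matrix.diagonal_apply_ne _ hab, smul_zero, sub_zero]
          ring
      rw [Finset.sum_congr rfl fun b _ => hterm b, Finset.sum_add_distrib]
      simp
    rw [mul_add, hsum, Real.rpow_sub_one ht.1.ne']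
    simp only [hκ']
    push_cast
    field_simp
    ring
  · refine IsBigO.of_bound |C| ?_
    filter_upwards [Ioo_mem_nhdsGT hη0] with t ht
    have h1 : ((t ^ (w a) : ℝ) : ℂ) * u a t - (1 : Mat m) a j =
        ((t ^ (w a) : ℝ) : ℂ) * (u a t - (1 : Mat m) a j) := by
      rcases eq_or_ne a j with rfl | h
      · simp [hwj]
      · simp [Matrix.one_apply_ne h]
    rw [h1, norm_mul, Complex.norm_real, Real.norm_of_nonneg (Real.rpow_nonneg ht.1.le _),
      Real.norm_of_nonneg (Real.rpow_nonneg ht.1.le _), Real.rpow_add ht.1, Real.rpow_one]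
    calc t ^ w a * ‖u a t - (1 : Mat m) a j‖ ≤ t ^ w a * (|C| * t) := by
          refine mul_le_mul_of_nonneg_left ((hC a t ht).trans ?_) (Real.rpow_nonneg ht.1.le _)
          exact mul_le_mul_of_nonneg_right (le_abs_self C) ht.1.le
      _ = _ := by ring

end Singular

theorem HasMatDeriv.ofReal_smul {m : ℕ} {f : ℝ → Mat m} {f' : Mat m} {t : ℝ}
    (hf : HasMatDeriv f f' t) :
    HasMatDeriv (fun s => (s : ℂ) • f s) (f t + (t : ℂ) • f') t := by
  intro a b
  have h : HasDerivAt (fun s : ℝ => (s : ℂ)) 1 t := by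
    simpa using (hasDerivAt_id t).ofReal_comp
  exact (h.mul (hf a b)).congr_deriv (by simp)

/-! ### The frame generated by the action of tβ -/

section Singular

variable {m : ℕ} {κ : Type*} {sz : κ → ℕ} (e : Fin m ≃ Σ b : κ, Fin (sz b))
  {α β : ℝ → Mat m} {ε : ℝ}

/-- The first index of the block of `b`. -/
def initIdx (b : Fin m) : Fin m := e.symm ⟨(e b).1, ⟨0, (Nat.zero_le _).trans_lt (e b).2.2⟩⟩

theorem apply_symm_snd (x : Σ b : κ, Fin (sz b)) : ((e (e.symm x)).2 : ℕ) = x.2 :=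
  congrArg (fun y : Σ b : κ, Fin (sz b) => (y.2 : ℕ)) (e.apply_symm_apply x)

theorem initIdx_fst (b : Fin m) : (e (initIdx e b)).1 = (e b).1 := by simp [initIdx]

theorem initIdx_snd (b : Fin m) : ((e (initIdx e b)).2 : ℕ) = 0 := apply_symm_snd e _

theorem sigma_fin_ext {x y : Σ b : κ, Fin (sz b)} (h₁ : x.1 = y.1) (h₂ : (x.2 : ℕ) = y.2) :
    x = y := by
  obtain ⟨x1, x2⟩ := x
  obtain ⟨y1, y2⟩ := y
  obtain rfl : x1 = y1 := h₁
  obtain rfl : x2 = y2 := Fin.ext h₂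
  rfl

theorem idx_ext {a b : Fin m} (h₁ : (e a).1 = (e b).1) (h₂ : ((e a).2 : ℕ) = (e b).2) : a = b :=
  e.injective (sigma_fin_ext h₁ h₂)

theorem initIdx_congr {b b' : Fin m} (h : (e b).1 = (e b').1) : initIdx e b = initIdx e b' :=
  idx_ext e (by rw [initIdx_fst, initIdx_fst, h]) (by rw [initIdx_snd, initIdx_snd])

variable {e}

theorem exists_pred {b : Fin m} {p : ℕ} (h : ((e b).2 : ℕ) = p + 1) :
    ∃ c, (e b).1 = (e c).1 ∧ ((e c).2 : ℕ) = p := by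
  refine ⟨e.symm ⟨(e b).1, ⟨p, ?_⟩⟩, by simp, apply_symm_snd e _⟩
  have := (e b).2.2
  omega

theorem exists_succ {b : Fin m} (h : ((e b).2 : ℕ) + 1 < sz (e b).1) :
    ∃ c, (e c).1 = (e b).1 ∧ ((e c).2 : ℕ) = (e b).2 + 1 :=
  ⟨e.symm ⟨(e b).1, ⟨(e b).2 + 1, h⟩⟩, by simp, apply_symm_snd e _⟩

theorem yBlock_mul_apply_of_succ [DecidableEq κ] (A : Mat m) {b c : Fin m} (d : Fin m)
    (h₁ : (e b).1 = (e c).1) (h₂ : ((e b).2 : ℕ) = (e c).2 + 1) :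
    (yBlock e * A) b d = A c d := by
  rw [Matrix.mul_apply, Finset.sum_eq_single c]
  · simp [yBlock, h₁, h₂]
  · intro c' _ hc'
    have : ¬ ((e b).1 = (e c').1 ∧ ((e b).2 : ℕ) = (e c').2 + 1) := fun h =>
      hc' (idx_ext e (h.1.symm.trans h₁) (by omega))
    simp [yBlock, this]
  · simp

theorem yBlock_mul_apply_of_zero [DecidableEq κ] (A : Mat m) {b : Fin m} (d : Fin m)
    (h : ((e b).2 : ℕ) = 0) : (yBlock e * A) b d = 0 := by
  rw [Matrix.mul_apply]
  refine Finset.sum_eq_zero fun c _ => ?_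
  simp [yBlock, h]

theorem mul_yBlock_apply_of_succ [DecidableEq κ] (A : Mat m) {b c : Fin m} (d : Fin m)
    (h₁ : (e c).1 = (e b).1) (h₂ : ((e c).2 : ℕ) = (e b).2 + 1) :
    (A * yBlock e) d b = A d c := by
  rw [Matrix.mul_apply, Finset.sum_eq_single c]
  · simp [yBlock, h₁, h₂]
  · intro c' _ hc'
    have : ¬ ((e c').1 = (e b).1 ∧ ((e c').2 : ℕ) = (e b).2 + 1) := fun h =>
      hc' (idx_ext e (h.1.trans h₁.symm) (by omega))
    simp [yBlock, this]
  · simp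

theorem mul_yBlock_apply_of_last [DecidableEq κ] (A : Mat m) {b : Fin m} (d : Fin m)
    (h : ((e b).2 : ℕ) + 1 = sz (e b).1) : (A * yBlock e) d b = 0 := by
  rw [Matrix.mul_apply]
  refine Finset.sum_eq_zero fun c _ => ?_
  have : ¬ ((e c).1 = (e b).1 ∧ ((e c).2 : ℕ) = (e b).2 + 1) := fun h' => by
    have h2 := (e c).2.2
    have h3 : sz (e c).1 = sz (e b).1 := by rw [h'.1]
    omega
  simp [yBlock, this]

/-- The matrix whose column `b` is the first basis vector of the block of `b`. -/
def initMat (e : Fin m ≃ Σ b : κ, Fin (sz b)) : Mat m :=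
  Matrix.of fun a b => (1 : Mat m) a (initIdx e b)

theorem weightO_initMat : WeightO e 0 fun _ => initMat e := by
  refine weightO_const fun a b h => Matrix.one_apply_ne ?_
  rintro rfl
  rw [initIdx_fst] at h
  exact h rfl

/-- For p equal to the position of b, column b is the basis vector of b. This identifies the limit
of the frame as the identity matrix. -/
theorem yBlock_pow_mul_initMat [DecidableEq κ] (p : ℕ) (a b : Fin m) :
    (yBlock e ^ p * initMat e) a b = if (e a).1 = (e b).1 ∧ ((e a).2 : ℕ) = p then 1 else 0 := by
  induction p generalizing a with
  | zero =>
    rw [pow_zero, one_mul, initMat, Matrix.of_apply, Matrix.one_apply]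
    congr 1
    refine propext ⟨?_, fun h => idx_ext e (h.1.trans (initIdx_fst e b).symm)
      (h.2.trans (initIdx_snd e b).symm)⟩
    rintro rfl
    exact ⟨initIdx_fst e b, initIdx_snd e b⟩
  | succ p ih =>
    rw [pow_succ', mul_assoc]
    rcases Nat.eq_zero_or_eq_succ_pred ((e a).2 : ℕ) with h | h
    · rw [yBlock_mul_apply_of_zero _ _ h, if_neg (by omega)]
    · obtain ⟨c, hc1, hc2⟩ := exists_pred h
      rw [yBlock_mul_apply_of_succ _ _ hc1 (by omega), ih c]
      congr 1
      refine propext (and_congr (by rw [hc1]) ?_)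
      omega

/-- Every column of a block is a copy of the solution attached to its first index, so that powers of
tβ can act on the whole matrix at once. Finitely many columns leave a common interval. -/
theorem exists_column_matrix (hε : 0 < ε) (hα : SmoothOn 0 ε α)
    (hα' : WeightO e 0 fun t => α t - ((t⁻¹ : ℝ) : ℂ) • xBlock e) :
    ∃ η, 0 < η ∧ η ≤ ε ∧ ∃ S : ℝ → Mat m, SmoothOn 0 η S ∧
      (∀ t ∈ Ioo 0 η, HasMatDeriv S ((-2 : ℂ) • (α t * S t) + (2 * (t : ℂ)⁻¹) •
        (S t * Matrix.diagonal fun b => (xVal e (initIdx e b) : ℂ))) t) ∧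
      (WeightO e 1 fun t => S t - initMat e) ∧
      ∀ t a b b', (e b).1 = (e b').1 → S t a b = S t a b' := by
  have hex : ∀ j : Fin m, ∃ η : ℝ, ∃ s : Fin m → ℝ → ℂ, ((e j).2 : ℕ) = 0 → 0 < η ∧ η ≤ ε ∧
      (∀ a, ∀ t ∈ Ioo 0 η, HasDerivAt (s a)
        (∑ b, (-2 * α t a b) * s b t + 2 * ((xVal e j * t⁻¹ : ℝ) : ℂ) * s a t) t) ∧
      ∀ a, (fun t => s a t - (1 : Mat m) a j) =O[𝓝[>] 0]
        fun t : ℝ => t ^ (1 + weight e a j) := by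
    intro j
    by_cases hj : ((e j).2 : ℕ) = 0
    · obtain ⟨η, h1, h2, s, h3, h4⟩ := exists_column_solution hε hα hα' hj
      exact ⟨η, s, fun _ => ⟨h1, h2, h3, h4⟩⟩
    · exact ⟨0, 0, fun h => absurd h hj⟩
  choose η' s hs using hex
  have hη : ∃ η : ℝ, 0 < η ∧ η ≤ ε ∧ ∀ b, η ≤ η' (initIdx e b) := by
    have h1 : ∀ᶠ η : ℝ in 𝓝[>] 0, 0 < η ∧ η ≤ ε ∧ ∀ b, η ≤ η' (initIdx e b) := by
      refine eventually_mem_nhdsWithin.and (Eventually.and ?_ (eventually_all.2 fun b => ?_))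
      · exact mem_nhdsWithin_of_mem_nhds (Iic_mem_nhds hε)
      · exact mem_nhdsWithin_of_mem_nhds (Iic_mem_nhds (hs _ (initIdx_snd e b)).1)
    exact h1.exists
  obtain ⟨η, hη0, hηε, hηb⟩ := hη
  have hder : ∀ b a, ∀ t ∈ Ioo 0 η, HasDerivAt (s (initIdx e b) a)
      (∑ c, (-2 * α t a c) * s (initIdx e b) c t +
        2 * ((xVal e (initIdx e b) * t⁻¹ : ℝ) : ℂ) * s (initIdx e b) a t) t := fun b a t ht =>
    (hs _ (initIdx_snd e b)).2.2.1 a t ⟨ht.1, ht.2.trans_le (hηb b)⟩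
  refine ⟨η, hη0, hηε, fun t => Matrix.of fun a b => s (initIdx e b) a t, fun a b => ?_,
    fun t ht a b => ?_, fun a b => ?_, fun t a b b' h => ?_⟩
  · refine contDiffOn_of_linear_ode (u := s (initIdx e b)) isOpen_Ioo
      (M := fun a c t => -2 * α t a c +
        if a = c then 2 * ((xVal e (initIdx e b) * t⁻¹ : ℝ) : ℂ) else 0) (fun a c => ?_)
      (fun a t ht => ?_) a
    · refine ContDiffOn.add (contDiffOn_const.mul ((hα a c).mono (Ioo_subset_Ioo_right hηε))) ?_
      split_ifs
      · refine contDiffOn_const.mul (Complex.ofRealCLM.contDiff.comp_contDiffOn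
          (contDiffOn_const.mul (contDiffOn_id.inv fun t ht => ht.1.ne')))
      · exact contDiffOn_const
    · refine (hder b a t ht).congr_deriv ?_
      simp [add_mul, Finset.sum_add_distrib]
  · refine (hder b a t ht).congr_deriv ?_
    rw [Matrix.add_apply, Matrix.smul_apply, Matrix.smul_apply, Matrix.mul_diagonal,
      Matrix.mul_apply]
    simp only [Matrix.of_apply, smul_eq_mul, Finset.mul_sum]
    push_cast
    congr 1
    · exact Finset.sum_congr rfl fun c _ => by ring
    · ring
  · have h1 := (hs _ (initIdx_snd e b)).2.2.2 a
    have h2 : weight e a b = weight e a (initIdx e b) := by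
      unfold weight
      rw [initIdx_fst]
    rw [h2]
    exact h1
  · simp only [Matrix.of_apply, initIdx_congr e h]

/-- The frame `P` in which `α` becomes `x / t` and in which `β` acts as a shift inside the
blocks. -/
theorem exists_frame [DecidableEq κ] (hε : 0 < ε) (hα : SmoothOn 0 ε α) (hβ : SmoothOn 0 ε β)
    (heq : ∀ t ∈ Ioo 0 ε, HasMatDeriv β (-((2 : ℂ) • (α t * β t - β t * α t))) t)
    (hα' : WeightO e 0 fun t => α t - ((t⁻¹ : ℝ) : ℂ) • xBlock e)
    (hβ' : WeightO e 0 fun t => β t - ((t⁻¹ : ℝ) : ℂ) • yBlock e) :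
    ∃ η, 0 < η ∧ η ≤ ε ∧ ∃ P : ℝ → Mat m, SmoothOn 0 η P ∧
      (∀ t ∈ Ioo 0 η, HasMatDeriv P ((-2 : ℂ) • (α t * P t) + (2 * (t : ℂ)⁻¹) •
        (P t * xBlock e)) t) ∧
      (WeightO e 1 fun t => P t - 1) ∧
      ∀ t ∈ Ioo 0 η, ∀ a b c, (e c).1 = (e b).1 → ((e c).2 : ℕ) = (e b).2 + 1 →
        (β t * P t) a b = (t : ℂ)⁻¹ * P t a c := by
  obtain ⟨η, hη0, hηε, S, hS1, hS2, hS3, hS4⟩ := exists_column_matrix hε hα hα'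
  let V : ℕ → ℝ → Mat m := fun p t => ((t : ℂ) • β t) ^ p * S t
  have hV : ∀ p t, V (p + 1) t = ((t : ℂ) • β t) * V p t := fun p t => by
    simp only [V, pow_succ', mul_assoc]
  have hVs : ∀ p, SmoothOn 0 η (V p) := by
    intro p
    induction p with
    | zero => simpa only [V, pow_zero, one_mul] using hS1
    | succ p ih =>
      have h1 : SmoothOn 0 η fun t => (t : ℂ) • β t := fun a b =>
        Complex.ofRealCLM.contDiff.contDiffOn.mul ((hβ a b).mono (Ioo_subset_Ioo_right hηε))
      have h2 := h1.mul ih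
      simp only [← hV] at h2
      exact h2
  -- Since (tβ)˙ = β - 2[α, tβ], and the extra β is t⁻¹(tβ), each factor tβ raises the eigenvalue in
  -- the equation by 1/2.
  have hVd : ∀ p : ℕ, ∀ t ∈ Ioo 0 η, HasMatDeriv (V p) ((-2 : ℂ) • (α t * V p t) +
      (2 * (t : ℂ)⁻¹) • (V p t *
        Matrix.diagonal fun b => ((xVal e (initIdx e b) : ℂ) + p / 2))) t := by
    intro p
    induction p with
    | zero =>
      intro t ht
      have := hS2 t ht
      simpa [V] using this
    | succ p ih =>
      intro t ht
      have ht0 : (t : ℂ) ≠ 0 := by exact_mod_cast ht.1.ne'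
      have h1 := (heq t ⟨ht.1, ht.2.trans_le hηε⟩).ofReal_smul.mul (ih t ht)
      have h2 := h1.congr_of_eventuallyEq (Eventually.of_forall fun s => hV p s)
      have hD : (Matrix.diagonal fun b => ((xVal e (initIdx e b) : ℂ) + (p + 1 : ℕ) / 2) : Mat m) =
          (Matrix.diagonal fun b => ((xVal e (initIdx e b) : ℂ) + p / 2)) + (1 / 2 : ℂ) • 1 := by
        rw [← Matrix.diagonal_one, ← Matrix.diagonal_smul, Matrix.diagonal_add]
        congr 1
        funext b
        simp
        ring
      rw [hD, hV]
      convert h2 using 1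
      simp only [mul_add, add_mul, sub_mul, mul_smul_comm, smul_mul_assoc, mul_one,
        mul_assoc, smul_neg, neg_mul, smul_sub, smul_add, smul_smul]
      match_scalars <;> field_simp
      norm_num
  have hVw : ∀ p : ℕ, WeightO e 1 fun t => V p t - yBlock e ^ p * initMat e := by
    have hb : WeightO e 1 fun t => (t : ℂ) • β t - yBlock e := by
      have h1 := hβ'.rpow_smul 1
      rw [add_zero] at h1
      refine h1.congr ?_
      filter_upwards [self_mem_nhdsWithin] with t ht
      have ht0 : (t : ℂ) ≠ 0 := by exact_mod_cast (ne_of_gt ht : t ≠ 0)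
      rw [Real.rpow_one, smul_sub, smul_smul, Complex.ofReal_inv, mul_inv_cancel₀ ht0, one_smul]
    have hyp : ∀ p : ℕ, WeightO e 0 fun _ => yBlock e ^ p * initMat e := by
      intro p
      induction p with
      | zero => simpa using weightO_initMat
      | succ p ih =>
        have := weightO_yBlock.mul ih
        simpa [pow_succ', mul_assoc] using this
    intro p
    induction p with
    | zero => simpa [V] using hS3
    | succ p ih =>
      have := WeightO.mul_sub_mul weightO_yBlock (hyp p) hb ih
      simpa only [hV, pow_succ', mul_assoc] using this
  -- Column b of the frame is taken from the power of tβ given by the position of b; its eigenvalue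
  -- is then x_b.
  refine ⟨η, hη0, hηε, fun t => Matrix.of fun a b => V (e b).2 t a b, fun a b => hVs _ a b,
    fun t ht a b => ?_, fun a b => ?_, fun t ht a b c hc1 hc2 => ?_⟩
  · refine (hVd (e b).2 t ht a b).congr_deriv ?_
    have hx : ((xVal e (initIdx e b) : ℂ) + ((e b).2 : ℕ) / 2) = xVal e b := by
      simp only [xVal, initIdx_fst, initIdx_snd]
      push_cast
      ring
    rw [Matrix.add_apply, Matrix.add_apply, Matrix.smul_apply, Matrix.smul_apply,
      Matrix.smul_apply, Matrix.smul_apply, xBlock, Matrix.mul_diagonal, Matrix.mul_diagonal, hx]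
    simp only [Matrix.mul_apply, Matrix.of_apply]
  · refine (hVw (e b).2 a b).congr_left fun t => ?_
    simp only [Matrix.sub_apply, yBlock_pow_mul_initMat, Matrix.of_apply, Matrix.one_apply]
    congr 2
    refine propext ⟨fun h => idx_ext e h.1 h.2, ?_⟩
    rintro rfl
    exact ⟨rfl, rfl⟩
  · have ht0 : (t : ℂ) ≠ 0 := by exact_mod_cast ht.1.ne'
    have hVc : ∀ p a, V p t a b = V p t a c := by
      intro p a
      simp only [V, Matrix.mul_apply]
      exact Finset.sum_congr rfl fun d _ => by rw [hS4 t d b c hc1.symm]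
    simp only [Matrix.mul_apply, Matrix.of_apply]
    rw [hc2, ← hVc, hV, smul_mul_assoc, Matrix.smul_apply, smul_eq_mul, inv_mul_cancel_left₀ ht0,
      Matrix.mul_apply]

end Singular

/-! ### The local normal form -/

section Singular

variable {m : ℕ} {κ : Type*} {sz : κ → ℕ} [DecidableEq κ] {e : Fin m ≃ Σ b : κ, Fin (sz b)}
  {α β : ℝ → Mat m} {ε : ℝ}

/-- The normal form of `β` at distance `t` from a singular end. -/
def normalBeta (e : Fin m ≃ Σ b : κ, Fin (sz b)) (C : Mat m) (t : ℝ) : Mat m :=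
  Matrix.of fun a b =>
    if ((e b).2 : ℕ) + 1 = sz (e b).1 then
      ((t ^ (((sz (e b).1 : ℝ) + (sz (e a).1 : ℝ)) / 2 - ((((e a).2 : ℕ) : ℝ) + 1)) : ℝ) : ℂ) *
        C a b
    else if (e a).1 = (e b).1 ∧ ((e a).2 : ℕ) = (e b).2 + 1 then (t : ℂ)⁻¹ else 0

/-- A matrix function which tends to `1` extends to a gauge transformation near `0`. -/
theorem exists_isGauge_of_tendsto_one {P : ℝ → Mat m} (hε : 0 < ε) (hP : SmoothOn 0 ε P)
    (h : ∀ a b, Tendsto (fun t => P t a b) (𝓝[>] 0) (𝓝 ((1 : Mat m) a b))) :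
    ∃ η, 0 < η ∧ η < ε ∧ IsGauge 0 η fun t => if 0 < t then P t else 1 := by
  set Q : ℝ → Mat m := fun t => if 0 < t then P t else 1 with hQ
  have hQP : ∀ t, 0 < t → Q t = P t := fun t ht => if_pos ht
  have hQ0 : Q 0 = 1 := if_neg (lt_irrefl _)
  have hc : ∀ a b, ContinuousOn (fun t => Q t a b) (Ico 0 ε) := by
    intro a b t ht
    rcases eq_or_lt_of_le ht.1 with rfl | h0
    · have h1 : ContinuousWithinAt (fun t => Q t a b) (Ioi 0) 0 := by
        refine Tendsto.congr' ?_ (by simpa only [hQ0] using h a b)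
        filter_upwards [self_mem_nhdsWithin] with s hs
        rw [hQP s hs]
      exact (continuousWithinAt_Ioi_iff_Ici.1 h1).mono Ico_subset_Ici_self
    · have h1 : ContinuousAt (fun t => P t a b) t :=
        (hP a b).continuousOn.continuousAt (Ioo_mem_nhds h0 ht.2)
      refine (h1.congr ?_).continuousWithinAt
      filter_upwards [lt_mem_nhds h0] with s hs
      rw [hQP s hs]
  have hdet : ContinuousOn (fun t => (Q t).det) (Ico 0 ε) := by
    have hp : ContinuousOn (fun t i j => Q t i j) (Ico 0 ε) :=
      continuousOn_pi.2 fun i => continuousOn_pi.2 fun j => hc i j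
    exact contDiff_det.continuous.comp_continuousOn hp
  have h1 : ∀ᶠ t in 𝓝[≥] (0 : ℝ), (Q t).det ≠ 0 := by
    have h2 := hdet 0 ⟨le_rfl, hε⟩
    rw [ContinuousWithinAt, nhdsWithin_Ico_eq_nhdsGE hε] at h2
    exact h2.eventually_ne (by simp [hQ0])
  obtain ⟨η₁, hη₁, hη₁'⟩ := mem_nhdsGE_iff_exists_Ico_subset.1 h1
  have hη₁ : 0 < η₁ := hη₁
  obtain ⟨η, hη0, hη⟩ := exists_between (lt_min hη₁ hε)
  refine ⟨η, hη0, hη.trans_le (min_le_right _ _), fun a b => ?_, fun a b => ?_, fun t ht => ?_⟩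
  · refine ((hP a b).mono (Ioo_subset_Ioo_right (hη.le.trans (min_le_right _ _)))).congr
      fun t ht => ?_
    exact congrFun (congrFun (hQP t ht.1) a) b
  · exact (hc a b).mono (Icc_subset_Ico_right (hη.trans_le (min_le_right _ _)))
  · exact isUnit_iff_ne_zero.2 (hη₁' ⟨ht.1, ht.2.trans_lt (hη.trans_le (min_le_left _ _))⟩)

/-- The normal form at a singular end, located at `0`. -/
theorem exists_local_normal_form (hε : 0 < ε) (hα : SmoothOn 0 ε α) (hβ : SmoothOn 0 ε β)
    (heq : ∀ t ∈ Ioo 0 ε, HasMatDeriv β (-((2 : ℂ) • (α t * β t - β t * α t))) t)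
    (hα' : WeightO e 0 fun t => α t - ((t⁻¹ : ℝ) : ℂ) • xBlock e)
    (hβ' : WeightO e 0 fun t => β t - ((t⁻¹ : ℝ) : ℂ) • yBlock e) :
    ∃ η, 0 < η ∧ η < ε ∧ ∃ g : ℝ → Mat m, IsGauge 0 η g ∧ g 0 = 1 ∧
      (∀ t ∈ Ioo 0 η, gaugeAlpha g α t = (t : ℂ)⁻¹ • xBlock e) ∧
      (WeightO e 0 fun t => gaugeBeta g β t - (t : ℂ)⁻¹ • yBlock e) ∧
      ∃ C : Mat m, ∀ t ∈ Ioo 0 η, gaugeBeta g β t = normalBeta e C t := by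
  obtain ⟨ε', hε', hε'ε, P, hPs, hPd, hPw, hPβ⟩ := exists_frame hε hα hβ heq hα' hβ'
  have hPt : ∀ a b, Tendsto (fun t => P t a b) (𝓝[>] 0) (𝓝 ((1 : Mat m) a b)) := by
    intro a b
    have := (hPw.tendsto one_pos a b).add_const ((1 : Mat m) a b)
    simpa using this
  obtain ⟨η, hη0, hηε, hQ⟩ := exists_isGauge_of_tendsto_one hε' hPs hPt
  set Q : ℝ → Mat m := fun t => if 0 < t then P t else 1
  have hQP : ∀ t, 0 < t → Q t = P t := fun t ht => if_pos ht
  have hu : ∀ t ∈ Ioo 0 η, IsUnit (P t).det := fun t ht => by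
    rw [← hQP t ht.1]
    exact hQ.invertible t (Ioo_subset_Icc_self ht)
  set g : ℝ → Mat m := fun t => (Q t)⁻¹ with hg
  have hgP : ∀ t ∈ Ioo 0 η, g t = (P t)⁻¹ := fun t ht => by simp only [hg, hQP t ht.1]
  have hgP' : ∀ t ∈ Ioo 0 η, (g t)⁻¹ = P t := fun t ht => by
    rw [hgP t ht, Matrix.nonsing_inv_nonsing_inv _ (hu t ht)]
  have hgu : ∀ t ∈ Ioo 0 η, IsUnit (g t).det := fun t ht =>
    hQ.inv.invertible t (Ioo_subset_Icc_self ht)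
  have hgd : ∀ t ∈ Ioo 0 η, HasMatDeriv g (-((P t)⁻¹ * ((-2 : ℂ) • (α t * P t) +
      (2 * (t : ℂ)⁻¹) • (P t * xBlock e)) * (P t)⁻¹)) t := by
    intro t ht
    refine ((hPd t ⟨ht.1, ht.2.trans hηε⟩).inv (hu t ht)).congr_of_eventuallyEq ?_
    filter_upwards [isOpen_Ioo.mem_nhds ht] with s hs using hgP s hs
  have hA : ∀ t ∈ Ioo 0 η, gaugeAlpha g α t = (t : ℂ)⁻¹ • xBlock e := by
    intro t ht
    have hinv : (P t)⁻¹ * P t = 1 := Matrix.nonsing_inv_mul _ (hu t ht)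
    have hinv' : ∀ A : Mat m, (P t)⁻¹ * (P t * A) = A := fun A => by
      rw [← mul_assoc, hinv, one_mul]
    rw [(hgd t ht).gaugeAlpha_eq, hgP' t ht, hgP t ht]
    simp only [neg_mul, mul_add, add_mul, mul_smul_comm, smul_mul_assoc, mul_assoc, hinv, hinv',
      mul_one]
    module
  have hB : ∀ t ∈ Ioo 0 η, gaugeBeta g β t = (P t)⁻¹ * (β t * P t) := fun t ht => by
    rw [gaugeBeta, hgP' t ht, hgP t ht, mul_assoc]
  have hGd : ∀ t ∈ Ioo 0 η, HasMatDeriv (gaugeBeta g β) (-((2 : ℂ) •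
      (((t : ℂ)⁻¹ • xBlock e) * gaugeBeta g β t - gaugeBeta g β t * ((t : ℂ)⁻¹ • xBlock e)))) t := by
    intro t ht
    rw [← hA t ht]
    exact (hgd t ht).gaugeBeta (hgu t ht) (heq t ⟨ht.1, ht.2.trans (hηε.trans_le hε'ε)⟩)
  -- C is read off at η/2 from the quantity t^(2(x_a - x_b)) (g.β)_ab, shown below to be constant
  -- for b last in its block. The other columns of C do not enter `normalBeta`.
  refine ⟨η, hη0, hηε.trans_le hε'ε, g, hQ.inv, by simp [hg, Q], hA, ?_,
    fun a b => (((η / 2) ^ (2 * (xVal e a - xVal e b)) : ℝ) : ℂ) * gaugeBeta g β (η / 2) a b,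
    fun t ht => ?_⟩
  -- Here P(g.β - y/t) = (β - y/t)P + t⁻¹(y(P - 1) - (P - 1)y), and each term is of weighted order
  -- 0.
  · refine WeightO.of_mul hPw ?_
    have hP0 : WeightO e 0 P := by
      refine ((hPw.mono zero_le_one).add weightO_one).congr (Eventually.of_forall fun t => ?_)
      simp
    have hY : WeightO e 0 fun _ => yBlock e := weightO_yBlock
    have h1 := (hβ'.mul hP0).mono (s := 0) (by norm_num)
    have h2 := ((hY.mul hPw).sub ((hPw.mul hY).mono (s := 0 + 1) (by norm_num))).rpow_smul (-1)
    refine (h1.add (h2.mono (s := 0) (by norm_num))).congr ?_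
    filter_upwards [Ioo_mem_nhdsGT hη0] with t ht
    rw [hB t ht, mul_sub, ← mul_assoc, Matrix.mul_nonsing_inv _ (hu t ht), one_mul,
      Real.rpow_neg_one]
    push_cast
    simp only [sub_mul, mul_sub, smul_mul_assoc, mul_smul_comm, smul_sub, mul_one, one_mul]
    abel
  · ext a b
    simp only [normalBeta, Matrix.of_apply]
    split_ifs with h1 h2
    · set p : ℝ := 2 * (xVal e a - xVal e b) with hp
      have hconst : ∀ s ∈ Ioo 0 η,
          HasDerivAt (fun s : ℝ => ((s ^ p : ℝ) : ℂ) * gaugeBeta g β s a b) 0 s := by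
        intro s hs
        have d1 : HasDerivAt (fun t : ℝ => ((t ^ p : ℝ) : ℂ)) ((p * s ^ (p - 1) : ℝ) : ℂ) s :=
          (Real.hasDerivAt_rpow_const (Or.inl hs.1.ne')).ofReal_comp
        refine (d1.mul (hGd s hs a b)).congr_deriv ?_
        have hs0 : (s : ℂ) ≠ 0 := by exact_mod_cast hs.1.ne'
        simp only [Matrix.neg_apply, Matrix.smul_apply, Matrix.sub_apply, smul_mul_assoc,
          mul_smul_comm, xBlock, Matrix.diagonal_mul, Matrix.mul_diagonal, smul_eq_mul]
        rw [Real.rpow_sub_one hs.1.ne', hp]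
        push_cast
        field_simp
        ring
      have h3 := eq_of_hasDerivAt_zero hconst (s := t) (t := η / 2) ht ⟨by linarith, by linarith⟩
      rw [← h3, ← mul_assoc, ← Complex.ofReal_mul, ← Real.rpow_add ht.1]
      -- The power of t is -2(x_a - x_b), rewritten with pos_b + 1 = sz_b.
      have h4 : ((sz (e b).1 : ℝ) + (sz (e a).1 : ℝ)) / 2 - ((((e a).2 : ℕ) : ℝ) + 1) + p = 0 := by
        have : (sz (e b).1 : ℝ) = ((e b).2 : ℕ) + 1 := by exact_mod_cast h1.symm
        simp only [hp, xVal, this]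
        ring
      rw [h4]
      simp
    -- When b is not last, column b of βP is t⁻¹ times the next column c of P, so column b of P⁻¹βP
    -- is t⁻¹ e_c.
    all_goals
      obtain ⟨c, hc1, hc2⟩ := exists_succ (e := e) (b := b) (by
        have := (e b).2.2
        omega)
      have h3 : gaugeBeta g β t a b = (t : ℂ)⁻¹ * (1 : Mat m) a c := by
        rw [hB t ht, ← Matrix.nonsing_inv_mul _ (hu t ht), Matrix.mul_apply, Matrix.mul_apply,
          Finset.mul_sum]
        refine Finset.sum_congr rfl fun d _ => ?_
        rw [hPβ t ⟨ht.1, ht.2.trans hηε⟩ d b c hc1 hc2]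
        ring
      rw [h3]
    · rw [idx_ext e (h2.1.trans hc1.symm) (h2.2.trans hc2.symm), Matrix.one_apply_eq, mul_one]
    · rw [Matrix.one_apply_ne, mul_zero]
      rintro rfl
      exact h2 ⟨hc1, hc2⟩

end Singular

/-! ### Operations on gauge transformations -/

section Operations

variable {m : ℕ} {α β g : ℝ → Mat m} {g' Q : Mat m} {t p : ℝ}

theorem gaugeAlpha_mul_const (hg : HasMatDeriv g g' t) (hQ : IsUnit Q.det) :
    gaugeAlpha (fun s => g s * Q) α t = gaugeAlpha g (fun s => Q * α s * Q⁻¹) t := by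
  have hinv : ∀ A : Mat m, Q * (Q⁻¹ * A) = A := fun A => by
    rw [← mul_assoc, Matrix.mul_nonsing_inv _ hQ, one_mul]
  rw [hg.gaugeAlpha_eq, (hg.mul (hasMatDeriv_const Q t)).gaugeAlpha_eq, Matrix.mul_inv_rev]
  simp only [mul_zero, add_zero, mul_assoc, hinv]

theorem gaugeBeta_mul_const :
    gaugeBeta (fun s => g s * Q) β t = gaugeBeta g (fun s => Q * β s * Q⁻¹) t := by
  simp only [gaugeBeta, Matrix.mul_inv_rev, mul_assoc]

/-- The symmetry (α, β) ↦ (-αᵀ, βᵀ) of the equation intertwines g with its inverse transpose. It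
carries the left model x₁ = -x(m), y₁ = y(m)ᵀ to x(m), y(m). -/
theorem gaugeAlpha_dual (hg : HasMatDeriv g g' t) (hu : IsUnit (g t).det) :
    gaugeAlpha (fun s => ((g s)⁻¹)ᵀ) α t = -(gaugeAlpha g (fun s => -(α s)ᵀ) t)ᵀ := by
  rw [hg.gaugeAlpha_eq, (hg.inv hu).transpose.gaugeAlpha_eq, ← Matrix.transpose_nonsing_inv,
    Matrix.nonsing_inv_nonsing_inv _ hu]
  simp only [Matrix.transpose_sub, Matrix.transpose_smul, Matrix.transpose_mul,
    Matrix.transpose_neg, Matrix.transpose_transpose, mul_assoc, mul_neg, neg_mul]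
  rw [← Matrix.transpose_mul (g t) ((g t)⁻¹), Matrix.mul_nonsing_inv _ hu, Matrix.transpose_one,
    mul_one]
  module

theorem gaugeBeta_dual (hu : IsUnit (g t).det) :
    gaugeBeta (fun s => ((g s)⁻¹)ᵀ) β t = (gaugeBeta g (fun s => (β s)ᵀ) t)ᵀ := by
  simp only [gaugeBeta]
  rw [← Matrix.transpose_nonsing_inv, Matrix.nonsing_inv_nonsing_inv _ hu]
  simp only [Matrix.transpose_mul, Matrix.transpose_transpose, mul_assoc]

theorem gaugeAlpha_shift :
    gaugeAlpha (fun s => g (s - p)) α t = gaugeAlpha g (fun s => α (p + s)) (t - p) := by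
  have h : matDeriv (fun s => g (s - p)) t = matDeriv g (t - p) := by
    ext a b
    exact deriv_comp_sub_const (f := fun s => g s a b) p t
  simp only [gaugeAlpha, h, add_sub_cancel]

theorem gaugeBeta_shift :
    gaugeBeta (fun s => g (s - p)) β t = gaugeBeta g (fun s => β (p + s)) (t - p) := by
  simp only [gaugeBeta, add_sub_cancel]

/-- Reversing time changes the sign of ġ; passing to (-α, -β) compensates for this and keeps both
the equation and the residues. -/
theorem gaugeAlpha_reflect :
    gaugeAlpha (fun s => g (p - s)) α t = -gaugeAlpha g (fun s => -α (p - s)) (p - t) := by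
  have h : matDeriv (fun s => g (p - s)) t = -matDeriv g (p - t) := by
    ext a b
    exact deriv_comp_const_sub (f := fun s => g s a b) p t
  simp only [gaugeAlpha, h, sub_sub_cancel, mul_neg, neg_mul]
  module

theorem gaugeBeta_reflect :
    gaugeBeta (fun s => g (p - s)) β t = -gaugeBeta g (fun s => -β (p - s)) (p - t) := by
  simp only [gaugeBeta, sub_sub_cancel, mul_neg, neg_mul, neg_neg]

theorem HasMatDeriv.conj {A B : Mat m} (hQ : IsUnit Q.det)
    (h : HasMatDeriv β (-((2 : ℂ) • (A * B - B * A))) t) :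
    HasMatDeriv (fun s => Q * β s * Q⁻¹)
      (-((2 : ℂ) • ((Q * A * Q⁻¹) * (Q * B * Q⁻¹) - (Q * B * Q⁻¹) * (Q * A * Q⁻¹)))) t := by
  have h1 := ((hasMatDeriv_const Q t).mul h).mul (hasMatDeriv_const Q⁻¹ t)
  have hinv' : ∀ A : Mat m, Q⁻¹ * (Q * A) = A := fun A => by
    rw [← mul_assoc, Matrix.nonsing_inv_mul _ hQ, one_mul]
  convert h1 using 1
  simp only [mul_assoc, hinv', zero_mul, zero_add, mul_zero, add_zero, mul_neg, neg_mul,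
    mul_smul_comm, smul_mul_assoc, mul_sub, sub_mul]

theorem HasMatDeriv.dual {A B : Mat m}
    (h : HasMatDeriv β (-((2 : ℂ) • (A * B - B * A))) t) :
    HasMatDeriv (fun s => (β s)ᵀ) (-((2 : ℂ) • (-Aᵀ * Bᵀ - Bᵀ * -Aᵀ))) t := by
  convert h.transpose using 1
  simp only [Matrix.transpose_neg, Matrix.transpose_smul, Matrix.transpose_sub,
    Matrix.transpose_mul, mul_neg, neg_mul]
  module

theorem HasMatDeriv.shift (h : HasMatDeriv β g' (p + t)) :
    HasMatDeriv (fun s => β (p + s)) g' t :=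
  fun a b => (h a b).comp_const_add p t

theorem HasMatDeriv.reflect {A B : Mat m}
    (h : HasMatDeriv β (-((2 : ℂ) • (A * B - B * A))) (p - t)) :
    HasMatDeriv (fun s => -β (p - s)) (-((2 : ℂ) • (-A * -B - -B * -A))) t := by
  intro a b
  exact (((h a b).comp_const_sub p t).neg).congr_deriv (by simp)

theorem SmoothOn.shift {l u : ℝ} (h : SmoothOn l u β) {ε : ℝ} (hl : l ≤ p) (hε : p + ε ≤ u) :
    SmoothOn 0 ε fun s => β (p + s) :=
  h.comp (θ := fun s => p + s) (contDiff_const.add contDiff_id).contDiffOn fun s hs =>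
    ⟨by linarith [hs.1], by linarith [hs.2]⟩

theorem SmoothOn.reflect {l u : ℝ} (h : SmoothOn l u β) {ε : ℝ} (hl : l ≤ p - ε) (hp : p ≤ u) :
    SmoothOn 0 ε fun s => β (p - s) :=
  h.comp (θ := fun s => p - s) (contDiff_const.sub contDiff_id).contDiffOn fun s hs =>
    ⟨by linarith [hs.2], by linarith [hs.1]⟩

end Operations

/-! ### The matrix `gSt` -/

section GSt

variable {m : ℕ}

/-- With its columns reversed the matrix is upper triangular with ones on the diagonal. -/
theorem isUnit_det_gSt (q : Fin m → ℂ) (z : ℝ) : IsUnit (gSt q z).det := by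
  have h : ((gSt q z).submatrix id Fin.revPerm).det = 1 := by
    rw [Matrix.det_of_isUpperTriangular]
    · refine Finset.prod_eq_one fun a _ => ?_
      have h1 : (a : ℕ) + (Fin.rev a : ℕ) + 1 = m := by
        rw [Fin.val_rev]
        omega
      simp only [Matrix.submatrix_apply, id, gSt, Matrix.of_apply, Fin.revPerm_apply]
      rw [dif_neg (by omega), if_pos h1]
    · intro a b hab
      have h1 : (b : ℕ) < a := hab
      simp only [Matrix.submatrix_apply, id, gSt, Matrix.of_apply, Fin.revPerm_apply]
      have h2 : (Fin.rev b : ℕ) = m - (b + 1) := Fin.val_rev b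
      rw [dif_neg (by omega), if_neg (by omega)]
  rw [Matrix.det_permute'] at h
  exact IsUnit.of_mul_eq_one _ (by rw [mul_comm]; exact h)

theorem xLeft_eq (m : ℕ) :
    xLeft m = Matrix.diagonal fun s : Fin m => ((m : ℂ) - 1 - 2 * ((s : ℕ) : ℂ)) / 4 := by
  rw [xLeft, xMat, Matrix.diagonal_neg]
  congr 1
  funext s
  ring

/-- Counting from 0, the entry (a, b) is homogeneous in z of degree m - 1 - a - b, which is twice
the sum of the a-th and b-th diagonal entries of x₁. -/
theorem hasMatDeriv_gSt (q : Fin m → ℂ) {l t : ℝ} (ht : l < t) :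
    HasMatDeriv (fun s => gSt q (s - l))
      ((2 * ((t : ℂ) - l)⁻¹) • (gSt q (t - l) * xLeft m + xLeft m * gSt q (t - l))) t := by
  intro a b
  have hz : ((t : ℂ) - l) ≠ 0 := by
    rw [← Complex.ofReal_sub]
    exact_mod_cast (sub_pos.2 ht).ne'
  rw [xLeft_eq, Matrix.smul_apply, Matrix.add_apply, Matrix.mul_diagonal, Matrix.diagonal_mul,
    smul_eq_mul]
  simp only [gSt, Matrix.of_apply]
  split_ifs with h1 h2
  · obtain ⟨N, hN⟩ : ∃ N, m - 1 - ((a : ℕ) + b) = N + 1 := ⟨m - 2 - (a + b), by omega⟩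
    have hm : (m : ℂ) = a + b + N + 2 := by
      have : m = a + b + N + 2 := by omega
      exact_mod_cast this
    rw [hN]
    have h3 : HasDerivAt (fun s : ℝ => ((s - l : ℝ) : ℂ)) 1 t := by
      simpa using ((hasDerivAt_id t).sub_const l).ofReal_comp
    refine ((h3.pow (N + 1)).mul_const _).congr_deriv ?_
    rw [hm]
    push_cast
    field_simp
    ring
  · have hm : (m : ℂ) = a + b + 1 := by exact_mod_cast h2.symm
    refine (hasDerivAt_const t (1 : ℂ)).congr_deriv ?_
    rw [hm]
    ring
  · refine (hasDerivAt_const t (0 : ℂ)).congr_deriv ?_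
    ring

/-- The derivative term cancels the conjugate of x₁/z and leaves -x₁/z, whatever q is. Hence it
suffices to bring α to the form x₁/z. -/
theorem gaugeAlpha_gSt (q : Fin m → ℂ) {α : ℝ → Mat m} {l t : ℝ} (ht : l < t)
    (hα : α t = ((t : ℂ) - l)⁻¹ • xLeft m) :
    gaugeAlpha (fun s => gSt q (s - l)) α t = -(((t : ℂ) - l)⁻¹ • xLeft m) := by
  rw [(hasMatDeriv_gSt q ht).gaugeAlpha_eq, hα]
  simp only [mul_smul_comm, smul_mul_assoc, add_mul, mul_assoc,
    Matrix.mul_nonsing_inv _ (isUnit_det_gSt q (t - l)), mul_one]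
  module

end GSt

/-! ### The left end -/

theorem yBlock_pow_apply {m : ℕ} {κ : Type*} {sz : κ → ℕ} [DecidableEq κ]
    {e : Fin m ≃ Σ b : κ, Fin (sz b)} (p : ℕ) (a b : Fin m) :
    (yBlock e ^ p) a b = if (e a).1 = (e b).1 ∧ ((e a).2 : ℕ) = (e b).2 + p then 1 else 0 := by
  induction p generalizing a with
  | zero =>
    rw [pow_zero, Matrix.one_apply]
    congr 1
    refine propext ⟨?_, fun h => idx_ext e h.1 h.2⟩
    rintro rfl
    exact ⟨rfl, rfl⟩
  | succ p ih =>
    rw [pow_succ']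
    rcases Nat.eq_zero_or_eq_succ_pred ((e a).2 : ℕ) with h | h
    · rw [yBlock_mul_apply_of_zero _ _ h, if_neg (by omega)]
    · obtain ⟨c, hc1, hc2⟩ := exists_pred h
      rw [yBlock_mul_apply_of_succ _ _ hc1 (by omega), ih c]
      congr 1
      refine propext (and_congr (by rw [hc1]) ?_)
      omega

/-- The index set of the left end: a single block. -/
def leftIdx (m : ℕ) : Fin m ≃ Σ _ : Unit, Fin m := (Equiv.uniqueSigma fun _ : Unit => Fin m).symm

section Left

variable {m : ℕ}

theorem xBlock_leftIdx : xBlock (leftIdx m) = -xLeft m := by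
  rw [xLeft, neg_neg, xBlock, xMat]
  congr 1
  funext s
  simp only [xVal, leftIdx, Equiv.uniqueSigma_symm_apply]
  push_cast
  ring

theorem yBlock_leftIdx : yBlock (leftIdx m) = yMat m := by
  ext a b
  simp [yBlock, yMat, leftIdx]

theorem yMat_pow_self : yMat m ^ m = 0 := by
  ext a b
  rw [← yBlock_leftIdx, yBlock_pow_apply, if_neg, Matrix.zero_apply]
  rintro ⟨-, h⟩
  have h1 : (a : ℕ) = b + m := h
  omega

theorem weightO_leftIdx_iff {f : ℝ → Mat m} :
    WeightO (leftIdx m) 0 f ↔ ∀ a b, (fun t => f t a b) =O[𝓝[>] 0] fun _ : ℝ => (1 : ℝ) := by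
  have h : ∀ a b, weight (leftIdx m) a b = 0 := fun a b => weight_eq_zero _ rfl
  simp only [WeightO, h, add_zero, Real.rpow_zero]

theorem tendsto_const_add_nhdsGT (p : ℝ) : Tendsto (fun t => p + t) (𝓝[>] 0) (𝓝[>] p) := by
  refine tendsto_nhdsWithin_iff.2 ⟨?_, ?_⟩
  · exact ((continuous_const.add continuous_id).tendsto' 0 p (by simp)).mono_left
      nhdsWithin_le_nhds
  · filter_upwards [self_mem_nhdsWithin] with t ht
    have : 0 < t := ht
    exact lt_add_of_pos_right p this

variable {p u : ℝ} {f α β : ℝ → Mat m} {A B : Mat m}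

theorem MeroSimplePoleRight.isBigO (h : MeroSimplePoleRight p f A) :
    WeightO (leftIdx m) 0 fun t => f (p + t) - ((t⁻¹ : ℝ) : ℂ) • A := by
  rw [weightO_leftIdx_iff]
  intro a b
  obtain ⟨F, hF, hf⟩ := h a b
  have h1 : Tendsto (fun t : ℝ => F (((p + t : ℝ)) : ℂ)) (𝓝[>] 0) (𝓝 (F p)) :=
    hF.continuousAt.tendsto.comp ((Complex.continuous_ofReal.tendsto p).comp
      ((tendsto_const_add_nhdsGT p).mono_right nhdsWithin_le_nhds))
  refine (h1.isBigO_one ℝ).congr' ?_ EventuallyEq.rfl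
  filter_upwards [(tendsto_const_add_nhdsGT p).eventually hf] with t ht
  rw [Matrix.sub_apply, Matrix.smul_apply, ht]
  push_cast
  rw [add_sub_cancel_left, smul_eq_mul]
  ring

theorem MeroSimplePoleRight.tendsto_mul (h : MeroSimplePoleRight p f A) (a b : Fin m) :
    Tendsto (fun t : ℝ => ((t : ℂ) - p) * f t a b) (𝓝[>] p) (𝓝 (A a b)) := by
  obtain ⟨F, hF, hf⟩ := h a b
  have h0 : Tendsto (fun t : ℝ => (t : ℂ) - p) (𝓝[>] p) (𝓝 0) :=
    (Continuous.tendsto' (by fun_prop) p 0 (by simp)).mono_left nhdsWithin_le_nhds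
  have h1 : Tendsto (fun t : ℝ => F (t : ℂ)) (𝓝[>] p) (𝓝 (F p)) :=
    hF.continuousAt.tendsto.comp
      ((Complex.continuous_ofReal.tendsto p).mono_left nhdsWithin_le_nhds)
  have h2 := (tendsto_const_nhds (x := A a b)).add (h0.mul h1)
  rw [zero_mul, add_zero] at h2
  refine h2.congr' ?_
  filter_upwards [hf, self_mem_nhdsWithin] with t ht htp
  have hne : (t : ℂ) - p ≠ 0 := by
    rw [← Complex.ofReal_sub]
    exact_mod_cast (sub_pos.2 htp).ne'
  rw [ht, mul_add, mul_div_cancel₀ _ hne]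

/-- The analyticity of the regular part is used here: a bounded remainder alone would not control
the derivative. -/
theorem MeroSimplePoleRight.tendsto_sq_mul_deriv (h : MeroSimplePoleRight p f A) (a b : Fin m) :
    Tendsto (fun t : ℝ => ((t : ℂ) - p) ^ 2 * matDeriv f t a b) (𝓝[>] p) (𝓝 (-A a b)) := by
  obtain ⟨F, hF, hf⟩ := h a b
  obtain ⟨v, hv, hv'⟩ := mem_nhdsGT_iff_exists_Ioo_subset.1 hf
  have h0 : Tendsto (fun t : ℝ => (t : ℂ) - p) (𝓝[>] p) (𝓝 0) :=
    (Continuous.tendsto' (by fun_prop) p 0 (by simp)).mono_left nhdsWithin_le_nhds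
  have hT : Tendsto (fun t : ℝ => (t : ℂ)) (𝓝[>] p) (𝓝 (p : ℂ)) :=
    (Complex.continuous_ofReal.tendsto p).mono_left nhdsWithin_le_nhds
  have h1 : Tendsto (fun t : ℝ => deriv F (t : ℂ)) (𝓝[>] p) (𝓝 (deriv F p)) :=
    hF.deriv.continuousAt.tendsto.comp hT
  have h2 := (tendsto_const_nhds (x := -A a b)).add ((h0.pow 2).mul h1)
  rw [zero_pow two_ne_zero, zero_mul, add_zero] at h2
  refine h2.congr' ?_
  filter_upwards [Ioo_mem_nhdsGT hv, hT.eventually hF.eventually_analyticAt] with t ht hFt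
  have hne : (t : ℂ) - p ≠ 0 := by
    rw [← Complex.ofReal_sub]
    exact_mod_cast (sub_pos.2 ht.1).ne'
  have h3 : HasDerivAt (fun s : ℝ => (s : ℂ) - p) 1 t := by
    simpa using ((hasDerivAt_id t).ofReal_comp).sub_const (p : ℂ)
  have h4 : HasDerivAt (fun s : ℝ => A a b / ((s : ℂ) - p) + F s)
      (-A a b / ((t : ℂ) - p) ^ 2 + deriv F t) t := by
    refine ((((hasDerivAt_const t (A a b)).div h3 hne)).add
      (hFt.differentiableAt.hasDerivAt.comp_ofReal)).congr_deriv ?_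
    simp
  have h5 : HasDerivAt (fun s => f s a b) (-A a b / ((t : ℂ) - p) ^ 2 + deriv F t) t := by
    refine h4.congr_of_eventuallyEq ?_
    filter_upwards [isOpen_Ioo.mem_nhds ht] with s hs using hv' hs
  have h6 : matDeriv f t a b = -A a b / ((t : ℂ) - p) ^ 2 + deriv F t := h5.deriv
  rw [h6]
  field_simp

/-- The leading term of the equation of a complex at the left end. -/
theorem residue_commutator (hpu : p < u)
    (heq : ∀ t ∈ Ioo p u, matDeriv β t + (2 : ℂ) • (α t * β t - β t * α t) = 0)
    (hA : MeroSimplePoleRight p α A) (hB : MeroSimplePoleRight p β B) :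
    (2 : ℂ) • (A * B - B * A) = B := by
  ext a b
  have hmul : ∀ {f g : ℝ → Mat m} {F G : Mat m}, MeroSimplePoleRight p f F →
      MeroSimplePoleRight p g G →
      Tendsto (fun t : ℝ => ((t : ℂ) - p) ^ 2 * (f t * g t) a b) (𝓝[>] p) (𝓝 ((F * G) a b)) := by
    intro f g F G hF hG
    simp only [Matrix.mul_apply, Finset.mul_sum]
    refine tendsto_finsetSum _ fun c _ => ?_
    refine ((hF.tendsto_mul a c).mul (hG.tendsto_mul c b)).congr fun t => ?_
    ring
  have h1 := (hB.tendsto_sq_mul_deriv a b).add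
    (((hmul hA hB).sub (hmul hB hA)).const_mul 2)
  have h2 : -B a b + 2 * ((A * B) a b - (B * A) a b) = 0 := by
    refine tendsto_nhds_unique (h1.congr' ?_) tendsto_const_nhds
    filter_upwards [Ioo_mem_nhdsGT hpu] with t ht
    have := congrFun (congrFun (heq t ht) a) b
    simp only [Matrix.add_apply, Matrix.smul_apply, Matrix.sub_apply, Matrix.zero_apply,
      smul_eq_mul] at this
    linear_combination ((t : ℂ) - p) ^ 2 * this
  simp only [Matrix.smul_apply, Matrix.sub_apply, smul_eq_mul]
  linear_combination h2

theorem pow_eq_zero_of_conjTo (h : ConjTo B (yLeft m)) : B ^ m = 0 := by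
  obtain ⟨g, hg, hB⟩ := h
  have h1 : g * B ^ m * g⁻¹ = 0 := by
    have h2 : ∀ r : ℕ, g * B ^ r * g⁻¹ = yLeft m ^ r := by
      intro r
      induction r with
      | zero => simp [Matrix.mul_nonsing_inv _ hg]
      | succ r ih =>
        rw [pow_succ (yLeft m), ← ih, ← hB, pow_succ]
        simp only [mul_assoc]
        rw [← mul_assoc g⁻¹ g, Matrix.nonsing_inv_mul _ hg, one_mul]
    rw [h2, yLeft, ← Matrix.transpose_pow, yMat_pow_self, Matrix.transpose_zero]
  have h3 : B ^ m = g⁻¹ * (g * B ^ m * g⁻¹) * g := by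
    rw [mul_assoc g, ← mul_assoc g⁻¹, Matrix.nonsing_inv_mul _ hg, one_mul, mul_assoc,
      Matrix.nonsing_inv_mul _ hg, mul_one]
  rw [h3, h1]
  simp

/-- The frame at the left end which is determined by the cyclic vector. -/
theorem exists_left_frame {v : Fin m → ℂ} (hAB : (2 : ℂ) • (A * B - B * A) = B)
    (hBm : B ^ m = 0) (hv : Aᵀ *ᵥ v = (((m : ℂ) - 1) / 4) • v)
    (hspan : Submodule.span ℂ (Set.range fun r : ℕ => (Bᵀ ^ r) *ᵥ v) = ⊤) :
    ∃ Q : Mat m, IsUnit Q.det ∧ Q * A = xLeft m * Q ∧ Q * B = yLeft m * Q ∧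
      ∀ a : Fin m, (a : ℕ) = 0 → Q a = v := by
  have hBr : ∀ r, m ≤ r → (Bᵀ ^ r) *ᵥ v = 0 := by
    intro r hr
    rw [← Matrix.transpose_pow, pow_eq_zero_of_le hr hBm]
    simp
  have hrow : ∀ (a b : Fin m) (M : Mat m), ((Matrix.of fun c : Fin m => (Bᵀ ^ (c : ℕ)) *ᵥ v) * M) a b
      = (Mᵀ *ᵥ ((Bᵀ ^ (a : ℕ)) *ᵥ v)) b := by
    intro a b M
    rw [Matrix.mul_apply, Matrix.mulVec, dotProduct]
    exact Finset.sum_congr rfl fun c _ => mul_comm _ _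
  refine ⟨Matrix.of fun c : Fin m => (Bᵀ ^ (c : ℕ)) *ᵥ v, ?_, ?_, ?_, fun a ha => ?_⟩
  · have h1 : LinearIndependent ℂ (fun c : Fin m => (Bᵀ ^ (c : ℕ)) *ᵥ v) := by
      -- Powers from m on vanish, so the m listed rows already span.
      refine linearIndependent_of_top_le_span_of_card_eq_finrank ?_ (by simp)
      rw [← hspan, Submodule.span_le]
      rintro _ ⟨r, rfl⟩
      rcases lt_or_ge r m with hr | hr
      · exact Submodule.subset_span ⟨⟨r, hr⟩, rfl⟩
      · simp only [hBr r hr]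
        exact Submodule.zero_mem _
    rw [← Matrix.isUnit_iff_isUnit_det]
    exact Matrix.linearIndependent_rows_iff_isUnit.1 h1
  · have hcomm : Aᵀ * Bᵀ = Bᵀ * Aᵀ - (1 / 2 : ℂ) • Bᵀ := by
      have h1 := congrArg Matrix.transpose hAB
      rw [Matrix.transpose_smul, Matrix.transpose_sub, Matrix.transpose_mul,
        Matrix.transpose_mul] at h1
      have h2 : Aᵀ * Bᵀ = Bᵀ * Aᵀ - (1 / 2 : ℂ) • ((2 : ℂ) • (Bᵀ * Aᵀ - Aᵀ * Bᵀ)) := by module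
      rwa [h1] at h2
    -- Each factor Bᵀ lowers the eigenvalue of Aᵀ by 1/2; starting from (m - 1)/4 this runs through
    -- the diagonal of x₁.
    have heig : ∀ r : ℕ, Aᵀ *ᵥ ((Bᵀ ^ r) *ᵥ v) =
        (((m : ℂ) - 1 - 2 * r) / 4) • ((Bᵀ ^ r) *ᵥ v) := by
      intro r
      induction r with
      | zero => simpa using hv
      | succ r ih =>
        rw [pow_succ', ← Matrix.mulVec_mulVec, Matrix.mulVec_mulVec, hcomm, Matrix.sub_mulVec,
          ← Matrix.mulVec_mulVec, ih, Matrix.smul_mulVec, Matrix.mulVec_smul]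
        push_cast
        module
    ext a b
    rw [hrow, heig, xLeft_eq, Matrix.diagonal_mul]
    rfl
  · ext a b
    rw [hrow, Matrix.mulVec_mulVec, ← pow_succ', yLeft, Matrix.mul_apply]
    by_cases ha : (a : ℕ) + 1 < m
    · rw [Finset.sum_eq_single ⟨a + 1, ha⟩]
      · simp [yMat]
      · intro c _ hc
        have : ¬ ((c : ℕ) = a + 1) := fun h => hc (Fin.ext h)
        simp [yMat, this]
      · simp
    · rw [hBr _ (by omega), Finset.sum_eq_zero]
      · rfl
      · intro c _
        have : ¬ ((c : ℕ) = a + 1) := by omega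
        simp [yMat, this]
  · funext b
    simp [ha]

/-- The normal form at the left end. -/
theorem exists_left_gauge (hpu : p < u) (hα : SmoothOn p u α) (hβ : SmoothOn p u β)
    (heq : ∀ t ∈ Ioo p u, matDeriv β t + (2 : ℂ) • (α t * β t - β t * α t) = 0)
    (hA : MeroSimplePoleRight p α A) (hB : MeroSimplePoleRight p β B)
    (hBy : ConjTo B (yLeft m)) {v : Fin m → ℂ} (hv : Aᵀ *ᵥ v = (((m : ℂ) - 1) / 4) • v)
    (hspan : Submodule.span ℂ (Set.range fun r : ℕ => (Bᵀ ^ r) *ᵥ v) = ⊤) :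
    ∃ c, p < c ∧ c < u ∧ ∃ g : ℝ → Mat m, IsGauge p c g ∧
      v ᵥ* (g p)⁻¹ = (fun a : Fin m => if (a : ℕ) = 0 then 1 else 0) ∧ ∃ q : Fin m → ℂ,
        ∀ t ∈ Ioo p c, gaugeAlpha g α t = ((t : ℂ) - p)⁻¹ • xLeft m ∧
          gaugeBeta g β t = (companionSt q (t - p))ᵀ := by
  obtain ⟨Q, hQ, hQA, hQB, hQv⟩ :=
    exists_left_frame (residue_commutator hpu heq hA hB) (pow_eq_zero_of_conjTo hBy) hv hspan
  have hε : 0 < u - p := sub_pos.2 hpu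
  have hw : ∀ A : Mat m, WeightO (leftIdx m) 0 fun _ => A := fun A =>
    weightO_const fun _ _ h => absurd rfl h
  have hT : ∀ {f : ℝ → Mat m}, WeightO (leftIdx m) 0 f → WeightO (leftIdx m) 0 fun t => (f t)ᵀ := by
    intro f hf
    rw [weightO_leftIdx_iff] at hf ⊢
    exact fun a b => hf b a
  have hres : ∀ {f : ℝ → Mat m} {F X : Mat m}, MeroSimplePoleRight p f F → Q * F = X * Q →
      WeightO (leftIdx m) 0 fun t => (Q * f (p + t) * Q⁻¹)ᵀ - ((t⁻¹ : ℝ) : ℂ) • Xᵀ := by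
    intro f F X hf hX
    have h1 := hT ((((hw Q).mul hf.isBigO).mul (hw Q⁻¹)).mono (s := 0) (by norm_num))
    refine h1.congr (Eventually.of_forall fun t => ?_)
    rw [mul_sub, sub_mul, mul_smul_comm, smul_mul_assoc, hX, mul_assoc X,
      Matrix.mul_nonsing_inv _ hQ, mul_one, Matrix.transpose_sub, Matrix.transpose_smul]
  have hxT : (xLeft m)ᵀ = -xBlock (leftIdx m) := by
    rw [xBlock_leftIdx, neg_neg, xLeft_eq, Matrix.diagonal_transpose]
  have hα₁ : SmoothOn 0 (u - p) fun t => Q * α (p + t) * Q⁻¹ :=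
    ((SmoothOn.const Q).mul (hα.shift le_rfl (by linarith))).mul (SmoothOn.const Q⁻¹)
  have hβ₁ : SmoothOn 0 (u - p) fun t => Q * β (p + t) * Q⁻¹ :=
    ((SmoothOn.const Q).mul (hβ.shift le_rfl (by linarith))).mul (SmoothOn.const Q⁻¹)
  obtain ⟨η, hη0, hηε, g, hg, hg0, hgα, -, C, hgβ⟩ := exists_local_normal_form (e := leftIdx m)
    (α := fun t => -(Q * α (p + t) * Q⁻¹)ᵀ) (β := fun t => (Q * β (p + t) * Q⁻¹)ᵀ) hε
    hα₁.transpose.neg hβ₁.transpose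
    (fun t ht => by
      have ht' : p + t ∈ Ioo p u := ⟨by linarith [ht.1], by linarith [ht.2]⟩
      exact ((hasMatDeriv_of_complex hβ ht' (heq _ ht')).shift.conj hQ).dual)
    (by
      have h1 : WeightO (leftIdx m) 0 fun _ => (0 : Mat m) := hw 0
      refine (h1.sub (hres hA hQA)).congr (Eventually.of_forall fun t => ?_)
      rw [hxT]
      module)
    (by
      have h1 := hres hB hQB
      rwa [yLeft, Matrix.transpose_transpose, ← yBlock_leftIdx] at h1)
  have hgu : ∀ t ∈ Icc 0 η, IsUnit (g t).det := hg.invertible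
  have hsub : ContDiff ℝ ∞ fun t : ℝ => t - p := contDiff_id.sub contDiff_const
  have hg₁ : IsGauge p (p + η) fun t => ((g (t - p))⁻¹)ᵀ * Q :=
    ((hg.inv.transpose.comp hsub
      (fun t ht => ⟨by linarith [ht.1], by linarith [ht.2]⟩)
      (fun t ht => ⟨by linarith [ht.1], by linarith [ht.2]⟩))).mul (IsGauge.const hQ)
  -- The companion matrix has -q in its last column, so q is minus the last column of C; `Fin.rev`
  -- of 0 is the last index.
  refine ⟨p + η, by linarith, by linarith, _, hg₁, ?_, fun b => -C b (Fin.rev ⟨0, b.pos⟩), ?_⟩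
  · have h1 : ((g (p - p))⁻¹)ᵀ * Q = Q := by rw [sub_self, hg0]; simp
    rw [h1]
    have h2 : (fun a : Fin m => if (a : ℕ) = 0 then (1 : ℂ) else 0) ᵥ* Q = v := by
      rcases Nat.eq_zero_or_pos m with rfl | hm
      · exact Subsingleton.elim _ _
      · have : (fun a : Fin m => if (a : ℕ) = 0 then (1 : ℂ) else 0) = Pi.single ⟨0, hm⟩ 1 := by
          funext a
          simp [Pi.single_apply, Fin.ext_iff]
        rw [this, Matrix.single_one_vecMul]
        exact hQv _ rfl
    rw [← h2, Matrix.vecMul_vecMul, Matrix.mul_nonsing_inv _ hQ, Matrix.vecMul_one]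
  · intro t ht
    have ht' : t - p ∈ Ioo 0 η := ⟨by linarith [ht.1], by linarith [ht.2]⟩
    have hu := hgu _ (Ioo_subset_Icc_self ht')
    have hd := (hg.smooth.hasMatDeriv ht')
    have hd' : HasMatDeriv (fun s => ((g (s - p))⁻¹)ᵀ) _ t :=
      fun a b => ((hd.inv hu).transpose a b).comp_sub_const t p
    constructor
    · rw [gaugeAlpha_mul_const hd' hQ, gaugeAlpha_shift (g := fun s => ((g s)⁻¹)ᵀ),
        gaugeAlpha_dual hd hu, hgα _ ht', xBlock_leftIdx, xLeft_eq]
      push_cast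
      rw [smul_neg, Matrix.transpose_neg, neg_neg, Matrix.transpose_smul,
        Matrix.diagonal_transpose]
    · rw [gaugeBeta_mul_const, gaugeBeta_shift (g := fun s => ((g s)⁻¹)ᵀ),
        gaugeBeta_dual hu, hgβ _ ht']
      congr 1
      ext a b
      have ha : (((leftIdx m) a).2 : ℕ) = a := rfl
      have hb : (((leftIdx m) b).2 : ℕ) = b := rfl
      have hab : ((leftIdx m) a).1 = ((leftIdx m) b).1 := rfl
      simp only [normalBeta, companionSt, Matrix.of_apply, ha, hb, hab, true_and]
      split_ifs with h1
      · have h2 : Fin.rev ⟨0, a.pos⟩ = b := by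
          refine Fin.ext ?_
          simp only [Fin.val_rev]
          omega
        have h3 : ((m : ℝ) + m) / 2 - (((a : ℕ) : ℝ) + 1) = ((m - 1 - (a : ℕ) : ℕ) : ℝ) := by
          rw [Nat.sub_sub, Nat.cast_sub (by omega)]
          push_cast
          ring
        rw [h3, Real.rpow_natCast, h2]
        push_cast
        ring
      · rfl
      · rfl

end Left

/-! ### The right end -/

/-- Weights are nonnegative, so a weighted bound implies plain boundedness, which is all that
residues require. -/
theorem WeightO.leftIdx {m : ℕ} {κ : Type*} {sz : κ → ℕ} {e : Fin m ≃ Σ b : κ, Fin (sz b)}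
    {f : ℝ → Mat m} (h : WeightO e 0 f) : WeightO (NahmNF.leftIdx m) 0 f :=
  weightO_leftIdx_iff.2 fun a b => (h a b).trans <| by
    have := isBigO_rpow_of_le (p := 0 + weight e a b) (q := 0)
      (by linarith [weight_nonneg e a b])
    simpa using this

section Right

variable {m : ℕ} {κ : Type*} [DecidableEq κ] {sz : κ → ℕ} {e : Fin m ≃ Σ b : κ, Fin (sz b)}

theorem xBlock_yBlock_commutator :
    (2 : ℂ) • (xBlock e * yBlock e - yBlock e * xBlock e) = yBlock e := by
  ext a b
  rw [Matrix.smul_apply, Matrix.sub_apply, xBlock, Matrix.diagonal_mul, Matrix.mul_diagonal]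
  simp only [yBlock, Matrix.of_apply]
  split_ifs with h
  · have h1 : (sz (e a).1 : ℝ) = sz (e b).1 := by rw [h.1]
    have h2 : (((e a).2 : ℕ) : ℝ) = ((e b).2 : ℕ) + 1 := by exact_mod_cast h.2
    simp only [xVal, h1, h2, smul_eq_mul]
    push_cast
    ring
  · simp

/-- A matrix commuting with `x` and `y` preserves the sizes of the blocks. -/
theorem apply_eq_zero_of_commute {M : Mat m} (hx : M * xBlock e = xBlock e * M)
    (hy : M * yBlock e = yBlock e * M) {a b : Fin m} (hab : sz (e a).1 ≠ sz (e b).1) :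
    M a b = 0 := by
  have hyp : ∀ p : ℕ, M * yBlock e ^ p = yBlock e ^ p * M := fun p =>
    (show Commute M (yBlock e) from hy).pow_right p
  -- If b is first in its block, y^(sz b) kills e_b. A nonzero entry M a b forces x_a = x_b, that is
  -- sz_a = 2 pos_a + sz_b; with sz_a ≠ sz_b this leaves room for y^(sz b) to shift e_a inside its
  -- block, contradicting the commutation.
  have hinit : ∀ a b, ((e b).2 : ℕ) = 0 → sz (e a).1 ≠ sz (e b).1 → M a b = 0 := by
    intro a b hb hab
    by_contra hM
    have h1 : xVal e a = xVal e b := by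
      have h2 := congrFun (congrFun hx a) b
      rw [xBlock, Matrix.mul_diagonal, Matrix.diagonal_mul, mul_comm] at h2
      exact_mod_cast (mul_right_cancel₀ hM h2).symm
    have h2 : sz (e a).1 = 2 * ((e a).2 : ℕ) + sz (e b).1 := by
      simp only [xVal, hb, Nat.cast_zero] at h1
      have : (sz (e a).1 : ℝ) = 2 * ((e a).2 : ℕ) + sz (e b).1 := by linarith
      exact_mod_cast this
    have h3 := (e a).2.2
    have h4 : ((e a).2 : ℕ) + sz (e b).1 < sz (e a).1 := by omega
    set a' : Fin m := e.symm ⟨(e a).1, ⟨(e a).2 + sz (e b).1, h4⟩⟩ with ha'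
    have ha1 : (e a').1 = (e a).1 := by simp [ha']
    have ha2 : ((e a').2 : ℕ) = (e a).2 + sz (e b).1 := apply_symm_snd e _
    have h5 := congrFun (congrFun (hyp (sz (e b).1)) a') b
    rw [Matrix.mul_apply, Matrix.mul_apply, Finset.sum_eq_zero, Finset.sum_eq_single a] at h5
    · rw [yBlock_pow_apply, if_pos ⟨ha1, ha2⟩, one_mul] at h5
      exact hM h5.symm
    · intro c _ hc
      rw [yBlock_pow_apply, if_neg, zero_mul]
      exact fun h => hc (idx_ext e (h.1.symm.trans ha1) (by omega))
    · simp
    · intro c _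
      rw [yBlock_pow_apply, if_neg, mul_zero]
      rintro ⟨h6, h7⟩
      have h8 := (e c).2.2
      have h9 : sz (e c).1 = sz (e b).1 := by rw [h6]
      omega
  -- Any e_b is a power of y applied to the first vector of its block, and M commutes with that
  -- power.
  have h5 := congrFun (congrFun (hyp (e b).2) a) (initIdx e b)
  rw [Matrix.mul_apply, Matrix.mul_apply, Finset.sum_eq_single b] at h5
  · rw [yBlock_pow_apply, if_pos ⟨(initIdx_fst e b).symm, by rw [initIdx_snd, zero_add]⟩, mul_one]
      at h5
    rw [h5]
    refine Finset.sum_eq_zero fun c _ => ?_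
    rw [yBlock_pow_apply]
    split_ifs with h
    · rw [hinit c _ (initIdx_snd e b), mul_zero]
      rw [initIdx_fst, ← h.1]
      exact hab
    · rw [zero_mul]
  · intro c _ hc
    rw [yBlock_pow_apply, if_neg, mul_zero]
    rintro ⟨h1, h2⟩
    rw [initIdx_fst] at h1
    rw [initIdx_snd, zero_add] at h2
    exact hc (idx_ext e h1 h2)
  · simp

variable {A B g Q : Mat m}

/-- The frame at the right end which is determined by the vectors. -/
theorem right_frame_mul {w : κ → Fin m → ℂ} (hAB : (2 : ℂ) • (A * B - B * A) = B)
    (hw : ∀ j, A *ᵥ w j = (-((sz j : ℂ) - 1) / 4) • w j) (hw' : ∀ j, (B ^ sz j) *ᵥ w j = 0)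
    (hQ : ∀ a b, Q a b = ((B ^ ((e b).2 : ℕ)) *ᵥ w (e b).1) a) :
    A * Q = Q * xBlock e ∧ B * Q = Q * yBlock e := by
  have hcol : ∀ (M : Mat m) a b, (M * Q) a b = (M *ᵥ ((B ^ ((e b).2 : ℕ)) *ᵥ w (e b).1)) a := by
    intro M a b
    rw [Matrix.mul_apply, Matrix.mulVec, dotProduct]
    exact Finset.sum_congr rfl fun c _ => by rw [hQ]
  constructor
  · have hcomm : A * B = B * A + (1 / 2 : ℂ) • B := by
      have h2 : A * B = B * A + (1 / 2 : ℂ) • ((2 : ℂ) • (A * B - B * A)) := by module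
      rwa [hAB] at h2
    have heig : ∀ (j : κ) (r : ℕ), A *ᵥ ((B ^ r) *ᵥ w j) =
        (-((sz j : ℂ) - 1) / 4 + r / 2) • ((B ^ r) *ᵥ w j) := by
      intro j r
      induction r with
      | zero => simpa using hw j
      | succ r ih =>
        rw [pow_succ', ← Matrix.mulVec_mulVec, Matrix.mulVec_mulVec, hcomm, Matrix.add_mulVec,
          ← Matrix.mulVec_mulVec, ih, Matrix.smul_mulVec, Matrix.mulVec_smul]
        push_cast
        module
    ext a b
    rw [hcol, heig, xBlock, Matrix.mul_diagonal, hQ, Pi.smul_apply, smul_eq_mul, mul_comm, xVal]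
    push_cast
    rfl
  · ext a b
    rw [hcol, Matrix.mulVec_mulVec, ← pow_succ']
    have hb := (e b).2.2
    rcases eq_or_ne (((e b).2 : ℕ) + 1) (sz (e b).1) with h | h
    · rw [mul_yBlock_apply_of_last _ _ h, h, hw']
      rfl
    · obtain ⟨c, hc1, hc2⟩ := exists_succ (e := e) (b := b) (by omega)
      rw [mul_yBlock_apply_of_succ _ _ hc1 hc2, hQ, hc2, hc1]

theorem eq_of_residue {f : ℝ → Mat m} {F F' : Mat m}
    (h : WeightO (NahmNF.leftIdx m) 0 fun t => f t - ((t⁻¹ : ℝ) : ℂ) • F)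
    (h' : WeightO (NahmNF.leftIdx m) 0 fun t => f t - ((t⁻¹ : ℝ) : ℂ) • F') : F = F' := by
  have h1 := (h'.sub h).rpow_smul 1
  rw [add_zero] at h1
  have h2 : WeightO (NahmNF.leftIdx m) 1 fun _ => F - F' := by
    refine h1.congr ?_
    filter_upwards [self_mem_nhdsWithin] with t ht
    have ht0 : (t : ℂ) ≠ 0 := by exact_mod_cast (ne_of_gt ht : t ≠ 0)
    rw [Real.rpow_one, sub_sub_sub_cancel_left, ← smul_sub, smul_smul, Complex.ofReal_inv,
      mul_inv_cancel₀ ht0, one_smul]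
  ext a b
  exact sub_eq_zero.1 (tendsto_nhds_unique tendsto_const_nhds (h2.tendsto one_pos a b))

theorem commute_inv {X : Mat m} (hg : IsUnit g.det) (h : g * X = X * g) : g⁻¹ * X = X * g⁻¹ := by
  calc g⁻¹ * X = g⁻¹ * (X * g) * g⁻¹ := by
        rw [mul_assoc, mul_assoc, Matrix.mul_nonsing_inv _ hg, mul_one]
    _ = X * g⁻¹ := by rw [← h, ← mul_assoc, Matrix.nonsing_inv_mul _ hg, one_mul]

/-- The normal form at the right end. -/
theorem exists_right_gauge {l p : ℝ} {α β : ℝ → Mat m} (hlp : l < p) (hα : SmoothOn l p α)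
    (hβ : SmoothOn l p β)
    (heq : ∀ t ∈ Ioo l p, matDeriv β t + (2 : ℂ) • (α t * β t - β t * α t) = 0)
    (hg : IsUnit g.det)
    (hgα : WeightO e 0 fun t => g * -α (p - t) * g⁻¹ - ((t⁻¹ : ℝ) : ℂ) • xBlock e)
    (hgβ : WeightO e 0 fun t => g * -β (p - t) * g⁻¹ - ((t⁻¹ : ℝ) : ℂ) • yBlock e)
    (hA : WeightO (NahmNF.leftIdx m) 0 fun t => -α (p - t) - ((t⁻¹ : ℝ) : ℂ) • A)
    (hB : WeightO (NahmNF.leftIdx m) 0 fun t => -β (p - t) - ((t⁻¹ : ℝ) : ℂ) • B)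
    {w : κ → Fin m → ℂ}
    (hw : ∀ j, A *ᵥ w j = (-((sz j : ℂ) - 1) / 4) • w j) (hw' : ∀ j, (B ^ sz j) *ᵥ w j = 0)
    (hQ : IsUnit (Matrix.of fun a b => ((B ^ ((e b).2 : ℕ)) *ᵥ w (e b).1) a : Mat m).det) :
    ∃ c, l < c ∧ c < p ∧ ∃ h : ℝ → Mat m, IsGauge c p h ∧
      (∀ b, ((e b).2 : ℕ) = 0 → h p *ᵥ w (e b).1 = Pi.single b 1) ∧
      (∀ t ∈ Ioo c p, gaugeAlpha h α t = ((t : ℂ) - p)⁻¹ • xBlock e) ∧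
      (WeightO e 0 fun t => -gaugeBeta h β (p - t) - (t : ℂ)⁻¹ • yBlock e) ∧
      ∃ C : Mat m, ∀ t ∈ Ioo c p, gaugeBeta h β t = -normalBeta e C (p - t) := by
  set Q : Mat m := Matrix.of fun a b => ((B ^ ((e b).2 : ℕ)) *ᵥ w (e b).1) a with hQdef
  have hconj : ∀ {f : ℝ → Mat m} {F : Mat m},
      (WeightO (NahmNF.leftIdx m) 0 fun t => f t - ((t⁻¹ : ℝ) : ℂ) • F) →
      WeightO (NahmNF.leftIdx m) 0 fun t => g * f t * g⁻¹ - ((t⁻¹ : ℝ) : ℂ) • (g * F * g⁻¹) := by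
    intro f F hf
    have hc : ∀ M : Mat m, WeightO (NahmNF.leftIdx m) 0 fun _ => M := fun M =>
      weightO_const fun _ _ h => absurd rfl h
    refine ((((hc g).mul hf).mul (hc g⁻¹)).mono (s := 0) (by norm_num)).congr
      (Eventually.of_forall fun t => ?_)
    rw [mul_sub, sub_mul, mul_smul_comm, smul_mul_assoc]
  have hAX : g * A * g⁻¹ = xBlock e := eq_of_residue (hconj hA) hgα.leftIdx
  have hBY : g * B * g⁻¹ = yBlock e := eq_of_residue (hconj hB) hgβ.leftIdx
  have hinv : ∀ M : Mat m, g⁻¹ * (g * M) = M := fun M => by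
    rw [← mul_assoc, Matrix.nonsing_inv_mul _ hg, one_mul]
  have hgA : g * A = xBlock e * g := by
    rw [← hAX, mul_assoc _ g⁻¹, Matrix.nonsing_inv_mul _ hg, mul_one]
  have hgB : g * B = yBlock e * g := by
    rw [← hBY, mul_assoc _ g⁻¹, Matrix.nonsing_inv_mul _ hg, mul_one]
  have hAB : (2 : ℂ) • (A * B - B * A) = B := by
    have h1 : g * ((2 : ℂ) • (A * B - B * A)) = g * B := by
      rw [hgB]
      conv_rhs => rw [← xBlock_yBlock_commutator]
      rw [mul_smul_comm, smul_mul_assoc, mul_sub, sub_mul, ← mul_assoc, ← mul_assoc, hgA, hgB,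
        mul_assoc, mul_assoc, hgA, hgB, ← mul_assoc, ← mul_assoc]
    rw [← hinv ((2 : ℂ) • (A * B - B * A)), h1, hinv]
  obtain ⟨hAQ, hBQ⟩ := right_frame_mul (Q := Q) (e := e) hAB hw hw' (fun a b => rfl)
  have hG : IsUnit (g * Q).det := by
    rw [Matrix.det_mul]
    exact hg.mul hQ
  have hGX : (g * Q) * xBlock e = xBlock e * (g * Q) := by
    rw [mul_assoc, ← hAQ, ← mul_assoc, hgA, mul_assoc]
  have hGY : (g * Q) * yBlock e = yBlock e * (g * Q) := by
    rw [mul_assoc, ← hBQ, ← mul_assoc, hgB, mul_assoc]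
  -- As gQ commutes with x and y, it does not mix blocks of different sizes; conjugation by it
  -- respects the weights and transfers the estimates from the frame g to Q⁻¹.
  have hW : WeightO e 0 fun _ => g * Q :=
    weightO_const fun a b hab => apply_eq_zero_of_commute hGX hGY hab
  have hW' : WeightO e 0 fun _ => (g * Q)⁻¹ :=
    weightO_const fun a b hab => apply_eq_zero_of_commute (commute_inv hG hGX)
      (commute_inv hG hGY) hab
  have hQ' : IsUnit (Q⁻¹).det := by
    rw [Matrix.det_nonsing_inv]
    exact (isUnit_ringInverse).2 hQ
  have hloc : ∀ {f : ℝ → Mat m} {X : Mat m}, (g * Q) * X = X * (g * Q) →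
      (WeightO e 0 fun t => g * -f (p - t) * g⁻¹ - ((t⁻¹ : ℝ) : ℂ) • X) →
      WeightO e 0 fun t => -(Q⁻¹ * f (p - t) * Q⁻¹⁻¹) - ((t⁻¹ : ℝ) : ℂ) • X := by
    intro f X hX hf
    refine (((hW'.mul hf).mul hW).mono (s := 0) (by norm_num)).congr
      (Eventually.of_forall fun t => ?_)
    have h1 : (g * Q)⁻¹ * X * (g * Q) = X := by
      rw [mul_assoc, ← hX, ← mul_assoc, Matrix.nonsing_inv_mul _ hG, one_mul]
    rw [mul_sub, sub_mul, mul_smul_comm, smul_mul_assoc, h1, Matrix.mul_inv_rev,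
      Matrix.nonsing_inv_nonsing_inv _ hQ]
    congr 1
    simp only [mul_assoc, hinv, neg_mul, mul_neg]
  have hε : 0 < p - l := sub_pos.2 hlp
  have hα₁ : SmoothOn 0 (p - l) fun t => Q⁻¹ * α (p - t) * Q⁻¹⁻¹ :=
    ((SmoothOn.const Q⁻¹).mul (hα.reflect (by linarith) le_rfl)).mul (SmoothOn.const Q⁻¹⁻¹)
  have hβ₁ : SmoothOn 0 (p - l) fun t => Q⁻¹ * β (p - t) * Q⁻¹⁻¹ :=
    ((SmoothOn.const Q⁻¹).mul (hβ.reflect (by linarith) le_rfl)).mul (SmoothOn.const Q⁻¹⁻¹)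
  obtain ⟨η, hη0, hηε, f, hf, hf0, hfα, hfw, C, hfβ⟩ := exists_local_normal_form (e := e)
    (α := fun t => -(Q⁻¹ * α (p - t) * Q⁻¹⁻¹)) (β := fun t => -(Q⁻¹ * β (p - t) * Q⁻¹⁻¹)) hε
    hα₁.neg hβ₁.neg
    (fun t ht => by
      have ht' : p - t ∈ Ioo l p := ⟨by linarith [ht.2], by linarith [ht.1]⟩
      exact ((hasMatDeriv_of_complex hβ ht' (heq _ ht')).conj hQ').reflect
        (β := fun s => Q⁻¹ * β s * Q⁻¹⁻¹))
    (hloc hGX hgα) (hloc hGY hgβ)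
  have hsub : ContDiff ℝ ∞ fun t : ℝ => p - t := contDiff_const.sub contDiff_id
  have hh : IsGauge (p - η) p fun t => f (p - t) * Q⁻¹ :=
    (hf.comp hsub
      (fun t ht => ⟨by linarith [ht.2], by linarith [ht.1]⟩)
      (fun t ht => ⟨by linarith [ht.2], by linarith [ht.1]⟩)).mul (IsGauge.const hQ')
  have hbeta : ∀ t, gaugeBeta (fun t => f (p - t) * Q⁻¹) β t =
      -gaugeBeta f (fun t => -(Q⁻¹ * β (p - t) * Q⁻¹⁻¹)) (p - t) := fun t => by
    rw [gaugeBeta_mul_const, gaugeBeta_reflect]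
  refine ⟨p - η, by linarith, by linarith, _, hh, fun b hb => ?_, fun t ht => ?_, ?_, C,
    fun t ht => ?_⟩
  -- The gauge transformation equals Q⁻¹ at p, and Q maps e_b to the given vector when b is first in
  -- its block.
  · have h1 : Q *ᵥ Pi.single b 1 = w (e b).1 := by
      rw [Matrix.mulVec_single_one]
      funext a
      simp [hQdef, hb]
    rw [sub_self, hf0, one_mul, ← h1, Matrix.mulVec_mulVec, Matrix.nonsing_inv_mul _ hQ,
      Matrix.one_mulVec]
  · have ht' : p - t ∈ Ioo 0 η := ⟨by linarith [ht.2], by linarith [ht.1]⟩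
    have hd : HasMatDeriv (fun s => f (p - s)) _ t :=
      fun a b => (hf.smooth.hasMatDeriv ht' a b).comp_const_sub p t
    rw [gaugeAlpha_mul_const hd hQ', gaugeAlpha_reflect, hfα _ ht', ← neg_smul, ← inv_neg]
    push_cast
    rw [neg_sub]
  · refine hfw.congr (Eventually.of_forall fun t => ?_)
    rw [hbeta, neg_neg, sub_sub_cancel]
  · rw [hbeta, hfβ _ ⟨by linarith [ht.2], by linarith [ht.1]⟩]

end Right

/-! ### The block structure given by `k` -/

section Blocks

variable {n : ℕ} {k : Fin n → ℕ}

theorem xRight_eq (k : Fin n → ℕ) : xRight k = xBlock (idx k).symm := by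
  ext a b
  rw [xRight, Matrix.reindex_apply, Matrix.submatrix_apply, xBlock]
  rcases eq_or_ne a b with rfl | hab
  · rw [Matrix.diagonal_apply_eq, Matrix.blockDiagonal'_apply_eq, xMat, Matrix.diagonal_apply_eq,
      xVal]
    push_cast
    ring
  · rw [Matrix.diagonal_apply_ne _ hab]
    have h1 : (idx k).symm a ≠ (idx k).symm b := (idx k).symm.injective.ne hab
    generalize (idx k).symm a = x at h1 ⊢
    generalize (idx k).symm b = y at h1 ⊢
    obtain ⟨i, s⟩ := x
    obtain ⟨j, t⟩ := y
    rcases eq_or_ne i j with rfl | hij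
    · rw [Matrix.blockDiagonal'_apply_eq, xMat, Matrix.diagonal_apply_ne]
      rintro rfl
      exact h1 rfl
    · rw [Matrix.blockDiagonal'_apply_ne _ _ _ hij]

theorem yRight_eq (k : Fin n → ℕ) : yRight k = yBlock (idx k).symm := by
  ext a b
  rw [yRight, Matrix.reindex_apply, Matrix.submatrix_apply, yBlock, Matrix.of_apply]
  generalize (idx k).symm a = x
  generalize (idx k).symm b = y
  obtain ⟨i, s⟩ := x
  obtain ⟨j, t⟩ := y
  rcases eq_or_ne i j with rfl | hij
  · simp [Matrix.blockDiagonal'_apply_eq, yMat]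
  · simp [Matrix.blockDiagonal'_apply_ne _ _ _ hij, hij]

/-- The blocks are listed in the reverse order of `k`, so those preceding a block have the larger
indices in `k`. -/
theorem val_eq_sum_of_pos_eq_zero {b : Fin (dim k)} (hb : pos k b = 0) :
    (b : ℕ) = ∑ j ∈ Finset.Ioi (blk k b).rev, k j := by
  have h1 : ∀ y, (idx k y : ℕ) = ∑ i : Fin y.1, blockSize k (Fin.castLE y.1.2.le i) + y.2 :=
    fun y => finSigmaFinEquiv_apply y
  have h2 : (b : ℕ) = ∑ i : Fin (blk k b).val, blockSize k (Fin.castLE (blk k b).2.le i) +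
      pos k b := by
    conv_lhs => rw [← (idx k).apply_symm_apply b, h1]
    rfl
  rw [hb, add_zero] at h2
  rw [h2]
  refine Finset.sum_bij (fun i _ => (Fin.castLE (blk k b).2.le i).rev) (fun i _ => ?_)
    (fun i _ j _ h => ?_) (fun j hj => ?_) (fun i _ => rfl)
  · rw [Finset.mem_Ioi, Fin.rev_lt_rev, Fin.lt_def]
    exact i.2
  · exact Fin.castLE_injective _ (Fin.rev_injective h)
  · rw [Finset.mem_Ioi, ← Fin.rev_lt_rev, Fin.rev_rev, Fin.lt_def] at hj
    exact ⟨⟨j.rev, hj⟩, Finset.mem_univ _, by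
      have : Fin.castLE (blk k b).2.le ⟨(j.rev : ℕ), hj⟩ = j.rev := rfl
      rw [this, Fin.rev_rev]⟩

theorem stdVec_eq {b : Fin (dim k)} (hb : pos k b = 0) :
    stdVec k (blk k b).rev = Pi.single b 1 := by
  funext a
  rw [stdVec, ← val_eq_sum_of_pos_eq_zero hb, Pi.single_apply]
  simp only [Fin.ext_iff]

theorem exists_idx (hk : ∀ i, 0 < k i) (i : Fin n) :
    ∃ b : Fin (dim k), pos k b = 0 ∧ (blk k b).rev = i := by
  refine ⟨idx k ⟨i.rev, ⟨0, ?_⟩⟩, ?_, ?_⟩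
  · rw [blockSize, Fin.rev_rev]
    exact hk i
  · exact apply_symm_snd (idx k).symm _
  · rw [blk, Equiv.symm_apply_apply, Fin.rev_rev]

theorem tendsto_const_sub_nhdsGT (p : ℝ) : Tendsto (fun t => p - t) (𝓝[>] 0) (𝓝[<] p) := by
  refine tendsto_nhdsWithin_iff.2 ⟨?_, ?_⟩
  · exact ((continuous_const.sub continuous_id).tendsto' 0 p (by simp)).mono_left
      nhdsWithin_le_nhds
  · filter_upwards [self_mem_nhdsWithin] with t ht
    have : 0 < t := ht
    exact sub_lt_self p this

theorem tendsto_const_sub_nhdsLT (p : ℝ) : Tendsto (fun t => p - t) (𝓝[<] p) (𝓝[>] 0) := by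
  refine tendsto_nhdsWithin_iff.2 ⟨?_, ?_⟩
  · exact ((continuous_const.sub continuous_id).tendsto' p 0 (by simp)).mono_left
      nhdsWithin_le_nhds
  · filter_upwards [self_mem_nhdsWithin] with t ht
    have : t < p := ht
    exact sub_pos.2 this

/-- Under t = p - s the pole X/(t - p) becomes -X/s, whence the sign in front of f. -/
theorem halfPowerForm_iff {p : ℝ} {f : ℝ → Mat (dim k)} {X : Mat (dim k)} :
    HalfPowerForm k p f X ↔
      WeightO (idx k).symm 0 fun t => -f (p - t) - ((t⁻¹ : ℝ) : ℂ) • X := by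
  refine forall_congr' fun a => forall_congr' fun b => ⟨fun h => ?_, fun h => ?_⟩
  · refine ((h.comp_tendsto (tendsto_const_sub_nhdsGT p)).neg_left).congr' ?_ ?_
    · refine Eventually.of_forall fun t => ?_
      simp only [Function.comp, Matrix.sub_apply, Matrix.neg_apply, Matrix.smul_apply, smul_eq_mul]
      push_cast
      rw [sub_sub_cancel_left, div_neg]
      ring
    · filter_upwards [self_mem_nhdsWithin] with t ht
      have ht : 0 < t := ht
      simp only [Function.comp]
      rw [sub_sub_cancel_left, abs_neg, abs_of_pos ht, zero_add]
      rfl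
  · refine ((h.comp_tendsto (tendsto_const_sub_nhdsLT p)).neg_left).congr' ?_ ?_
    · refine Eventually.of_forall fun t => ?_
      simp only [Function.comp, Matrix.sub_apply, Matrix.neg_apply, Matrix.smul_apply, smul_eq_mul,
        sub_sub_cancel]
      have h1 : (t : ℂ) - p = -((p - t : ℝ) : ℂ) := by push_cast; ring
      rw [h1, div_neg, Complex.ofReal_inv]
      ring
    · filter_upwards [self_mem_nhdsWithin] with t ht
      have ht : t < p := ht
      simp only [Function.comp]
      rw [← abs_neg, neg_sub, abs_of_pos (sub_pos.2 ht), zero_add]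
      rfl

theorem hasResidueLeft_iff {m : ℕ} {p : ℝ} {f : ℝ → Mat m} {A : Mat m} :
    HasResidueLeft p f A ↔
      WeightO (leftIdx m) 0 fun t => -f (p - t) - ((t⁻¹ : ℝ) : ℂ) • A := by
  rw [weightO_leftIdx_iff]
  refine forall_congr' fun a => forall_congr' fun b => ⟨fun h => ?_, fun h => ?_⟩
  · refine ((h.comp_tendsto (tendsto_const_sub_nhdsGT p)).neg_left).congr_left fun t => ?_
    simp only [Function.comp, Matrix.sub_apply, Matrix.neg_apply, Matrix.smul_apply, smul_eq_mul]
    push_cast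
    rw [sub_sub_cancel_left, div_neg]
    ring
  · refine ((h.comp_tendsto (tendsto_const_sub_nhdsLT p)).neg_left).congr_left fun t => ?_
    simp only [Function.comp, Matrix.sub_apply, Matrix.neg_apply, Matrix.smul_apply, smul_eq_mul,
      sub_sub_cancel]
    have h1 : (t : ℂ) - p = -((p - t : ℝ) : ℂ) := by push_cast; ring
    rw [h1, div_neg, Complex.ofReal_inv]
    ring

/-- For z < 0 the principal power z^μ is (-z)^μ exp(πiμ). The phase depends only on the entry, so it
is absorbed into the constants, together with the sign from reversing time. -/
theorem exists_betaRightSt (hk : ∀ i, 0 < k i) (C : Mat (dim k)) :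
    ∃ C' : Matrix (Fin (dim k)) (Fin n) ℂ, ∀ z : ℝ, z < 0 →
      -normalBeta (idx k).symm C (-z) = betaRightSt k C' z := by
  have hpos : ∀ j : Fin n, blockSize k j - 1 < blockSize k j := fun j =>
    Nat.sub_lt (hk j.rev) one_pos
  refine ⟨Matrix.of fun a j => -(C a (idx k ⟨j, ⟨_, hpos j⟩⟩) *
    Complex.exp (-(Real.pi * Complex.I * (((blockSize k j : ℂ) + (blockSize k (blk k a) : ℂ)) / 2
      - ((pos k a : ℂ) + 1))))), fun z hz => ?_⟩
  ext a b
  have hblk : ∀ a, ((idx k).symm a).1 = blk k a := fun _ => rfl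
  have hp : ∀ a, (((idx k).symm a).2 : ℕ) = pos k a := fun _ => rfl
  simp only [Matrix.neg_apply, normalBeta, betaRightSt, Matrix.of_apply, hblk, hp]
  split_ifs with h1 h2
  · have hlast : idx k ⟨blk k b, ⟨_, hpos (blk k b)⟩⟩ = b := by
      refine idx_ext (idx k).symm (by simp [hblk]) ?_
      refine (apply_symm_snd (idx k).symm _).trans ?_
      rw [hp]
      simp only
      omega
    rw [hlast, Complex.ofReal_cpow_of_nonpos hz.le, Complex.ofReal_cpow (neg_nonneg.2 hz.le),
      Complex.exp_neg]
    push_cast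
    field_simp
  · push_cast
    rw [inv_neg, neg_neg]
  · simp

end Blocks

/-! ### The standard complex -/

section Standard

theorem gaugeAlpha_congr {m : ℕ} {g h α : ℝ → Mat m} {t : ℝ} (hgh : g =ᶠ[𝓝 t] h) :
    gaugeAlpha g α t = gaugeAlpha h α t := by
  have h1 : matDeriv g t = matDeriv h t := by
    ext a b
    exact Filter.EventuallyEq.deriv_eq (hgh.mono fun s hs => by simp only [hs])
  simp only [gaugeAlpha, h1, hgh.self_of_nhds]

theorem span_yMat_pow {m : ℕ} :
    Submodule.span ℂ (Set.range fun r : ℕ =>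
      (yMat m ^ r) *ᵥ fun a : Fin m => if (a : ℕ) = 0 then (1 : ℂ) else 0) = ⊤ := by
  rw [← top_le_iff, ← (Pi.basisFun ℂ (Fin m)).span_eq]
  refine Submodule.span_mono ?_
  rintro _ ⟨i, rfl⟩
  refine ⟨i, ?_⟩
  have h0 : (fun a : Fin m => if (a : ℕ) = 0 then (1 : ℂ) else 0) = Pi.single ⟨0, i.pos⟩ 1 := by
    funext a
    simp [Pi.single_apply, Fin.ext_iff]
  simp only [h0, Matrix.mulVec_single_one, ← yBlock_leftIdx]
  funext a
  rw [Matrix.col_apply, yBlock_pow_apply, Pi.basisFun_apply, Pi.single_apply]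
  congr 1
  refine propext ⟨fun h => Fin.ext (h.2.trans (zero_add _)), ?_⟩
  rintro rfl
  exact ⟨rfl, (zero_add _).symm⟩

/-- The entries involving q are polynomial in z; only the off-diagonal ones have a pole. -/
theorem meroSimplePoleRight_companionSt {m : ℕ} {p : ℝ} {β : ℝ → Mat m} {q : Fin m → ℂ}
    (h : ∀ᶠ t in 𝓝[>] p, β t = (companionSt q (t - p))ᵀ) :
    MeroSimplePoleRight p β (yLeft m) := by
  intro a b
  refine ⟨fun s => if (a : ℕ) + 1 = m then -((s - p) ^ (m - 1 - (b : ℕ)) * q b) else 0, ?_, ?_⟩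
  · split_ifs
    · fun_prop
    · fun_prop
  · filter_upwards [h] with t ht
    simp only [ht, Matrix.transpose_apply, companionSt, Matrix.of_apply, yLeft, yMat]
    by_cases h1 : (a : ℕ) + 1 = m
    · rw [if_pos h1, if_neg (by omega), if_pos h1]
      push_cast
      ring
    · rw [if_neg h1, if_neg h1]
      split_ifs
      · push_cast
        ring
      · simp

variable {n : ℕ} {k : Fin n → ℕ}

/-- Pairs of the standard form are Nahm complexes. -/
theorem isNahmComplex_std (hk : ∀ i, 0 < k i) {l₁ lN : ℝ}
    {α β : ℝ → Mat (dim k)} (hα : SmoothOn l₁ lN α) (hβ : SmoothOn l₁ lN β)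
    (heq : ∀ t ∈ Ioo l₁ lN, matDeriv β t + (2 : ℂ) • (α t * β t - β t * α t) = 0)
    {q : Fin (dim k) → ℂ}
    (hαl : ∀ᶠ t : ℝ in 𝓝[>] l₁, α t = ((t : ℂ) - l₁)⁻¹ • xLeft (dim k))
    (hβl : ∀ᶠ t : ℝ in 𝓝[>] l₁, β t = (companionSt q (t - l₁))ᵀ)
    (hαr : HalfPowerForm k lN α (xRight k)) (hβr : HalfPowerForm k lN β (yRight k)) :
    IsNahmComplex k l₁ lN α β (stdRow k) (stdVec k) where
  smooth_alpha := hα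
  smooth_beta := hβ
  complex_eq := heq
  left_end := by
    refine ⟨xLeft (dim k), yLeft (dim k), fun a b => ⟨fun _ => 0, analyticAt_const, ?_⟩,
      meroSimplePoleRight_companionSt hβl, ⟨1, by simp, by simp⟩, ⟨1, by simp, by simp⟩, ?_, ?_⟩
    · filter_upwards [hαl] with t ht
      rw [ht, Matrix.smul_apply, smul_eq_mul]
      ring
    · rw [xLeft_eq, Matrix.diagonal_transpose]
      funext a
      rw [Matrix.mulVec_diagonal, Pi.smul_apply, smul_eq_mul, stdRow]
      split_ifs with h
      · simp [h]
      · simp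
    · rw [yLeft, Matrix.transpose_transpose]
      exact span_yMat_pow
  right_end := ⟨1, by simp, by simpa using hαr, by simpa using hβr⟩
  right_vectors := by
    have hcol : ∀ (p : ℕ) (b : Fin (dim k)), pos k b = 0 →
        (yRight k ^ p) *ᵥ stdVec k (blk k b).rev = fun a => (yRight k ^ p) a b := by
      intro p b hb
      rw [stdVec_eq hb, Matrix.mulVec_single_one]
      rfl
    refine ⟨xRight k, yRight k, hasResidueLeft_iff.2 (halfPowerForm_iff.1 hαr).leftIdx,
      hasResidueLeft_iff.2 (halfPowerForm_iff.1 hβr).leftIdx, fun i => ?_, ?_, fun i => ?_⟩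
    · obtain ⟨b, hb, rfl⟩ := exists_idx hk i
      rw [stdVec_eq hb, xRight_eq, xBlock]
      funext a
      rw [Matrix.mulVec_diagonal, Pi.smul_apply, smul_eq_mul]
      rcases eq_or_ne a b with rfl | hab
      · have h1 : (((idx k).symm a).2 : ℕ) = 0 := hb
        rw [Pi.single_eq_same, mul_one, mul_one, xVal, h1]
        push_cast
        rw [zero_div, add_zero]
        rfl
      · simp [hab]
    -- Powers of y_N shift the first basis vector of each block through that block, so the matrix of
    -- columns is the identity.
    · have h1 : (Matrix.of fun a b => ((yRight k ^ pos k b) *ᵥ stdVec k (blk k b).rev) a :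
          Mat (dim k)) = 1 := by
        ext a b
        have h2 : blk k (initIdx (idx k).symm b) = blk k b := initIdx_fst (idx k).symm b
        have h3 : pos k (initIdx (idx k).symm b) = 0 := initIdx_snd (idx k).symm b
        rw [Matrix.of_apply, ← h2, hcol _ _ h3, yRight_eq]
        refine (yBlock_pow_apply _ _ _).trans ?_
        rw [Matrix.one_apply]
        congr 1
        refine propext ⟨fun h => idx_ext (idx k).symm (h.1.trans h2) ?_, ?_⟩
        · exact h.2.trans (by rw [initIdx_snd, zero_add]; rfl)
        · rintro rfl
          exact ⟨h2.symm, by rw [initIdx_snd, zero_add]; rfl⟩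
      rw [h1, Matrix.det_one]
      exact one_ne_zero
    · obtain ⟨b, hb, rfl⟩ := exists_idx hk i
      rw [hcol _ _ hb, yRight_eq]
      funext a
      rw [yBlock_pow_apply, if_neg]
      · rfl
      · rintro ⟨h1, h2⟩
        have h3 := ((idx k).symm a).2.2
        have h4 : blockSize k ((idx k).symm a).1 = k (blk k b).rev := by
          rw [h1]
          rfl
        have h5 : (((idx k).symm b).2 : ℕ) = 0 := hb
        omega

/-- Every Nahm complex is equivalent to one of the standard form. -/
theorem exists_standard_form (hk : ∀ i, 0 < k i) {l₁ lN : ℝ} (hl : l₁ < lN)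
    {α β : ℝ → Mat (dim k)} {v₁ : Fin (dim k) → ℂ} {w : Fin n → Fin (dim k) → ℂ}
    (h : IsNahmComplex k l₁ lN α β v₁ w) :
    ∃ α' β' : ℝ → Mat (dim k),
      IsNahmComplex k l₁ lN α' β' (stdRow k) (stdVec k) ∧
      GaugeEquiv l₁ lN α β v₁ w α' β' (stdRow k) (stdVec k) ∧
      IsStandardForm k l₁ lN α' β' := by
  obtain ⟨A, B, hA, hB, -, hBy, hv, hspan⟩ := h.left_end
  obtain ⟨c, hc1, hc2, gL, hgL, hgv, q, hgLt⟩ := exists_left_gauge hl h.smooth_alpha h.smooth_beta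
    h.complex_eq hA hB hBy hv hspan
  obtain ⟨G, hG, hGα, hGβ⟩ := h.right_end
  obtain ⟨A', B', hA', hB', hAw, hdet, hBw⟩ := h.right_vectors
  rw [halfPowerForm_iff, xRight_eq] at hGα
  rw [halfPowerForm_iff, yRight_eq] at hGβ
  rw [hasResidueLeft_iff] at hA' hB'
  obtain ⟨d, hd1, hd2, gR, hgR, hgw, hgRα, hgRw, C, hgRβ⟩ := exists_right_gauge
    (e := (idx k).symm) (g := G) hl h.smooth_alpha h.smooth_beta h.complex_eq hG
    (by simpa only [mul_neg, neg_mul] using hGα) (by simpa only [mul_neg, neg_mul] using hGβ)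
    hA' hB' (w := fun j => w j.rev) (fun j => hAw j.rev) (fun j => hBw j.rev)
    (isUnit_iff_ne_zero.2 hdet)
  -- An intermediate point separates the domains of the two local gauge transformations.
  obtain ⟨x, hx1, hx2⟩ := exists_between hl
  obtain ⟨g, hg, ⟨p, hp, hgp⟩, r, hr, hgr⟩ := exists_gauge_glue (c := min c x) (d := max d x)
    (lt_min hc1 hx1) ((min_le_right _ _).trans (le_max_right _ _)) (max_lt hd2 hx2)
    (hgL.mono le_rfl (min_le_left _ _)) (hgR.mono (le_max_left _ _) le_rfl)
  have hu : ∀ t ∈ Ioo l₁ lN, IsUnit (g t).det := fun t ht =>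
    hg.invertible t (Ioo_subset_Icc_self ht)
  have hl1 : ∀ t ∈ Ioo l₁ (min p c), gaugeAlpha g α t = ((t : ℂ) - l₁)⁻¹ • xLeft (dim k) ∧
      gaugeBeta g β t = (companionSt q (t - l₁))ᵀ := by
    intro t ht
    have ht1 : t < p := ht.2.trans_le (min_le_left _ _)
    have ht2 : t ∈ Ioo l₁ c := ⟨ht.1, ht.2.trans_le (min_le_right _ _)⟩
    rw [← (hgLt t ht2).1, ← (hgLt t ht2).2]
    refine ⟨gaugeAlpha_congr ?_, by rw [gaugeBeta, gaugeBeta, hgp t ht1.le]⟩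
    filter_upwards [gt_mem_nhds ht1] with s hs using hgp s (le_of_lt hs)
  have hl2 : ∀ᶠ t : ℝ in 𝓝[>] l₁, t ∈ Ioo l₁ (min p c) := Ioo_mem_nhdsGT (lt_min hp hc1)
  have hr1 : ∀ t ∈ Ioo (max r d) lN, gaugeAlpha g α t = ((t : ℂ) - lN)⁻¹ • xRight k ∧
      gaugeBeta g β t = gaugeBeta gR β t := by
    intro t ht
    have ht1 : r < t := (le_max_left _ _).trans_lt ht.1
    have ht2 : t ∈ Ioo d lN := ⟨(le_max_right _ _).trans_lt ht.1, ht.2⟩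
    rw [xRight_eq, ← hgRα t ht2]
    refine ⟨gaugeAlpha_congr ?_, by rw [gaugeBeta, gaugeBeta, hgr t ht1.le]⟩
    filter_upwards [lt_mem_nhds ht1] with s hs using hgr s (le_of_lt hs)
  have hr2 : ∀ᶠ t : ℝ in 𝓝[<] lN, t ∈ Ioo (max r d) lN := Ioo_mem_nhdsLT (max_lt hr hd2)
  have hαs : SmoothOn l₁ lN (gaugeAlpha g α) := by
    have hinv := hg.smooth.inv hu
    exact ((hg.smooth.mul h.smooth_alpha).mul hinv).sub ((hg.smooth.matDeriv.mul hinv).smul _)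
  have hβs : SmoothOn l₁ lN (gaugeBeta g β) :=
    (hg.smooth.mul h.smooth_beta).mul (hg.smooth.inv hu)
  have hαr : HalfPowerForm k lN (gaugeAlpha g α) (xRight k) := by
    intro a b
    refine (isBigO_zero _ _).congr' ?_ EventuallyEq.rfl
    filter_upwards [hr2] with t ht
    rw [(hr1 t ht).1, Matrix.smul_apply, smul_eq_mul]
    ring
  -- The explicit form does not imply this for arbitrary C, since its exponents may be negative. The
  -- bound comes from the weighted estimate in the local normal form.
  have hβr : HalfPowerForm k lN (gaugeBeta g β) (yRight k) := by
    rw [halfPowerForm_iff, yRight_eq]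
    refine hgRw.congr ?_
    filter_upwards [(tendsto_const_sub_nhdsGT lN).eventually hr2] with t ht
    rw [(hr1 _ ht).2, Complex.ofReal_inv]
  obtain ⟨C', hC'⟩ := exists_betaRightSt hk C
  refine ⟨gaugeAlpha g α, gaugeBeta g β, ?_, ⟨g, hg, fun t _ => ⟨rfl, rfl⟩, ?_, fun i => ?_⟩, ?_⟩
  · refine isNahmComplex_std hk hαs hβs (fun t ht => ?_) (hl2.mono fun t ht => (hl1 t ht).1)
      (hl2.mono fun t ht => (hl1 t ht).2) hαr hβr
    rw [((hg.smooth.hasMatDeriv ht).gaugeBeta (hu t ht)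
      (hasMatDeriv_of_complex h.smooth_beta ht (h.complex_eq t ht))).matDeriv_eq, neg_add_cancel]
  · rw [hgp l₁ hp.le, hgv]
    rfl
  · obtain ⟨b, hb, rfl⟩ := exists_idx hk i
    rw [hgr lN hr.le, stdVec_eq hb]
    exact (hgw b hb).symm
  · refine ⟨⟨q, hl2.mono fun t ht => ⟨gaugeAlpha_gSt q ht.1 (hl1 t ht).1, (hl1 t ht).2⟩⟩,
      hr2.mono fun t ht => (hr1 t ht).1, ⟨C', hr2.mono fun t ht => ?_⟩, fun a b hab => ?_⟩
    · rw [(hr1 t ht).2, hgRβ t ⟨(le_max_right _ _).trans_lt ht.1, ht.2⟩,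
        ← hC' _ (sub_neg.2 ht.2), neg_sub]
    · have h0 : yRight k a b = 0 := by
        rw [yRight_eq, yBlock, Matrix.of_apply, if_neg]
        exact fun h' => hab h'.1
      have h1 := hβr a b
      simpa only [h0, zero_div, sub_zero] using h1

end Standard

end NahmNF

end

/-! ### The normal form theorem -/

theorem mainTheorem10 {n : ℕ} (hn : 2 ≤ n) (k : Fin n → ℕ) (hk : ∀ i, 0 < k i)
    (l₁ lN : ℝ) (hl : l₁ < lN)
    (α β : ℝ → NahmNF.Mat (NahmNF.dim k)) (v₁ : Fin (NahmNF.dim k) → ℂ)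
    (w : Fin n → Fin (NahmNF.dim k) → ℂ)
    (h : NahmNF.IsNahmComplex k l₁ lN α β v₁ w) :
    (∀ a b : ℝ, l₁ < a → a < b → b < lN →
      ∃ g : ℝ → NahmNF.Mat (NahmNF.dim k), NahmNF.IsGauge l₁ lN g ∧
        ∃ β₀ : NahmNF.Mat (NahmNF.dim k), ∀ t ∈ Set.Icc a b,
          NahmNF.gaugeAlpha g α t = 0 ∧ NahmNF.gaugeBeta g β t = β₀) ∧
    (∃ α' β' : ℝ → NahmNF.Mat (NahmNF.dim k),
      NahmNF.IsNahmComplex k l₁ lN α' β' (NahmNF.stdRow k) (NahmNF.stdVec k) ∧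
      NahmNF.GaugeEquiv l₁ lN α β v₁ w α' β' (NahmNF.stdRow k) (NahmNF.stdVec k) ∧
      NahmNF.IsStandardForm k l₁ lN α' β') :=
  ⟨fun _ _ hla hab hbu =>
    NahmNF.exists_gauge_const h.smooth_alpha h.smooth_beta h.complex_eq hla hab hbu,
    NahmNF.exists_standard_form hk hl h⟩
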